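/- **Setting.** Let $(\widetilde M,\widetilde g_{ab})$ be a four-dimensional spacetime, of signature $(-,+,+,+)$, satisfying the Einstein equations $\widetilde R_{ab}-\frac12\widetilde R\,\widetilde g_{ab}+\Lambda\widetilde g_{ab}=\widetilde T_{ab}$ with $\Lambda>0$. Suppose that it has a conformal extension: a smooth manifold $M$ with boundary $\Sigma$, a smooth Lorentzian metric $g_{ab}$ on $M$, a smooth function $\Omega\ge 0$ on $M$ with $\Sigma=\Omega^{-1}(0)$ and $d\Omega\ne0$ on $\Sigma$, and an embedding of $\widetilde M$ onto $M\setminus\Sigma$ under which $\widetilde g_{ab}=\Omega^{-2}g_{ab}$. Let $q\in\{0,1,2\}$ and suppose that $\widetilde T_{ab}=\Omega^q\tau_{ab}$ with $\tau_{ab}$ smooth on $M$ (so that $\tau_{ab}$ and $\Omega$ represent, in the scale $g_{ab}$, the stress-energy density of weight $-q$ and the scale density $\widetilde\sigma$). **Notation.** Indices are raised with $g^{ab}$; $\nabla$ is the Levi-Civita connection of $g_{ab}$; $\Delta=\nabla^a\nabla_a$; $\lambda=\Lambda/3$; $n_a=\lambda^{-1/2}\nabla_a\Omega$; an index $n$ denotes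 contraction with $n^a$, and $\nabla_n=n^a\nabla_a$; $\tau=g^{ab}\tau_{ab}$. The superscript $\top$ is the orthogonal projection on the annihilator of $n^a$ (near $\Sigma$); $\overline g_{ab}=g^{\top}_{ab}$; $\mathring\top$ is the part of the projection that is trace-free with respect to $\overline g_{ab}$; $\overline\nabla$ is the Levi-Civita connection of the metric induced on $\Sigma$ (on functions, $\overline\nabla_a f=\overline g_a{}^c\nabla_c f$); $K_{ab}=(\nabla_an_b)^\top$ and $H=\overline g^{ab}K_{ab}$. Curvature: $[\nabla_a,\nabla_b]v^c=R_{ab}{}^c{}_dv^d$, $R_{bd}=R_{ab}{}^a{}_d$, $P_{ab}=\frac12(R_{ab}-\frac16Rg_{ab})$, $J=g^{ab}P_{ab}$, $C_{abcd}$ is the Weyl tensor, $A_{abc}=\nabla_bP_{ca}-\nabla_cP_{ba}$, $B_{ab}=-\nabla^cA_{abc}+P^{dc}C_{dacb}$. In $\nabla_n\tau^\top_{ab}$, $\nabla_n\tau^\top_{an}$ and $\nabla_n\tau_{nn}$ the projection and contraction are taken first and the result is then differentiated. **Theorem.** $\Sigma$ is umbilic, i.e. $K_{ab}=\frac H3\overline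 g_{ab}$, and on $\Sigma$ $$(q-2)\tau_{an}+n_a\tau=0,\qquad \nabla_n\big[(q-2)\tau_{an}+n_a\tau\big]-\nabla_b\tau_a{}^b=0,$$ where $n_an^a=-1+\frac1{2\lambda}\Omega(\Delta+J)\Omega+O(\Omega^{q+2})$ near $\Sigma$; in particular $n_an^a=-1$ on $\Sigma$. Moreover, the following hold on $\Sigma$. * If $q=0$: $C_{nanb}=\frac12\mathring\top(\tau_{ab})$ and $\nabla_n\tau^\top_{ab}+\frac23H\tau^\top_{ab}=0$. * If $q=1$: $C_{abcd}=0$; $\tau_{ab}=-n_an_b\tau$; $\overline\nabla^bA^\top_{anb}=\lambda j_a-\frac{\sqrt\lambda}3\overline\nabla_a\tau$, where the smooth $j_a$ is defined by $\tau^\top_{an}=\Omega j_a+O(\Omega^2)$; $$\mathring\top(B_{ab})=\tfrac{\sqrt\lambda}3\big(9\nabla_n\tau^\top_{ab}-3\overline g_{ab}\nabla_n\tau_{nn}+8H\tau^\top_{ab}-H\overline g_{ab}\tau_{nn}\big);$$ $B_{nn}=0$; and $B^\top_{an}=\sqrt\lambda\,\big(\nabla_n\tau^\top_{an}+\frac13\overline\nabla_a\tau\big)$.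 * If $q=2$: $C_{abcd}=0$; $\overline\nabla^bA^\top_{anb}=\lambda\tau^\top_{an}$; $\mathring\top(B_{ab}+3\lambda\tau_{ab})=0$; $B_{nn}=0$; and $B^\top_{an}=-\lambda\tau^\top_{an}$. -/

import Mathlib

open scoped Manifold ContDiff Topology

noncomputable section

namespace AdS

/-- Coordinate space `ℝⁿ`. -/
abbrev E (n : ℕ) : Type := EuclideanSpace ℝ (Fin n)

/-! ### Tensor calculus of a pseudo-Riemannian metric in coordinates

All tensors are covariant unless stated otherwise; `T y a b` is the component `T_{ab}` at the
coordinate point `y`. Derivatives are taken within the domain `dom` (the closed half-space in a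
chart of a manifold with boundary, the whole space in a chart of a manifold without boundary). -/

/-- The components of a metric in a coordinate system. -/
structure LocalMetric (n : ℕ) where
  /-- the set within which derivatives are taken -/
  dom : Set (E n)
  /-- the components `g_{ab}` -/
  g : E n → Matrix (Fin n) (Fin n) ℝ

namespace LocalMetric

variable {n : ℕ} (X : LocalMetric n)

/-- `∂_a f`. -/
def pd (a : Fin n) (f : E n → ℝ) (y : E n) : ℝ :=
  fderivWithin ℝ f X.dom y (EuclideanSpace.single a 1)

/-- The inverse metric `g^{ab}`. -/
def inv (y : E n) (a b : Fin n) : ℝ := (X.g y)⁻¹ a b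

/-- Christoffel symbols of the Levi-Civita connection:
`chr y c a b = Γ^c_{ab} = ½ g^{cd} (∂_a g_{db} + ∂_b g_{da} - ∂_d g_{ab})`. -/
def chr (y : E n) (c a b : Fin n) : ℝ :=
  (1 / 2) * ∑ d, X.inv y c d *
    (X.pd a (fun z => X.g z d b) y + X.pd b (fun z => X.g z d a) y - X.pd d (fun z => X.g z a b) y)

/-- `∇_c w_a`. -/
def cov1 (w : E n → Fin n → ℝ) (y : E n) (c a : Fin n) : ℝ :=
  X.pd c (fun z => w z a) y - ∑ d, X.chr y d c a * w y d

/-- `∇_c T_{ab}`. -/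
def cov2 (T : E n → Fin n → Fin n → ℝ) (y : E n) (c a b : Fin n) : ℝ :=
  X.pd c (fun z => T z a b) y - ∑ d, X.chr y d c a * T y d b - ∑ d, X.chr y d c b * T y a d

/-- `∇_d T_{abc}`. -/
def cov3 (T : E n → Fin n → Fin n → Fin n → ℝ) (y : E n) (d a b c : Fin n) : ℝ :=
  X.pd d (fun z => T z a b c) y - ∑ e, X.chr y e d a * T y e b c
    - ∑ e, X.chr y e d b * T y a e c - ∑ e, X.chr y e d c * T y a b e

/-- The Riemann tensor `R_{ab}{}^c{}_d`, with `[∇_a, ∇_b] v^c = R_{ab}{}^c{}_d v^d`. -/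
def riemUp (y : E n) (a b c d : Fin n) : ℝ :=
  X.pd a (fun z => X.chr z c b d) y - X.pd b (fun z => X.chr z c a d) y
    + ∑ e, (X.chr y c a e * X.chr y e b d - X.chr y c b e * X.chr y e a d)

/-- `R_{abcd}`. -/
def riem (y : E n) (a b c d : Fin n) : ℝ := ∑ e, X.g y c e * X.riemUp y a b e d

/-- The Ricci tensor `R_{bd} = R_{ab}{}^a{}_d`. -/
def ric (y : E n) (b d : Fin n) : ℝ := ∑ a, X.riemUp y a b a d

/-- The metric trace `g^{ab} T_{ab}`. -/
def trace (T : E n → Fin n → Fin n → ℝ) (y : E n) : ℝ := ∑ a, ∑ b, X.inv y a b * T y a b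

/-- The scalar curvature `R`. -/
def scal (y : E n) : ℝ := X.trace X.ric y

/-- The Schouten tensor `P_{ab} = (R_{ab} - R g_{ab} / (2 (n - 1))) / (n - 2)`. -/
def schouten (y : E n) (a b : Fin n) : ℝ :=
  1 / ((n : ℝ) - 2) * (X.ric y a b - X.scal y / (2 * ((n : ℝ) - 1)) * X.g y a b)

/-- The trace `J` of the Schouten tensor. -/
def J (y : E n) : ℝ := X.trace X.schouten y

/-- The Weyl tensor `C_{abcd}`. -/
def weyl (y : E n) (a b c d : Fin n) : ℝ :=
  X.riem y a b c d - (X.g y c a * X.schouten y b d - X.g y c b * X.schouten y a d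
    + X.g y d b * X.schouten y a c - X.g y d a * X.schouten y b c)

/-- The Cotton tensor `A_{abc} = ∇_b P_{ca} - ∇_c P_{ba}`. -/
def cotton (y : E n) (a b c : Fin n) : ℝ :=
  X.cov2 X.schouten y b c a - X.cov2 X.schouten y c b a

/-- The Bach tensor `B_{ab} = -∇^c A_{abc} + P^{dc} C_{dacb}`. -/
def bach (y : E n) (a b : Fin n) : ℝ :=
  - ∑ c, ∑ d, X.inv y c d * X.cov3 X.cotton y d a b c
    + ∑ c, ∑ d, (∑ e, ∑ f, X.inv y d e * X.inv y c f * X.schouten y e f) * X.weyl y d a c b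

/-- The Laplacian `Δ f = g^{ab} ∇_a ∇_b f` of a function. -/
def lap (f : E n → ℝ) (y : E n) : ℝ :=
  X.trace (X.cov1 (fun z a => X.pd a f z)) y

/-- The divergence `∇^b T_{ab}` in the second index. -/
def div2 (T : E n → Fin n → Fin n → ℝ) (y : E n) (a : Fin n) : ℝ :=
  ∑ b, ∑ c, X.inv y b c * X.cov2 T y c a b

/-- `dot y v w = g^{ab} v_a w_b`. -/
def dot (v w : E n → Fin n → ℝ) (y : E n) : ℝ := ∑ a, ∑ b, X.inv y a b * v y a * w y b

end LocalMetric

/-! ### The unphysical fields near conformal infinity in coordinates -/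

/-- The coordinate representation, in the scale of the unphysical metric `g`, of the data of a
conformal extension: the metric, the defining function `Ω` (which represents the density `σ̃`),
the stress-energy tensor `τ_{ab}`, and the constant `λ = Λ / 3`. -/
structure LocalMatter extends LocalMetric 4 where
  /-- the defining function of the boundary -/
  Ω : E 4 → ℝ
  /-- the unphysical stress-energy tensor `τ_{ab}` -/
  τ : E 4 → Fin 4 → Fin 4 → ℝ
  /-- the normalized cosmological constant -/
  lam : ℝ

namespace LocalMatter

variable (X : LocalMatter)

/-- The covector `n_a = ∇_a Ω / √λ`. -/
def nrm (y : E 4) (a : Fin 4) : ℝ := X.pd a X.Ω y / √X.lam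

/-- The vector `n^a`. -/
def nUp (y : E 4) (a : Fin 4) : ℝ := ∑ b, X.inv y a b * X.nrm y b

/-- The norm `n_a n^a`. -/
def nn (y : E 4) : ℝ := X.dot X.nrm X.nrm y

/-- The orthogonal projection `ḡ_a{}^c = δ_a{}^c - n_a n^c / (n_e n^e)` onto the annihilator
of `n^a`. -/
def proj (y : E 4) (a c : Fin 4) : ℝ := (if a = c then 1 else 0) - X.nrm y a * X.nUp y c / X.nn y

/-- The projection `w_a^⊤` of a covector field. -/
def top1 (w : E 4 → Fin 4 → ℝ) (y : E 4) (a : Fin 4) : ℝ := ∑ c, X.proj y a c * w y c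

/-- The projection `T_{ab}^⊤` of a covariant 2-tensor field. -/
def top2 (T : E 4 → Fin 4 → Fin 4 → ℝ) (y : E 4) (a b : Fin 4) : ℝ :=
  ∑ c, ∑ d, X.proj y a c * X.proj y b d * T y c d

/-- The first fundamental form `ḡ_{ab}`. -/
def gbar (y : E 4) (a b : Fin 4) : ℝ := X.top2 (fun z c d => X.g z c d) y a b

/-- The trace-free part of the projection `T_{ab}^⊤` (for the three-dimensional metric `ḡ_{ab}`;
on projected tensors the traces with `ḡ^{ab}` and with `g^{ab}` agree). -/
def topFree (T : E 4 → Fin 4 → Fin 4 → ℝ) (y : E 4) (a b : Fin 4) : ℝ :=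
  X.top2 T y a b - (1 / 3) * X.trace (X.top2 T) y * X.gbar y a b

/-- The second fundamental form `K_{ab} = (∇_a n_b)^⊤`. -/
def K (y : E 4) (a b : Fin 4) : ℝ := X.top2 (X.cov1 X.nrm) y a b

/-- The mean curvature `H = ḡ^{ab} K_{ab}` (the trace, not divided by the dimension). -/
def H (y : E 4) : ℝ := X.trace X.K y

/-- The trace-free second fundamental form `K_{ab} - (H / 3) ḡ_{ab}`. -/
def Kfree (y : E 4) (a b : Fin 4) : ℝ := X.K y a b - X.H y / 3 * X.gbar y a b

/-- `∇_n f = n^c ∇_c f`. -/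
def dn0 (f : E 4 → ℝ) (y : E 4) : ℝ := ∑ c, X.nUp y c * X.pd c f y

/-- `∇_n w_a`. -/
def dn1 (w : E 4 → Fin 4 → ℝ) (y : E 4) (a : Fin 4) : ℝ := ∑ c, X.nUp y c * X.cov1 w y c a

/-- `∇_n T_{ab}`. -/
def dn2 (T : E 4 → Fin 4 → Fin 4 → ℝ) (y : E 4) (a b : Fin 4) : ℝ :=
  ∑ c, X.nUp y c * X.cov2 T y c a b

/-- The trace `τ = g^{ab} τ_{ab}`. -/
def τtr (y : E 4) : ℝ := X.trace X.τ y

/-- `T_{an} = T_{ab} n^b`. -/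
def ctr (T : E 4 → Fin 4 → Fin 4 → ℝ) (y : E 4) (a : Fin 4) : ℝ := ∑ b, T y a b * X.nUp y b

/-- `T_{nn} = T_{ab} n^a n^b`. -/
def ctr2 (T : E 4 → Fin 4 → Fin 4 → ℝ) (y : E 4) : ℝ := ∑ a, X.ctr T y a * X.nUp y a

/-- The tangential gradient `∇̄_a f = ḡ_a{}^c ∇_c f`. -/
def gradTop (f : E 4 → ℝ) (y : E 4) (a : Fin 4) : ℝ := X.top1 (fun z c => X.pd c f z) y a

/-- `C_{nanb} = C_{cadb} n^c n^d`. -/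
def weylE (y : E 4) (a b : Fin 4) : ℝ := ∑ c, ∑ d, X.weyl y c a d b * X.nUp y c * X.nUp y d

/-- The covector `(q - 2) τ_{an} + n_a τ`. -/
def constr (q : ℕ) (y : E 4) (a : Fin 4) : ℝ :=
  ((q : ℝ) - 2) * X.ctr X.τ y a + X.nrm y a * X.τtr y

/-! The boundary is the coordinate hyperplane `y⁰ = 0`, with coordinates `(y¹, y², y³)`; tensors
on the boundary are the pull-backs under the inclusion. -/

/-- The inclusion `z ↦ (0, z)` of the boundary hyperplane. -/
def incl (z : E 3) : E 4 := WithLp.toLp 2 (Fin.cons 0 (fun i : Fin 3 => z i))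

/-- The boundary coordinates `(y¹, y², y³)` of a point. -/
def tail (y : E 4) : E 3 := WithLp.toLp 2 (fun i : Fin 3 => y i.succ)

/-- The metric induced on the boundary. -/
def bdry : LocalMetric 3 where
  dom := Set.univ
  g := fun z => Matrix.of fun i j => X.g (incl z) i.succ j.succ

/-- The boundary tensor `A_{anb}^⊤`, with `A_{anb} = A_{acb} n^c`. -/
def cottonBdry (z : E 3) (i j : Fin 3) : ℝ :=
  ∑ c, X.cotton (incl z) i.succ c j.succ * X.nUp (incl z) c

/-- `∇̄^b A_{anb}^⊤`, with the Levi-Civita connection `∇̄` of the metric induced on the boundary. -/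
def divCotton (y : E 4) (i : Fin 3) : ℝ := X.bdry.div2 X.cottonBdry (tail y) i

end LocalMatter

/-! ### Tensor fields on manifolds -/

section Manifold

variable {n : ℕ} {HH : Type*} [TopologicalSpace HH] (I : ModelWithCorners ℝ (E n) HH)
  {M : Type*} [TopologicalSpace M] [ChartedSpace HH M]

variable (M) in
/-- A covariant 2-tensor field (not necessarily smooth). -/
abbrev Tensor2 : Type _ := (p : M) → TangentSpace I p →L[ℝ] TangentSpace I p →L[ℝ] ℝ

/-- The coordinate vector field `∂_a` of the chart `e`, at the point with coordinates `y`. -/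
def coordVec (e : OpenPartialHomeomorph M HH) (y : E n) (a : Fin n) :
    TangentSpace I ((e.extend I).symm y) :=
  mfderivWithin 𝓘(ℝ, E n) I (e.extend I).symm (Set.range I) y
    (EuclideanSpace.single a 1 : E n)

/-- The components `T_{ab} = T(∂_a, ∂_b)` in the chart `e`. -/
def comp (T : Tensor2 I M) (e : OpenPartialHomeomorph M HH) (y : E n) (a b : Fin n) : ℝ :=
  T ((e.extend I).symm y) (coordVec I e y a) (coordVec I e y b)

/-- A tensor field is smooth if its components in every chart are smooth. -/
def IsSmoothTensor (T : Tensor2 I M) : Prop :=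
  ∀ e ∈ IsManifold.maximalAtlas I ∞ M, ∀ a b,
    ContDiffOn ℝ ∞ (fun y => comp I T e y a b) (e.extend I).target

/-- The metric `g` in the chart `e`. -/
def localMetric (g : Tensor2 I M) (e : OpenPartialHomeomorph M HH) : LocalMetric n where
  dom := Set.range I
  g := fun y => Matrix.of fun a b => comp I g e y a b

end Manifold

section Lorentz

variable {HH : Type*} [TopologicalSpace HH] (I : ModelWithCorners ℝ (E 4) HH)
  {M : Type*} [TopologicalSpace M] [ChartedSpace HH M]

/-- A smooth metric of Lorentzian signature `(-, +, +, +)`. -/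
structure IsLorentzMetric (g : Tensor2 I M) : Prop where
  smooth : IsSmoothTensor I g
  signature : ∀ p, ∃ b : Module.Basis (Fin 4) ℝ (TangentSpace I p), ∀ i j,
    g p (b i) (b j) = if i = j then (if i = 0 then -1 else 1) else 0

/-- The Einstein field equations `R_{ab} - ½ R g_{ab} + Λ g_{ab} = T_{ab}`. -/
def SatisfiesEinstein (g T : Tensor2 I M) (Λ : ℝ) : Prop :=
  ∀ e ∈ IsManifold.maximalAtlas I ∞ M, ∀ y ∈ (e.extend I).target, ∀ a b,
    let X := localMetric I g e
    X.ric y a b - (1 / 2) * X.scal y * X.g y a b + Λ * X.g y a b = comp I T e y a b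

end Lorentz

section Extension

variable {Mt : Type*} [TopologicalSpace Mt] [ChartedSpace (E 4) Mt]
  {M : Type*} [TopologicalSpace M] [ChartedSpace (EuclideanHalfSpace 4) M]

/-- `(Mt, gt)` is a four-dimensional spacetime satisfying the Einstein field equations with
cosmological constant `Λ` and stress-energy tensor `Tt`; the manifold `M` with boundary, the metric
`g`, the defining function `Ω` of the boundary and the embedding `φ : Mt → M` form a conformal
extension of it; and `Tt = Ω^q τ` with `τ` smooth up to the boundary. -/
structure IsAsymptoticallyDeSitter (gt Tt : Tensor2 (𝓡 4) Mt) (g τ : Tensor2 (𝓡∂ 4) M)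
    (Ω : M → ℝ) (φ : Mt → M) (Λ : ℝ) (q : ℕ) : Prop where
  lorentz_phys : IsLorentzMetric (𝓡 4) gt
  einstein : SatisfiesEinstein (𝓡 4) gt Tt Λ
  lorentz : IsLorentzMetric (𝓡∂ 4) g
  smooth_Ω : ContMDiff (𝓡∂ 4) 𝓘(ℝ, ℝ) ∞ Ω
  nonneg_Ω : ∀ p, 0 ≤ Ω p
  zero_Ω : ∀ p, Ω p = 0 ↔ p ∈ (𝓡∂ 4).boundary M
  deriv_Ω : ∀ p ∈ (𝓡∂ 4).boundary M, mfderiv (𝓡∂ 4) 𝓘(ℝ, ℝ) Ω p ≠ 0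
  embedding : Manifold.IsSmoothEmbedding (𝓡 4) (𝓡∂ 4) ∞ φ
  range_embedding : Set.range φ = ((𝓡∂ 4).boundary M)ᶜ
  conformal : ∀ x u v, gt x u v = (Ω (φ x))⁻¹ ^ 2 *
    g (φ x) (mfderiv (𝓡 4) (𝓡∂ 4) φ x u) (mfderiv (𝓡 4) (𝓡∂ 4) φ x v)
  smooth_τ : IsSmoothTensor (𝓡∂ 4) τ
  decay : ∀ x u v, Tt x u v = Ω (φ x) ^ q *
    τ (φ x) (mfderiv (𝓡 4) (𝓡∂ 4) φ x u) (mfderiv (𝓡 4) (𝓡∂ 4) φ x v)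

/-- The unphysical fields in the chart `e`, with `λ = 2 Λ / ((4 - 1) (4 - 2)) = Λ / 3`. -/
def localMatter (g τ : Tensor2 (𝓡∂ 4) M) (Ω : M → ℝ) (Λ : ℝ)
    (e : OpenPartialHomeomorph M (EuclideanHalfSpace 4)) : LocalMatter where
  toLocalMetric := localMetric (𝓡∂ 4) g e
  Ω := fun y => Ω ((e.extend (𝓡∂ 4)).symm y)
  τ := comp (𝓡∂ 4) τ e
  lam := Λ / 3

end Extension

end AdS

end

open scoped Manifold ContDiff Topology

noncomputable section

namespace AdS

/-! Write w = dΩ, N = w_a w^a, t for the trace of τ, θ for its trace-free part and ρ = ¼(Δ + J)Ω. In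
terms of the unphysical metric the Einstein equations become Ω∇_a w_b + Ω²P_ab − ½(N + λ)g_ab =
½Ω^{q+2}(τ_ab − ⅓ t g_ab) (`einstein_conf`). Their trace shows that N + λ is divisible by Ω
(`N_add_lam`), so one factor Ω can be removed. What remains is the almost Einstein equation with a
source, ∇_a w_b = −ΩP_ab + ρ g_ab + ½Ω^{q+1}θ_ab (`cov1_w`). On the boundary it reads ∇_a w_b = ρ
g_ab with N = −λ, which is umbilicity.

The rest is the prolongation of this equation. Commuting derivatives gives C_abcd w^d + ΩA_cab =
Q_abc (`weyl_w`), where Q contains the derivative of the source and u_a = ∇_aρ + P_ab w^b. The trace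
of this identity makes the divergence of the source equal to 3u (`div_s`), while the gradient of the
trace equation expresses u through τ alone (`u_eq`). Equating the two yields Ω∇^bτ_ab + (q − 2)τ_ab
w^b + t w_a = 0 (`conservation`), whose orders Ω⁰ and Ω¹ are the two constraints on the matter. On
the boundary `weyl_w` gives the electric part of the Weyl tensor if q = 0. If q ≥ 1 it says that the
Weyl tensor is annihilated by the non-null vector w; it is then a trace-free curvature tensor of a
three-dimensional metric, hence zero (`curvature_four_eq_zero`).

The divergence of `weyl_w`, symmetrised, expresses ΩB_ab through τ and its derivatives
(`two_mul_Om_mul_bach`). For q = 0 its boundary value is the evolution equation of the projected τ.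
For q = 1 its boundary value is τ_ab = −n_a n_b τ, and its derivative along w gives the Bach tensor.
For q = 2 another factor Ω cancels and the Bach tensor can be read off. When C = 0 on the boundary,
the boundary divergence of A_anb is minus the tangential part of B_an: A_anb is tangential there,
and the umbilic second fundamental form contributes only a vanishing trace
(`MatterAlgebra.divCotton_eq`).

All of this is done with exact identities in the ring of smooth functions on a neighbourhood of a
boundary point, seen as a commutative algebra with commuting derivations. The function Ω is not a
unit there, but it is not a zero divisor, since it is positive in the dense interior. So expansions
in Ω have honest ring elements as remainders, they may be differentiated before being restricted,
and restriction to a point is an algebra homomorphism `ev`. The predicate `Rep` identifies ring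
elements with the coordinate expressions of the statement. The physical equations are available in
the interior only, through charts pulled back along the embedding, and reach the boundary by
density. -/

/-! ## Metrics over algebras with commuting derivations -/

section

/-- A pseudo-Riemannian metric over a commutative algebra with commuting derivations
`D 0, …, D (n - 1)`, which play the part of the coordinate derivatives. -/
structure MetricAlgebra (n : ℕ) (R : Type*) [CommRing R] [Algebra ℝ R] where
  /-- the coordinate derivatives -/
  D : Fin n → Derivation ℝ R R
  /-- the metric -/
  g : Fin n → Fin n → R
  /-- the inverse metric -/
  gi : Fin n → Fin n → R
  D_comm : ∀ a b f, D a (D b f) = D b (D a f)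
  g_symm : ∀ a b, g a b = g b a
  gi_symm : ∀ a b, gi a b = gi b a
  gi_mul_g : ∀ a b, ∑ c, gi a c * g c b = if a = b then 1 else 0

namespace MetricAlgebra

variable {n : ℕ} {R : Type*} [CommRing R] [Algebra ℝ R] (G : MetricAlgebra n R)

lemma D_mul (a : Fin n) (f h : R) : G.D a (f * h) = G.D a f * h + f * G.D a h := by
  rw [Derivation.leibniz, smul_eq_mul, smul_eq_mul]; ring

/-- The metric trace. -/
def tr (F : Fin n → Fin n → R) : R := ∑ a, ∑ b, G.gi a b * F a b

lemma tr_congr {F F' : Fin n → Fin n → R} (h : ∀ a b, F a b = F' a b) : G.tr F = G.tr F' := by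
  simp only [tr, h]

lemma tr_add (F F' : Fin n → Fin n → R) :
    G.tr (fun a b => F a b + F' a b) = G.tr F + G.tr F' := by
  simp only [tr, mul_add, Finset.sum_add_distrib]

lemma tr_sub (F F' : Fin n → Fin n → R) :
    G.tr (fun a b => F a b - F' a b) = G.tr F - G.tr F' := by
  simp only [tr, mul_sub, Finset.sum_sub_distrib]

lemma tr_neg (F : Fin n → Fin n → R) : G.tr (fun a b => - F a b) = - G.tr F := by
  simp only [tr, mul_neg, Finset.sum_neg_distrib]

lemma tr_zero : G.tr (fun _ _ => 0) = 0 := by simp [tr]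

lemma tr_mul_left (r : R) (F : Fin n → Fin n → R) :
    G.tr (fun a b => r * F a b) = r * G.tr F := by
  simp only [tr, Finset.mul_sum]
  exact Finset.sum_congr rfl fun _ _ => Finset.sum_congr rfl fun _ _ => by ring

lemma tr_mul_right (r : R) (F : Fin n → Fin n → R) :
    G.tr (fun a b => F a b * r) = G.tr F * r := by
  simp only [tr, Finset.sum_mul]
  exact Finset.sum_congr rfl fun _ _ => Finset.sum_congr rfl fun _ _ => by ring

lemma tr_smul (r : ℝ) (F : Fin n → Fin n → R) :
    G.tr (fun a b => r • F a b) = r • G.tr F := by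
  simp only [tr, Finset.smul_sum, mul_smul_comm]

lemma tr_swap (F : Fin n → Fin n → R) : G.tr (fun a b => F b a) = G.tr F := by
  simp only [tr]
  rw [Finset.sum_comm]
  simp only [G.gi_symm]

lemma tr_comm (F : Fin n → Fin n → Fin n → Fin n → R) :
    G.tr (fun a b => G.tr (fun c d => F a b c d))
      = G.tr (fun c d => G.tr (fun a b => F a b c d)) := by
  simp only [tr, Finset.mul_sum]
  have h1 : ∀ f : Fin n → Fin n → Fin n → Fin n → R, ∑ a, ∑ b, ∑ c, ∑ d, f a b c d
      = ∑ c, ∑ d, ∑ a, ∑ b, f a b c d := by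
    intro f
    calc _ = ∑ a, ∑ c, ∑ b, ∑ d, f a b c d :=
          Finset.sum_congr rfl fun a _ => Finset.sum_comm
      _ = ∑ c, ∑ a, ∑ b, ∑ d, f a b c d := Finset.sum_comm
      _ = ∑ c, ∑ a, ∑ d, ∑ b, f a b c d :=
          Finset.sum_congr rfl fun c _ => Finset.sum_congr rfl fun a _ => Finset.sum_comm
      _ = _ := Finset.sum_congr rfl fun c _ => Finset.sum_comm
  rw [h1]
  refine Finset.sum_congr rfl fun _ _ => Finset.sum_congr rfl fun _ _ =>
    Finset.sum_congr rfl fun _ _ => Finset.sum_congr rfl fun _ _ => by ring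

lemma tr_g_left (F : Fin n → R) (c : Fin n) : G.tr (fun a b => G.g a c * F b) = F c := by
  have : ∀ a b, G.gi a b * (G.g a c * F b) = (G.gi b a * G.g a c) * F b := by
    intro a b; rw [G.gi_symm a b]; ring
  simp only [tr, this]
  rw [Finset.sum_comm]
  simp only [← Finset.sum_mul, G.gi_mul_g]
  simp

lemma tr_g_left' (F : Fin n → R) (c : Fin n) : G.tr (fun a b => G.g c a * F b) = F c := by
  simp only [G.g_symm c, tr_g_left]

lemma tr_g_right (F : Fin n → R) (c : Fin n) : G.tr (fun a b => G.g b c * F a) = F c := by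
  rw [← tr_swap]; exact G.tr_g_left F c

lemma tr_g_right' (F : Fin n → R) (c : Fin n) : G.tr (fun a b => G.g c b * F a) = F c := by
  rw [← tr_swap]; exact G.tr_g_left' F c

lemma tr_g : G.tr (fun a b => G.g a b) = n := by
  have : ∀ a, ∑ b, G.gi a b * G.g a b = 1 := fun a => by
    simpa [G.g_symm a] using G.gi_mul_g a a
  rw [tr, Finset.sum_congr rfl fun a _ => this a]
  simp

/-- Christoffel symbols, `chr c a b = Γ^c_{ab}`. -/
def chr (c a b : Fin n) : R :=
  (1 / 2 : ℝ) • ∑ d, G.gi c d * (G.D a (G.g d b) + G.D b (G.g d a) - G.D d (G.g a b))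

lemma chr_symm (c a b : Fin n) : G.chr c a b = G.chr c b a := by
  simp only [chr, G.g_symm a b]
  congr 1; refine Finset.sum_congr rfl fun _ _ => by ring

lemma g_mul_gi (a b : Fin n) : ∑ c, G.g a c * G.gi c b = if a = b then 1 else 0 := by
  have := G.gi_mul_g b a
  rw [show (if a = b then (1 : R) else 0) = if b = a then 1 else 0 by simp [eq_comm], ← this]
  exact Finset.sum_congr rfl fun c _ => by rw [G.g_symm, G.gi_symm, mul_comm]

lemma g_mul_chr (e a b : Fin n) : ∑ c, G.g e c * G.chr c a b
    = (1 / 2 : ℝ) • (G.D a (G.g e b) + G.D b (G.g e a) - G.D e (G.g a b)) := by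
  simp only [chr, mul_smul_comm, ← Finset.smul_sum, Finset.mul_sum]
  rw [Finset.sum_comm]
  simp only [← mul_assoc, ← Finset.sum_mul, G.g_mul_gi]
  simp

/-- The action of the connection on one covariant index. -/
def Γ (c : Fin n) (w : Fin n → R) (a : Fin n) : R := ∑ d, G.chr d c a * w d

lemma Γ_add (c : Fin n) (v w : Fin n → R) (a : Fin n) :
    G.Γ c (fun d => v d + w d) a = G.Γ c v a + G.Γ c w a := by
  simp only [Γ, mul_add, Finset.sum_add_distrib]

lemma Γ_sub (c : Fin n) (v w : Fin n → R) (a : Fin n) :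
    G.Γ c (fun d => v d - w d) a = G.Γ c v a - G.Γ c w a := by
  simp only [Γ, mul_sub, Finset.sum_sub_distrib]

lemma Γ_neg (c : Fin n) (v : Fin n → R) (a : Fin n) :
    G.Γ c (fun d => - v d) a = - G.Γ c v a := by
  simp only [Γ, mul_neg, Finset.sum_neg_distrib]

lemma Γ_smul (c : Fin n) (r : ℝ) (v : Fin n → R) (a : Fin n) :
    G.Γ c (fun d => r • v d) a = r • G.Γ c v a := by
  simp only [Γ, Finset.smul_sum, mul_smul_comm]

lemma Γ_mul_left (c : Fin n) (r : R) (v : Fin n → R) (a : Fin n) :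
    G.Γ c (fun d => r * v d) a = r * G.Γ c v a := by
  simp only [Γ, Finset.mul_sum]
  exact Finset.sum_congr rfl fun _ _ => by ring

lemma Γ_mul_right (c : Fin n) (r : R) (v : Fin n → R) (a : Fin n) :
    G.Γ c (fun d => v d * r) a = G.Γ c v a * r := by
  simp only [Γ, Finset.sum_mul]
  exact Finset.sum_congr rfl fun _ _ => by ring

lemma Γ_tr (c : Fin n) (F : Fin n → Fin n → Fin n → R) (a : Fin n) :
    G.Γ c (fun d => G.tr (fun x y => F d x y)) a
      = G.tr (fun x y => G.Γ c (fun d => F d x y) a) := by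
  simp only [Γ, tr, Finset.mul_sum]
  rw [Finset.sum_comm]
  refine Finset.sum_congr rfl fun _ _ => ?_
  rw [Finset.sum_comm]
  exact Finset.sum_congr rfl fun _ _ => Finset.sum_congr rfl fun _ _ => by ring

lemma Γ_comm (c e : Fin n) (F : Fin n → Fin n → R) (a b : Fin n) :
    G.Γ c (fun d => G.Γ e (fun x => F d x) b) a = G.Γ e (fun x => G.Γ c (fun d => F d x) a) b := by
  simp only [Γ, Finset.mul_sum]
  rw [Finset.sum_comm]
  exact Finset.sum_congr rfl fun _ _ => Finset.sum_congr rfl fun _ _ => by ring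

lemma Γ_symm (c : Fin n) (w : Fin n → R) (a : Fin n) : G.Γ c w a = G.Γ a w c := by
  simp only [Γ, G.chr_symm]

/-- Metric compatibility: after lowering, each Christoffel symbol is a three-term sum, and in the
sum of the two all terms but two equal ones cancel. -/
lemma D_g (c a b : Fin n) :
    G.D c (G.g a b) = G.Γ c (fun d => G.g d b) a + G.Γ c (fun d => G.g a d) b := by
  have h1 : G.Γ c (fun d => G.g d b) a = ∑ d, G.g b d * G.chr d c a :=
    Finset.sum_congr rfl fun d _ => by rw [G.g_symm b d, mul_comm]
  have h2 : G.Γ c (fun d => G.g a d) b = ∑ d, G.g a d * G.chr d c b :=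
    Finset.sum_congr rfl fun d _ => by rw [mul_comm]
  rw [h1, h2, g_mul_chr, g_mul_chr, G.g_symm b a, G.g_symm b c, G.g_symm a c]
  algebra

/-- Differentiating `gi * g = 1` gives ∂g⁻¹ = −g⁻¹(∂g)g⁻¹, and `D_g` turns ∂g into Christoffel
symbols. -/
lemma D_gi (c a b : Fin n) : G.D c (G.gi a b)
    = - ∑ d, (G.chr a c d * G.gi d b + G.chr b c d * G.gi a d) := by
  have h : ∀ e, ∑ d, G.D c (G.gi a d) * G.g d e = - ∑ d, G.gi a d * G.D c (G.g d e) := by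
    intro e
    have := congrArg (G.D c) (G.gi_mul_g a e)
    rw [map_sum] at this
    simp only [D_mul, Finset.sum_add_distrib] at this
    have h0 : G.D c (if a = e then (1 : R) else 0) = 0 := by split_ifs <;> simp
    rw [h0] at this
    linear_combination this
  have h2 : G.D c (G.gi a b) = ∑ e, (∑ d, G.D c (G.gi a d) * G.g d e) * G.gi e b := by
    simp only [Finset.sum_mul]
    rw [Finset.sum_comm]
    simp only [mul_assoc, ← Finset.mul_sum, g_mul_gi]
    simp
  rw [h2]
  simp only [h, D_g, neg_mul, Finset.sum_neg_distrib, mul_add, Finset.sum_add_distrib, add_mul]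
  rw [add_comm]
  congr 2
  · simp only [Γ, Finset.sum_mul, Finset.mul_sum]
    refine Finset.sum_congr rfl fun x _ => ?_
    rw [Finset.sum_comm]
    have : ∀ d y, G.gi a d * (G.chr y c x * G.g d y) * G.gi x b
      = (G.gi a d * G.g d y) * (G.chr y c x * G.gi x b) := fun d y => by ring
    simp only [this, ← Finset.sum_mul, G.gi_mul_g]
    simp
  · simp only [Γ, Finset.sum_mul, Finset.mul_sum]
    rw [Finset.sum_comm]
    refine Finset.sum_congr rfl fun x _ => ?_
    rw [Finset.sum_comm]
    have : ∀ d y, G.gi a x * (G.chr d c x * G.g d y) * G.gi y b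
      = (G.g d y * G.gi y b) * (G.chr d c x * G.gi a x) := fun d y => by ring
    simp only [this, ← Finset.sum_mul, G.g_mul_gi]
    simp

/-- The Christoffel terms of `D_gi` are moved onto the indices of F. Every rule for the covariant
derivative of a contraction reduces to this one. -/
lemma D_tr (c : Fin n) (F : Fin n → Fin n → R) : G.D c (G.tr F)
    = G.tr (fun a b => G.D c (F a b) - G.Γ c (fun d => F d b) a - G.Γ c (fun d => F a d) b) := by
  have e1 : ∑ a, ∑ b, (∑ d, G.chr a c d * G.gi d b) * F a b
      = ∑ a, ∑ b, G.gi a b * G.Γ c (fun d => F d b) a := by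
    simp only [Γ, Finset.mul_sum, Finset.sum_mul]
    rw [Finset.sum_comm]; conv_rhs => rw [Finset.sum_comm]
    refine Finset.sum_congr rfl fun _ _ => ?_
    rw [Finset.sum_comm]
    exact Finset.sum_congr rfl fun _ _ => Finset.sum_congr rfl fun _ _ => by ring
  have e2 : ∑ a, ∑ b, (∑ d, G.chr b c d * G.gi a d) * F a b
      = ∑ a, ∑ b, G.gi a b * G.Γ c (fun d => F a d) b := by
    simp only [Γ, Finset.mul_sum, Finset.sum_mul]
    refine Finset.sum_congr rfl fun _ _ => ?_
    rw [Finset.sum_comm]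
    exact Finset.sum_congr rfl fun _ _ => Finset.sum_congr rfl fun _ _ => by ring
  simp only [tr, map_sum, D_mul, D_gi, mul_sub, Finset.sum_sub_distrib, Finset.sum_add_distrib,
    neg_mul, add_mul, Finset.sum_neg_distrib]
  rw [e1, e2]; ring

/-! ### Covariant derivatives -/

/-- `∇_c w_a`. -/
def cov1 (w : Fin n → R) (c a : Fin n) : R := G.D c (w a) - G.Γ c w a

/-- `∇_c T_{ab}`. -/
def cov2 (T : Fin n → Fin n → R) (c a b : Fin n) : R :=
  G.D c (T a b) - G.Γ c (fun d => T d b) a - G.Γ c (fun d => T a d) b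

/-- `∇_d T_{abc}`. -/
def cov3 (T : Fin n → Fin n → Fin n → R) (d a b c : Fin n) : R :=
  G.D d (T a b c) - G.Γ d (fun e => T e b c) a - G.Γ d (fun e => T a e c) b
    - G.Γ d (fun e => T a b e) c

/-- `∇_e T_{abcd}`. -/
def cov4 (T : Fin n → Fin n → Fin n → Fin n → R) (e a b c d : Fin n) : R :=
  G.D e (T a b c d) - G.Γ e (fun x => T x b c d) a - G.Γ e (fun x => T a x c d) b
    - G.Γ e (fun x => T a b x d) c - G.Γ e (fun x => T a b c x) d

lemma cov2_g (c a b : Fin n) : G.cov2 G.g c a b = 0 := by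
  rw [cov2, D_g]; ring

lemma D_tr_cov (c : Fin n) (F : Fin n → Fin n → R) :
    G.D c (G.tr F) = G.tr (fun a b => G.cov2 F c a b) := G.D_tr c F

lemma cov1_tr (T : Fin n → Fin n → Fin n → R) (e a : Fin n) :
    G.cov1 (fun a => G.tr (fun x y => T a x y)) e a = G.tr (fun x y => G.cov3 T e a x y) := by
  simp only [cov1, cov3, D_tr, Γ_tr, ← tr_sub]
  exact G.tr_congr fun _ _ => by ring

lemma cov2_tr (T : Fin n → Fin n → Fin n → Fin n → R) (e a b : Fin n) :
    G.cov2 (fun a b => G.tr (fun x y => T a b x y)) e a b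
      = G.tr (fun x y => G.cov4 T e a b x y) := by
  simp only [cov2, cov4, D_tr, Γ_tr, ← tr_sub]
  exact G.tr_congr fun _ _ => by ring

lemma cov1_add (v w : Fin n → R) (c a : Fin n) :
    G.cov1 (fun a => v a + w a) c a = G.cov1 v c a + G.cov1 w c a := by
  simp only [cov1, map_add, Γ_add]; ring

lemma cov1_mul (f : R) (w : Fin n → R) (c a : Fin n) :
    G.cov1 (fun a => f * w a) c a = G.D c f * w a + f * G.cov1 w c a := by
  simp only [cov1, D_mul, Γ_mul_left]; ring

lemma cov1_smul (r : ℝ) (w : Fin n → R) (c a : Fin n) :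
    G.cov1 (fun a => r • w a) c a = r • G.cov1 w c a := by
  simp only [cov1, Γ_smul, Derivation.map_smul, smul_sub]

lemma cov2_add (S T : Fin n → Fin n → R) (c a b : Fin n) :
    G.cov2 (fun a b => S a b + T a b) c a b = G.cov2 S c a b + G.cov2 T c a b := by
  simp only [cov2, map_add, Γ_add]; ring

lemma cov2_sub (S T : Fin n → Fin n → R) (c a b : Fin n) :
    G.cov2 (fun a b => S a b - T a b) c a b = G.cov2 S c a b - G.cov2 T c a b := by
  simp only [cov2, map_sub, Γ_sub]; ring

lemma cov2_neg (T : Fin n → Fin n → R) (c a b : Fin n) :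
    G.cov2 (fun a b => - T a b) c a b = - G.cov2 T c a b := by
  simp only [cov2, map_neg, Γ_neg]; ring

lemma cov2_smul (r : ℝ) (T : Fin n → Fin n → R) (c a b : Fin n) :
    G.cov2 (fun a b => r • T a b) c a b = r • G.cov2 T c a b := by
  simp only [cov2, Γ_smul, Derivation.map_smul, smul_sub]

lemma cov2_mul (f : R) (T : Fin n → Fin n → R) (c a b : Fin n) :
    G.cov2 (fun a b => f * T a b) c a b = G.D c f * T a b + f * G.cov2 T c a b := by
  simp only [cov2, D_mul, Γ_mul_left]; ring

lemma cov2_mul_g (f : R) (c a b : Fin n) :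
    G.cov2 (fun a b => f * G.g a b) c a b = G.D c f * G.g a b := by
  rw [cov2_mul, cov2_g]; ring

lemma cov2_prod (v w : Fin n → R) (c a b : Fin n) :
    G.cov2 (fun a b => v a * w b) c a b = G.cov1 v c a * w b + v a * G.cov1 w c b := by
  simp only [cov2, cov1, D_mul, Γ_mul_left, Γ_mul_right]; ring

lemma cov2_symm {T : Fin n → Fin n → R} (h : ∀ a b, T a b = T b a) (c a b : Fin n) :
    G.cov2 T c a b = G.cov2 T c b a := by
  simp only [cov2, h a b]
  rw [show (fun d => T d b) = fun d => T b d from funext fun d => h d b,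
    show (fun d => T a d) = fun d => T d a from funext fun d => h a d]
  ring

lemma cov2_swap (T : Fin n → Fin n → R) (c a b : Fin n) :
    G.cov2 (fun a b => T b a) c a b = G.cov2 T c b a := by
  simp only [cov2]; ring

lemma cov3_add (S T : Fin n → Fin n → Fin n → R) (d a b c : Fin n) :
    G.cov3 (fun a b c => S a b c + T a b c) d a b c = G.cov3 S d a b c + G.cov3 T d a b c := by
  simp only [cov3, map_add, Γ_add]; ring

lemma cov3_mul (f : R) (T : Fin n → Fin n → Fin n → R) (d a b c : Fin n) :
    G.cov3 (fun a b c => f * T a b c) d a b c = G.D d f * T a b c + f * G.cov3 T d a b c := by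
  simp only [cov3, D_mul, Γ_mul_left]; ring

lemma cov3_prod (v : Fin n → R) (T : Fin n → Fin n → R) (d a b c : Fin n) :
    G.cov3 (fun a b c => v a * T b c) d a b c
      = G.cov1 v d a * T b c + v a * G.cov2 T d b c := by
  simp only [cov3, cov2, cov1, D_mul, Γ_mul_left, Γ_mul_right]; ring

lemma cov3_swap (T : Fin n → Fin n → Fin n → R) (d a b c : Fin n) :
    G.cov3 (fun a b c => T b a c) d a b c = G.cov3 T d b a c := by
  simp only [cov3]; ring

/-- The contraction `T_{abc}{}^d w_d`. -/
lemma cov3_tr_mul (T : Fin n → Fin n → Fin n → Fin n → R) (w : Fin n → R) (e a b c : Fin n) :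
    G.cov3 (fun a b c => G.tr (fun x y => T a b c x * w y)) e a b c
      = G.tr (fun x y => G.cov4 T e a b c x * w y + T a b c x * G.cov1 w e y) := by
  simp only [cov3, cov4, cov1, D_tr, D_mul, Γ_tr, Γ_mul_left, Γ_mul_right, ← tr_sub]
  exact G.tr_congr fun _ _ => by ring

lemma cov1_tr_mul (T : Fin n → Fin n → R) (w : Fin n → R) (e a : Fin n) :
    G.cov1 (fun a => G.tr (fun x y => T a x * w y)) e a
      = G.tr (fun x y => G.cov2 T e a x * w y + T a x * G.cov1 w e y) := by
  simp only [cov2, cov1, D_tr, D_mul, Γ_tr, Γ_mul_left, Γ_mul_right, ← tr_sub]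
  exact G.tr_congr fun _ _ => by ring

lemma cov2_tr_mul (T : Fin n → Fin n → Fin n → R) (w : Fin n → R) (e a b : Fin n) :
    G.cov2 (fun a b => G.tr (fun x y => T a b x * w y)) e a b
      = G.tr (fun x y => G.cov3 T e a b x * w y + T a b x * G.cov1 w e y) := by
  simp only [cov3, cov2, cov1, D_tr, D_mul, Γ_tr, Γ_mul_left, Γ_mul_right, ← tr_sub]
  exact G.tr_congr fun _ _ => by ring

lemma D_tr_mul (v w : Fin n → R) (e : Fin n) :
    G.D e (G.tr (fun x y => v x * w y))
      = G.tr (fun x y => G.cov1 v e x * w y + v x * G.cov1 w e y) := by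
  simp only [cov1, D_tr, D_mul, Γ_mul_left, Γ_mul_right]
  exact G.tr_congr fun _ _ => by ring

lemma cov1_D_symm (f : R) (a b : Fin n) :
    G.cov1 (fun x => G.D x f) a b = G.cov1 (fun x => G.D x f) b a := by
  simp only [cov1, G.D_comm a b, G.Γ_symm a _ b]

end MetricAlgebra

end

/-! ## Curvature -/

section

namespace MetricAlgebra

variable {n : ℕ} {R : Type*} [CommRing R] [Algebra ℝ R] (G : MetricAlgebra n R)

/-! ### The Riemann tensor -/

/-- `R_{ab}{}^c{}_d`. -/
def riemUp (a b c d : Fin n) : R :=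
  G.D a (G.chr c b d) - G.D b (G.chr c a d)
    + ∑ e, (G.chr c a e * G.chr e b d - G.chr c b e * G.chr e a d)

/-- `R_{abcd}`. -/
def riem (a b c d : Fin n) : R := ∑ e, G.g c e * G.riemUp a b e d

/-- The Ricci tensor. -/
def ric (b d : Fin n) : R := ∑ a, G.riemUp a b a d

/-- The scalar curvature. -/
def scal : R := G.tr G.ric

lemma tr_riem_mul (a b c : Fin n) (w : Fin n → R) :
    G.tr (fun x y => G.riem a b x c * w y) = ∑ d, G.riemUp a b d c * w d := by
  simp only [tr, riem, Finset.sum_mul, Finset.mul_sum]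
  rw [Finset.sum_comm]
  have h : ∀ y x e, G.gi x y * (G.g x e * G.riemUp a b e c * w y)
      = (G.gi y x * G.g x e) * (G.riemUp a b e c * w y) := fun y x e => by
    rw [G.gi_symm]; ring
  simp only [h]
  refine Finset.sum_congr rfl fun y _ => ?_
  rw [Finset.sum_comm]
  simp only [← Finset.sum_mul, G.gi_mul_g]
  simp

lemma ric_eq (b d : Fin n) : G.ric b d = G.tr (fun x y => G.riem x b y d) := by
  simp only [tr, riem, ric, Finset.mul_sum]
  refine Finset.sum_congr rfl fun x _ => ?_
  rw [Finset.sum_comm]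
  simp only [← mul_assoc, ← Finset.sum_mul, G.gi_mul_g]
  simp

lemma riemUp_antisymm (a b c d : Fin n) : G.riemUp a b c d = - G.riemUp b a c d := by
  simp only [riemUp, Finset.sum_sub_distrib]; ring

lemma riem_antisymm_left (a b c d : Fin n) : G.riem a b c d = - G.riem b a c d := by
  simp only [riem, ← Finset.sum_neg_distrib]
  exact Finset.sum_congr rfl fun e _ => by rw [riemUp_antisymm]; ring

/-- The first Bianchi identity, a consequence of the symmetry of the Christoffel symbols alone. -/
lemma riemUp_cyclic (a b c d : Fin n) :
    G.riemUp a b c d + G.riemUp b d c a + G.riemUp d a c b = 0 := by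
  simp only [riemUp]
  rw [G.chr_symm c b d, G.chr_symm c a d, G.chr_symm c b a]
  have h : (∑ e, (G.chr c a e * G.chr e b d - G.chr c b e * G.chr e a d))
      + (∑ e, (G.chr c b e * G.chr e d a - G.chr c d e * G.chr e b a))
      + (∑ e, (G.chr c d e * G.chr e a b - G.chr c a e * G.chr e d b)) = 0 := by
    rw [← Finset.sum_add_distrib, ← Finset.sum_add_distrib]
    refine Finset.sum_eq_zero fun e _ => ?_
    rw [G.chr_symm e b d, G.chr_symm e a d, G.chr_symm e b a]; ring
  linear_combination h

lemma riem_cyclic (a b c d : Fin n) :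
    G.riem a b c d + G.riem b d c a + G.riem d a c b = 0 := by
  simp only [riem, ← Finset.sum_add_distrib, ← mul_add, riemUp_cyclic]
  simp

/-! Matrix form of the connection and of the curvature. -/

/-- The entrywise derivative of a matrix. -/
def DM (a : Fin n) (M : Matrix (Fin n) (Fin n) R) : Matrix (Fin n) (Fin n) R := M.map (G.D a)

/-- The connection matrix. -/
def Gm (a : Fin n) : Matrix (Fin n) (Fin n) R := Matrix.of fun c d => G.chr c a d

/-- The curvature matrix. -/
def Rm (a b : Fin n) : Matrix (Fin n) (Fin n) R := Matrix.of fun c d => G.riemUp a b c d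

/-- The metric as a matrix. -/
def gm : Matrix (Fin n) (Fin n) R := Matrix.of G.g

lemma DM_mul (a : Fin n) (M N : Matrix (Fin n) (Fin n) R) :
    G.DM a (M * N) = G.DM a M * N + M * G.DM a N := by
  ext i j
  simp only [DM, Matrix.map_apply, Matrix.mul_apply, map_sum, D_mul, Matrix.add_apply,
    Finset.sum_add_distrib]

lemma DM_add (a : Fin n) (M N : Matrix (Fin n) (Fin n) R) :
    G.DM a (M + N) = G.DM a M + G.DM a N := by ext; simp [DM]

lemma DM_sub (a : Fin n) (M N : Matrix (Fin n) (Fin n) R) :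
    G.DM a (M - N) = G.DM a M - G.DM a N := by ext; simp [DM]

lemma DM_transpose (a : Fin n) (M : Matrix (Fin n) (Fin n) R) :
    G.DM a M.transpose = (G.DM a M).transpose := by ext; simp [DM]

lemma DM_comm (a b : Fin n) (M : Matrix (Fin n) (Fin n) R) :
    G.DM a (G.DM b M) = G.DM b (G.DM a M) := by
  ext i j; simp only [DM, Matrix.map_apply]; exact G.D_comm a b _

/-- The curvature of the matrix connection A, namely ∂_a A_b − ∂_b A_a + [A_a, A_b]. In this form
skewness and the second Bianchi identity become identities in a noncommutative ring. -/
lemma Rm_eq (a b : Fin n) : G.Rm a b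
    = G.DM a (G.Gm b) - G.DM b (G.Gm a) + G.Gm a * G.Gm b - G.Gm b * G.Gm a := by
  ext c d
  simp only [Rm, riemUp, DM, Gm, Matrix.of_apply, Matrix.sub_apply, Matrix.add_apply,
    Matrix.map_apply, Matrix.mul_apply, Finset.sum_sub_distrib]
  ring

lemma DM_gm (a : Fin n) : G.DM a G.gm = (G.Gm a).transpose * G.gm + G.gm * G.Gm a := by
  ext c d
  simp only [DM, gm, Gm, Matrix.map_apply, Matrix.of_apply, Matrix.add_apply, Matrix.mul_apply,
    Matrix.transpose_apply, D_g, Γ]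
  congr 1
  exact Finset.sum_congr rfl fun _ _ => by ring

/-- The second derivatives of the metric commute; inserting `DM_gm` twice into this fact leaves
exactly the skewness of the curvature with respect to the metric. -/
lemma gm_mul_Rm (a b : Fin n) : G.gm * G.Rm a b + (G.Rm a b).transpose * G.gm = 0 := by
  have h := G.DM_comm a b G.gm
  simp only [DM_gm, DM_add, DM_mul, DM_transpose] at h
  rw [Rm_eq]
  simp only [Matrix.transpose_sub, Matrix.transpose_add, Matrix.transpose_mul]
  rw [← sub_eq_zero] at h
  rw [← h]
  noncomm_ring

lemma riem_antisymm_right (a b c d : Fin n) : G.riem a b c d = - G.riem a b d c := by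
  have h := congrFun (congrFun (G.gm_mul_Rm a b) c) d
  simp only [Matrix.add_apply, Matrix.mul_apply, gm, Rm, Matrix.of_apply, Matrix.transpose_apply,
    Matrix.zero_apply] at h
  have h2 : G.riem a b d c = ∑ x, G.riemUp a b x c * G.g x d :=
    Finset.sum_congr rfl fun x _ => by rw [G.g_symm, mul_comm]
  rw [h2, riem]
  linear_combination h

omit [Algebra ℝ R] in
-- The classical octahedron argument from four cyclic identities. The factor 2 stays because R is
-- only a commutative ring here; it is removed by a real scalar afterwards.
lemma pair_symm_aux {T : Fin n → Fin n → Fin n → Fin n → R}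
    (hl : ∀ a b c d, T a b c d = - T b a c d) (hr : ∀ a b c d, T a b c d = - T a b d c)
    (hc : ∀ a b c d, T a b c d + T b d c a + T d a c b = 0) (a b c d : Fin n) :
    2 * T a b c d = 2 * T c d a b := by
  have h1 := hc a b c d
  have h2 := hc b c d a
  have h3 := hc c d a b
  have h4 := hc d a b c
  grind

lemma riem_pair_symm (a b c d : Fin n) : G.riem a b c d = G.riem c d a b := by
  have key := pair_symm_aux G.riem_antisymm_left G.riem_antisymm_right G.riem_cyclic a b c d
  linear_combination (norm := algebra) (1 / 2 : ℝ) • key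

lemma ric_symm (b d : Fin n) : G.ric b d = G.ric d b := by
  rw [ric_eq, ric_eq, ← tr_swap]
  exact G.tr_congr fun x y => by rw [riem_pair_symm]

/-- The second Bianchi identity. -/
lemma bianchi (e a b c d : Fin n) : G.cov4 G.riem e a b c d + G.cov4 G.riem a b e c d
    + G.cov4 G.riem b e a c d = 0 := by
  have h : ∀ e a b c d, G.D e (G.riem a b c d) - G.Γ e (fun x => G.riem a b x d) c
      - G.Γ e (fun x => G.riem a b c x) d
      = (G.gm * (G.DM e (G.Rm a b) + G.Gm e * G.Rm a b - G.Rm a b * G.Gm e)) c d := by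
    intro e a b c d
    have h0 : ∀ c d, G.riem a b c d = (G.gm * G.Rm a b) c d := fun c d => by
      simp [riem, gm, Rm, Matrix.mul_apply]
    have h1 : G.gm * (G.DM e (G.Rm a b) + G.Gm e * G.Rm a b - G.Rm a b * G.Gm e)
        = G.DM e (G.gm * G.Rm a b) - (G.Gm e).transpose * (G.gm * G.Rm a b)
          - (G.gm * G.Rm a b) * G.Gm e := by
      rw [DM_mul, DM_gm]; noncomm_ring
    rw [h1]
    simp only [Matrix.sub_apply, h0, Γ]
    congr 1
    rw [Matrix.mul_apply]
    exact Finset.sum_congr rfl fun x _ => by rw [mul_comm]; rfl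
  -- This is DF = 0 for the curvature F of the matrix connection.
  have h2 : (G.DM e (G.Rm a b) + G.Gm e * G.Rm a b - G.Rm a b * G.Gm e)
      + (G.DM a (G.Rm b e) + G.Gm a * G.Rm b e - G.Rm b e * G.Gm a)
      + (G.DM b (G.Rm e a) + G.Gm b * G.Rm e a - G.Rm e a * G.Gm b) = 0 := by
    simp only [Rm_eq, DM_add, DM_sub, DM_mul]
    rw [G.DM_comm e a, G.DM_comm e b, G.DM_comm a b]
    noncomm_ring
  have h3 := congrArg (fun M : Matrix (Fin n) (Fin n) R => (G.gm * M) c d) h2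
  beta_reduce at h3
  rw [mul_add, mul_add, mul_zero, Matrix.add_apply, Matrix.add_apply, Matrix.zero_apply] at h3
  -- The matrix identity does not see the connection terms on the first two indices; those cancel in
  -- the cyclic sum by antisymmetry and the symmetry of the Christoffel symbols.
  have h4 : ∀ e a b, G.Γ e (fun x => G.riem b x c d) a = - G.Γ e (fun x => G.riem x b c d) a := by
    intro e a b
    rw [← Γ_neg]
    simp only [fun x => G.riem_antisymm_left b x c d]
  simp only [cov4]
  rw [h4 e b a, h4 a e b, h4 b a e, G.Γ_symm e _ a, G.Γ_symm e _ b, G.Γ_symm a _ b]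
  have k1 := h e a b c d
  have k2 := h a b e c d
  have k3 := h b e a c d
  linear_combination h3 + k1 + k2 + k3

/-! ### Ricci identities -/

lemma D_Γ (a b : Fin n) (w : Fin n → R) (c : Fin n) : G.D a (G.Γ b w c)
    = G.Γ b (fun d => G.D a (w d)) c + ∑ d, G.D a (G.chr d b c) * w d := by
  simp only [Γ, map_sum, D_mul, Finset.sum_add_distrib]; ring

lemma sum_riemUp_mul (a b : Fin n) (w : Fin n → R) (c : Fin n) :
    ∑ d, G.riemUp a b d c * w d = (∑ d, G.D a (G.chr d b c) * w d)
      - (∑ d, G.D b (G.chr d a c) * w d)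
      + G.Γ b (fun e => G.Γ a w e) c - G.Γ a (fun e => G.Γ b w e) c := by
  have h : ∀ a b, ∑ d, (∑ e, G.chr d a e * G.chr e b c) * w d = G.Γ b (fun e => G.Γ a w e) c := by
    intro a b
    simp only [Γ, Finset.mul_sum, Finset.sum_mul]
    rw [Finset.sum_comm]
    exact Finset.sum_congr rfl fun _ _ => Finset.sum_congr rfl fun _ _ => by ring
  simp only [riemUp, Finset.sum_sub_distrib, add_mul, sub_mul, Finset.sum_add_distrib, h]
  ring

/-- The curvature acts on covectors by minus the transpose of its action on vectors, hence the sign.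
The connection term on the derivative index is symmetric and drops out. -/
lemma ricci_identity (w : Fin n → R) (a b c : Fin n) :
    G.cov2 (G.cov1 w) a b c - G.cov2 (G.cov1 w) b a c
      = - G.tr (fun x y => G.riem a b x c * w y) := by
  rw [tr_riem_mul, sum_riemUp_mul]
  have h := G.Γ_symm a (fun d => G.cov1 w d c) b
  simp only [cov2, h]
  simp only [cov1, map_sub, Γ_sub, D_Γ, G.D_comm a b]
  ring

lemma ricci_identity₂ (T : Fin n → Fin n → R) (a b c d : Fin n) :
    G.cov3 (G.cov2 T) a b c d - G.cov3 (G.cov2 T) b a c d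
      = - G.tr (fun x y => G.riem a b x c * T y d) - G.tr (fun x y => G.riem a b x d * T c y) := by
  rw [G.tr_riem_mul a b c (fun y => T y d), G.tr_riem_mul a b d (fun y => T c y),
    sum_riemUp_mul, sum_riemUp_mul]
  have h := G.Γ_symm a (fun x => G.cov2 T x c d) b
  have h1 := G.Γ_comm a b T c d
  have h2 := G.Γ_comm b a T c d
  simp only [cov3, h]
  simp only [cov2, map_sub, Γ_sub, D_Γ, G.D_comm a b]
  linear_combination h1 - h2

/-! ### Contracted Bianchi identities -/

lemma cov4_perm₁₃ (T : Fin n → Fin n → Fin n → Fin n → R) (e a b x y : Fin n) :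
    G.cov4 (fun a b x y => T x a y b) e a b x y = G.cov4 T e x a y b := by
  simp only [cov4]; ring

lemma cov4_swap_left (T : Fin n → Fin n → Fin n → Fin n → R) (e a b c d : Fin n) :
    G.cov4 (fun a b c d => - T b a c d) e a b c d = - G.cov4 T e b a c d := by
  simp only [cov4, map_neg, Γ_neg]; ring

lemma cov4_swap_right (T : Fin n → Fin n → Fin n → Fin n → R) (e a b c d : Fin n) :
    G.cov4 (fun a b c d => - T a b d c) e a b c d = - G.cov4 T e a b d c := by
  simp only [cov4, map_neg, Γ_neg]; ring

lemma cov4_swap_pair (T : Fin n → Fin n → Fin n → Fin n → R) (e a b c d : Fin n) :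
    G.cov4 (fun a b c d => T c d a b) e a b c d = G.cov4 T e c d a b := by
  simp only [cov4]; ring

lemma cov2_ric (e b d : Fin n) :
    G.cov2 G.ric e b d = G.tr (fun x y => G.cov4 G.riem e x b y d) := by
  have h : G.ric = fun b d => G.tr (fun x y => G.riem x b y d) := by
    funext b d; exact G.ric_eq b d
  rw [h, G.cov2_tr (fun b d x y => G.riem x b y d)]
  exact G.tr_congr fun x y => G.cov4_perm₁₃ _ _ _ _ _ _

lemma cov4_riem_left (e a b c d : Fin n) :
    G.cov4 G.riem e a b c d = - G.cov4 G.riem e b a c d := by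
  conv_lhs => rw [show G.riem = fun a b c d => - G.riem b a c d from by
    funext a b c d; exact G.riem_antisymm_left a b c d]
  exact G.cov4_swap_left G.riem _ _ _ _ _

lemma cov4_riem_right (e a b c d : Fin n) :
    G.cov4 G.riem e a b c d = - G.cov4 G.riem e a b d c := by
  conv_lhs => rw [show G.riem = fun a b c d => - G.riem a b d c from by
    funext a b c d; exact G.riem_antisymm_right a b c d]
  exact G.cov4_swap_right G.riem _ _ _ _ _

lemma div_riem (a b d : Fin n) : G.tr (fun e c => G.cov4 G.riem e a b c d)
    = G.cov2 G.ric a b d - G.cov2 G.ric b a d := by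
  rw [cov2_ric, cov2_ric, ← tr_sub]
  refine G.tr_congr fun x y => ?_
  have h := G.bianchi x a b y d
  have h1 := G.cov4_riem_left a b x y d
  linear_combination h - h1

/-- The second Bianchi identity contracted twice, the first contraction being `div_riem`. -/
lemma div_ric (b : Fin n) :
    G.tr (fun x y => G.cov2 G.ric x b y) + G.tr (fun x y => G.cov2 G.ric x b y)
      = G.D b G.scal := by
  have h1 : G.tr (fun x y => G.tr (fun e c => G.cov4 G.riem e b x c y))
      = G.tr (fun e c => G.cov2 G.ric e b c) := by
    rw [tr_comm]
    refine G.tr_congr fun e c => ?_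
    rw [cov2_ric]
    refine G.tr_congr fun x y => ?_
    rw [cov4_riem_left, cov4_riem_right, neg_neg]
  simp only [div_riem] at h1
  rw [tr_sub] at h1
  rw [scal, D_tr_cov]
  linear_combination -h1

end MetricAlgebra

end

/-! ## The Schouten, Weyl, Cotton and Bach tensors -/

section

namespace MetricAlgebra

variable {R : Type*} [CommRing R] [Algebra ℝ R]

/-- The divergence `∇^x T_{bx}`. -/
def div {n : ℕ} (G : MetricAlgebra n R) (T : Fin n → Fin n → R) (b : Fin n) : R :=
  G.tr (fun x y => G.cov2 T x b y)

lemma tr_cov3_cov2 {n : ℕ} (G : MetricAlgebra n R) (T : Fin n → Fin n → R) (b c : Fin n) :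
    G.tr (fun e a => G.cov3 (G.cov2 T) b e c a) = G.cov1 (G.div T) b c := by
  rw [show G.div T = fun c => G.tr (fun x y => G.cov2 T x c y) from rfl,
    G.cov1_tr (fun c x y => G.cov2 T x c y)]
  exact G.tr_congr fun x y => (G.cov3_swap (G.cov2 T) b c x y).symm

/-- `∇^a ∇_b T_{ca}` in terms of `∇_b ∇^a T_{ca}`. -/
lemma div_cov2_comm {n : ℕ} (G : MetricAlgebra n R) (T : Fin n → Fin n → R) (b c : Fin n) :
    G.tr (fun e a => G.cov3 (G.cov2 T) e b c a) = G.cov1 (G.div T) b c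
      + G.tr (fun x y => G.ric b x * T c y)
      - G.tr (fun e a => G.tr (fun x y => G.riem e b x c * T y a)) := by
  have h : ∀ e a, G.cov3 (G.cov2 T) e b c a = G.cov3 (G.cov2 T) b e c a
      - G.tr (fun x y => G.riem e b x c * T y a) - G.tr (fun x y => G.riem e b x a * T c y) := by
    intro e a
    linear_combination G.ricci_identity₂ T e b c a
  have h2 : G.tr (fun e a => G.tr (fun x y => G.riem e b x a * T c y))
      = - G.tr (fun x y => G.ric b x * T c y) := by
    rw [tr_comm, ← tr_neg]
    refine G.tr_congr fun x y => ?_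
    rw [tr_mul_right, ric_eq, ← neg_mul, ← tr_neg]
    congr 1
    exact G.tr_congr fun e a => by rw [riem_antisymm_right]
  rw [G.tr_congr h, tr_sub, tr_sub, h2, tr_cov3_cov2]
  ring

variable (G : MetricAlgebra 4 R)

/-- The Schouten tensor. -/
def schouten (a b : Fin 4) : R := (1 / 2 : ℝ) • (G.ric a b - (1 / 6 : ℝ) • (G.scal * G.g a b))

/-- The trace of the Schouten tensor. -/
def J : R := G.tr G.schouten

/-- The Weyl tensor. -/
def weyl (a b c d : Fin 4) : R :=
  G.riem a b c d - (G.g c a * G.schouten b d - G.g c b * G.schouten a d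
    + G.g d b * G.schouten a c - G.g d a * G.schouten b c)

/-- The Cotton tensor. -/
def cotton (a b c : Fin 4) : R := G.cov2 G.schouten b c a - G.cov2 G.schouten c b a

/-- The Bach tensor. -/
def bach (a b : Fin 4) : R :=
  - G.tr (fun c d => G.cov3 G.cotton d a b c)
    + G.tr (fun d e => G.tr (fun c f => G.schouten e f * G.weyl d a c b))

lemma schouten_symm (a b : Fin 4) : G.schouten a b = G.schouten b a := by
  rw [schouten, schouten, ric_symm, G.g_symm]

lemma tr_g_four : G.tr (fun a b => G.g a b) = 4 := by simpa using G.tr_g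

lemma J_eq : (6 : R) * G.J = G.scal := by
  have : G.J = (1 / 2 : ℝ) • (G.scal - (1 / 6 : ℝ) • (G.scal * 4)) := by
    rw [J, show G.schouten = fun a b => (1 / 2 : ℝ) • (G.ric a b - (1 / 6 : ℝ) •
      (G.scal * G.g a b)) from rfl, tr_smul, tr_sub, tr_smul, tr_mul_left, tr_g_four]
    rfl
  rw [this]; algebra

lemma ric_eq_schouten (a b : Fin 4) : G.ric a b = 2 * G.schouten a b + G.J * G.g a b := by
  rw [schouten, ← J_eq]; algebra

lemma tr_schouten : G.tr (fun a b => G.schouten a b) = G.J := rfl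

lemma weyl_antisymm_left (a b c d : Fin 4) : G.weyl a b c d = - G.weyl b a c d := by
  rw [weyl, weyl, riem_antisymm_left]; ring

lemma weyl_antisymm_right (a b c d : Fin 4) : G.weyl a b c d = - G.weyl a b d c := by
  rw [weyl, weyl, riem_antisymm_right]; ring

lemma weyl_pair_symm (a b c d : Fin 4) : G.weyl a b c d = G.weyl c d a b := by
  rw [weyl, weyl, G.riem_pair_symm, G.schouten_symm b d, G.schouten_symm a d, G.schouten_symm b c,
    G.schouten_symm a c, G.g_symm c a, G.g_symm c b, G.g_symm d a, G.g_symm d b]; ring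

lemma tr_weyl (b d : Fin 4) : G.tr (fun x y => G.weyl x b y d) = 0 := by
  simp only [weyl, tr_add, tr_sub, ← ric_eq, tr_mul_left, tr_g_left', tr_g_right,
    ric_eq_schouten]
  have h1 : G.tr (fun x y => G.g y x * G.schouten b d) = 4 * G.schouten b d := by
    rw [tr_mul_right, G.tr_swap (fun x y => G.g x y), tr_g_four]
  have h2 : G.tr (fun x y => G.g y b * G.schouten x d) = G.schouten b d := G.tr_g_right _ _
  have h3 : G.tr (fun x y => G.g d x * G.schouten b y) = G.schouten b d := G.tr_g_left' _ _
  rw [h1, tr_schouten, G.g_symm d b]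
  ring

lemma tr_weyl' (b d : Fin 4) : G.tr (fun x y => G.weyl b x y d) = 0 := by
  have h := G.tr_weyl b d
  rw [← neg_eq_zero, ← tr_neg] at h
  rw [← h]
  exact G.tr_congr fun x y => G.weyl_antisymm_left _ _ _ _

lemma cov2_ric_eq (c a b : Fin 4) : G.cov2 G.ric c a b
    = 2 * G.cov2 G.schouten c a b + G.D c G.J * G.g a b := by
  rw [show G.ric = fun a b => (G.schouten a b + G.schouten a b) + G.J * G.g a b from by
    funext a b; rw [ric_eq_schouten]; ring, G.cov2_add (fun a b => G.schouten a b + G.schouten a b),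
    G.cov2_add G.schouten, cov2_mul_g]
  ring

lemma div_schouten (b : Fin 4) : G.div G.schouten b = G.D b G.J := by
  have h := G.div_ric b
  have h2 : G.tr (fun x y => G.cov2 G.ric x b y) = 2 * G.div G.schouten b + G.D b G.J := by
    simp only [cov2_ric_eq, tr_add, tr_mul_left, div]
    congr 1
    simp only [mul_comm (G.D _ G.J)]
    exact G.tr_g_right' (fun x => G.D x G.J) b
  have h3 : G.D b G.scal = 6 * G.D b G.J := by
    rw [← J_eq, D_mul]
    have : G.D b (6 : R) = 0 := by
      have := (G.D b).map_algebraMap 6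
      rwa [map_ofNat] at this
    rw [this]; ring
  rw [h2, h3] at h
  linear_combination (norm := algebra) (1 / 4 : ℝ) • h

lemma cov4_weyl (e a b c d : Fin 4) : G.cov4 G.weyl e a b c d = G.cov4 G.riem e a b c d
    - (G.g c a * G.cov2 G.schouten e b d - G.g c b * G.cov2 G.schouten e a d
    + G.g d b * G.cov2 G.schouten e a c - G.g d a * G.cov2 G.schouten e b c) := by
  simp only [cov4, weyl, map_sub, map_add, D_mul, D_g, Γ_sub, Γ_add, Γ_mul_left, Γ_mul_right, cov2]
  ring

lemma cotton_antisymm (a b c : Fin 4) : G.cotton a b c = - G.cotton a c b := by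
  rw [cotton, cotton]; ring

lemma cotton_cyclic (a b c : Fin 4) : G.cotton a b c + G.cotton b c a + G.cotton c a b = 0 := by
  simp only [cotton]
  rw [G.cov2_symm G.schouten_symm b c a, G.cov2_symm G.schouten_symm c b a,
    G.cov2_symm G.schouten_symm a c b]
  ring

lemma tr_cotton (c : Fin 4) : G.tr (fun a b => G.cotton a b c) = 0 := by
  simp only [cotton, tr_sub]
  have h1 : G.tr (fun a b => G.cov2 G.schouten b c a) = G.D c G.J := by
    rw [← div_schouten, div, ← tr_swap]
  have h2 : G.tr (fun a b => G.cov2 G.schouten c b a) = G.D c G.J := by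
    rw [J, D_tr_cov, ← tr_swap]
  rw [h1, h2, sub_self]

/-- The divergence of the Weyl tensor. -/
lemma div_weyl (a b d : Fin 4) : G.tr (fun e c => G.cov4 G.weyl e a b c d) = G.cotton d a b := by
  simp only [cov4_weyl, tr_add, tr_sub, div_riem, tr_mul_left, cov2_ric_eq]
  have h1 : G.tr (fun x y => G.g y a * G.cov2 G.schouten x b d) = G.cov2 G.schouten a b d :=
    G.tr_g_right _ _
  have h2 : G.tr (fun x y => G.g y b * G.cov2 G.schouten x a d) = G.cov2 G.schouten b a d :=
    G.tr_g_right _ _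
  have h3 : ∀ b, G.tr (fun x y => G.cov2 G.schouten x b y) = G.D b G.J := G.div_schouten
  -- The gradients of J cancel, and the factor n − 3 in front of the Cotton tensor is 1 in dimension
  -- four.
  rw [h1, h2, h3, h3, cotton, G.g_symm d b, G.g_symm d a]
  ring

lemma cov3_cotton (e a b c : Fin 4) : G.cov3 G.cotton e a b c
    = G.cov3 (G.cov2 G.schouten) e b c a - G.cov3 (G.cov2 G.schouten) e c b a := by
  rw [show G.cotton = fun a b c => G.cov2 G.schouten b c a - G.cov2 G.schouten c b a from rfl]
  simp only [cov3, map_sub, Γ_sub]; ring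

lemma cov3_cotton_antisymm (e a b c : Fin 4) :
    G.cov3 G.cotton e a b c = - G.cov3 G.cotton e a c b := by
  rw [cov3_cotton, cov3_cotton]; ring

lemma cov3_cotton_cyclic (e a b c : Fin 4) :
    G.cov3 G.cotton e a b c + G.cov3 G.cotton e b c a + G.cov3 G.cotton e c a b = 0 := by
  have h : ∀ e a b c, G.cov3 (G.cov2 G.schouten) e a b c = G.cov3 (G.cov2 G.schouten) e a c b := by
    intro e a b c
    conv_lhs => rw [show G.cov2 G.schouten = fun a b c => G.cov2 G.schouten a c b from by
      funext a b c; exact G.cov2_symm G.schouten_symm a b c]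
    simp only [cov3]; ring
  simp only [cov3_cotton]
  rw [h e b c a, h e c b a, h e a c b]; ring

lemma tr_tr_riem_symm {T : Fin 4 → Fin 4 → R} (hT : ∀ a b, T a b = T b a) (b c : Fin 4) :
    G.tr (fun e a => G.tr (fun x y => G.riem e b x c * T y a))
      = G.tr (fun e a => G.tr (fun x y => G.riem e c x b * T y a)) := by
  rw [tr_comm]
  refine G.tr_congr fun e a => G.tr_congr fun x y => ?_
  rw [riem_pair_symm, hT]

/-- By `div_cov2_comm` the divergence of ∇_b P_ca in its last index is ∇_b∇_c J plus a Ricci term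
and a Riemann term, and each of them is symmetric in b and c. This is what makes the Bach tensor
symmetric. -/
lemma tr_cov3_cotton (b c : Fin 4) : G.tr (fun e a => G.cov3 G.cotton e a b c) = 0 := by
  have h : ∀ b c, G.tr (fun x y => G.ric b x * G.schouten c y)
      = G.tr (fun x y => G.ric c x * G.schouten b y) := by
    intro b c
    simp only [ric_eq_schouten, add_mul, tr_add, mul_assoc, tr_mul_left]
    rw [G.tr_g_left' (fun y => G.schouten c y), G.tr_g_left' (fun y => G.schouten b y),
      G.schouten_symm c b, ← G.tr_swap (fun x y => G.schouten b x * G.schouten c y)]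
    congr 2
    exact G.tr_congr fun x y => mul_comm _ _
  simp only [cov3_cotton, tr_sub, div_cov2_comm]
  rw [h b c, G.tr_tr_riem_symm G.schouten_symm b c,
    show G.div G.schouten = fun x => G.D x G.J from funext G.div_schouten, G.cov1_D_symm _ b c]
  ring

/-- By the cyclic identity the antisymmetric part of ∇^c A_abc is a divergence of A in its first
index, which vanishes by `tr_cov3_cotton`. The algebraic term is symmetric by the pair symmetry of
the Weyl tensor. -/
lemma bach_symm (a b : Fin 4) : G.bach a b = G.bach b a := by
  have h1 : G.tr (fun c d => G.cov3 G.cotton d a b c) - G.tr (fun c d => G.cov3 G.cotton d b a c)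
      = 0 := by
    rw [← tr_sub, ← tr_swap, ← neg_eq_zero, ← tr_neg, ← G.tr_cov3_cotton a b]
    refine G.tr_congr fun x y => ?_
    have := G.cov3_cotton_cyclic x a b y
    have := G.cov3_cotton_antisymm x b y a
    linear_combination (-1 : R) * G.cov3_cotton_cyclic x a b y + G.cov3_cotton_antisymm x b y a
  have h2 : ∀ a b, G.tr (fun d e => G.tr (fun c f => G.schouten e f * G.weyl d a c b))
      = G.tr (fun d e => G.tr (fun c f => G.schouten e f * G.weyl d b c a)) := by
    intro a b
    rw [tr_comm]
    refine G.tr_congr fun e a => G.tr_congr fun x y => ?_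
    rw [weyl_pair_symm, schouten_symm]
  rw [bach, bach, h2 a b]
  linear_combination -h1

end MetricAlgebra

end

/-! ## Unphysical fields over algebras -/

section

namespace MetricAlgebra

variable {n : ℕ} {R : Type*} [CommRing R] [Algebra ℝ R] (G : MetricAlgebra n R)

/-- The gradient of a function. -/
def grad (f : R) (a : Fin n) : R := G.D a f

/-- The Laplacian of a function. -/
def lap (f : R) : R := G.tr (fun a b => G.cov1 (G.grad f) a b)

/-- The Laplacian of a covariant 2-tensor. -/
def lap₂ (T : Fin n → Fin n → R) (b c : Fin n) : R :=
  G.tr (fun e a => G.cov3 (G.cov2 T) e a b c)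

/-- The contraction `v_a w^a`. -/
def dot (v w : Fin n → R) : R := G.tr (fun x y => v x * w y)

/-- The contraction `T_{ab} w^b`. -/
def ctr (T : Fin n → Fin n → R) (w : Fin n → R) (a : Fin n) : R := G.tr (fun x y => T a x * w y)

/-- The directional derivative `w^c ∇_c T_{ab}`. -/
def dir₂ (w : Fin n → R) (T : Fin n → Fin n → R) (a b : Fin n) : R :=
  G.tr (fun x y => w x * G.cov2 T y a b)

lemma cov1_grad_symm (f : R) (a b : Fin n) : G.cov1 (G.grad f) a b = G.cov1 (G.grad f) b a :=
  G.cov1_D_symm f a b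

lemma grad_mul (f h : R) (a : Fin n) : G.grad (f * h) a = G.grad f a * h + f * G.grad h a :=
  G.D_mul a f h

lemma grad_pow (f : R) (k : ℕ) (a : Fin n) :
    G.grad (f ^ (k + 1)) a = (k + 1 : ℝ) • (f ^ k * G.grad f a) := by
  simp only [grad, Derivation.leibniz_pow, Nat.add_sub_cancel, smul_eq_mul, nsmul_eq_mul,
    Nat.cast_add, Nat.cast_one]
  have : ((k : R) + 1) = algebraMap ℝ R (k + 1) := by simp
  rw [this, Algebra.smul_def]

lemma lap₂_mul (f : R) (T : Fin n → Fin n → R) (b c : Fin n) :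
    G.lap₂ (fun b c => f * T b c) b c
      = G.lap f * T b c + 2 * G.dir₂ (G.grad f) T b c + f * G.lap₂ T b c := by
  have e : ∀ e a, G.cov3 (G.cov2 (fun b c => f * T b c)) e a b c
      = G.cov1 (G.grad f) e a * T b c + G.grad f a * G.cov2 T e b c
        + G.grad f e * G.cov2 T a b c + f * G.cov3 (G.cov2 T) e a b c := by
    intro e a
    rw [show G.cov2 (fun b c => f * T b c) = fun a b c => G.grad f a * T b c
        + f * G.cov2 T a b c from by funext a b c; rw [cov2_mul]; rfl,
      G.cov3_add (fun a b c => G.grad f a * T b c), cov3_prod, cov3_mul]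
    simp only [grad]; ring
  rw [lap₂, G.tr_congr e]
  simp only [tr_add, tr_mul_left, tr_mul_right]
  rw [G.tr_swap (fun x y => G.grad f x * G.cov2 T y b c)]
  simp only [lap, dir₂, lap₂]; ring

lemma dot_comm (v w : Fin n → R) : G.dot v w = G.dot w v := by
  rw [dot, ← tr_swap]; exact G.tr_congr fun _ _ => mul_comm _ _

lemma div_mul (f : R) (T : Fin n → Fin n → R) (b : Fin n) :
    G.div (fun a b => f * T a b) b = G.ctr T (G.grad f) b + f * G.div T b := by
  simp only [div, cov2_mul, tr_add, tr_mul_left, ctr, grad]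
  rw [← tr_swap]
  congr 1
  exact G.tr_congr fun _ _ => mul_comm _ _

lemma div_mul_g (f : R) (b : Fin n) : G.div (fun a b => f * G.g a b) b = G.grad f b := by
  simp only [div, cov2_mul_g, mul_comm (G.D _ f)]
  exact G.tr_g_right' (fun x => G.D x f) b

lemma div_sub (S T : Fin n → Fin n → R) (b : Fin n) :
    G.div (fun a b => S a b - T a b) b = G.div S b - G.div T b := by
  simp only [div, cov2_sub, tr_sub]

end MetricAlgebra

/-- The unphysical fields of a solution of the Einstein equations, over an algebra of functions. -/
structure MatterAlgebra (R : Type*) [CommRing R] [Algebra ℝ R] extends MetricAlgebra 4 R where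
  /-- the defining function of the boundary -/
  Om : R
  /-- the stress-energy tensor -/
  τ : Fin 4 → Fin 4 → R
  /-- the normalized cosmological constant -/
  lam : ℝ
  /-- the decay rate of the stress-energy tensor -/
  q : ℕ
  Om_cancel : ∀ f, Om * f = 0 → f = 0
  einstein : ∀ a b, Om * toMetricAlgebra.cov1 (toMetricAlgebra.grad Om) a b
    + Om ^ 2 * toMetricAlgebra.schouten a b
    - (1 / 2 : ℝ) • ((toMetricAlgebra.dot (toMetricAlgebra.grad Om) (toMetricAlgebra.grad Om)
      + algebraMap ℝ R lam) * toMetricAlgebra.g a b)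
    = (1 / 2 : ℝ) • (Om ^ (q + 2) * (τ a b - (1 / 3 : ℝ) • (toMetricAlgebra.tr τ
      * toMetricAlgebra.g a b)))

namespace MatterAlgebra

variable {R : Type*} [CommRing R] [Algebra ℝ R] (X : MatterAlgebra R)

lemma pow_cancel (k : ℕ) {f : R} (h : X.Om ^ k * f = 0) : f = 0 := by
  induction k with
  | zero => simpa using h
  | succ k ih => exact ih (X.Om_cancel _ (by rw [← h]; ring))

/-- The gradient of the defining function. -/
def w (a : Fin 4) : R := X.grad X.Om a

/-- The squared length of the gradient of the defining function. -/
def N : R := X.dot X.w X.w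

/-- The trace of the stress-energy tensor. -/
def t : R := X.tr X.τ

/-- The trace-free part of the stress-energy tensor. -/
def θ (a b : Fin 4) : R := X.τ a b - (1 / 4 : ℝ) • (X.t * X.g a b)

/-- `¼ (Δ + J) Ω`. -/
def ρ : R := (1 / 4 : ℝ) • (X.lap X.Om + X.Om * X.J)

/-- `½ Ω^{q + 1}`. -/
def f : R := (1 / 2 : ℝ) • X.Om ^ (X.q + 1)

/-- The source term of the almost Einstein equation. -/
def s (a b : Fin 4) : R := X.f * X.θ a b

/-- The covector `∇_a ρ + P_{ab} ∇^b Ω`. -/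
def u (a : Fin 4) : R := X.grad X.ρ a + X.ctr X.schouten X.w a

/-- Symmetry of τ is not assumed: all other terms of the field equation are symmetric, and the power
of Ω in front of τ cancels. -/
lemma τ_symm (a b : Fin 4) : X.τ a b = X.τ b a := by
  have h1 := X.einstein a b
  have h2 := X.einstein b a
  rw [X.g_symm b a, X.schouten_symm b a, X.cov1_grad_symm _ b a] at h2
  refine sub_eq_zero.1 (X.pow_cancel (X.q + 2) ?_)
  linear_combination (norm := algebra) (2 : ℝ) • h2 - (2 : ℝ) • h1

lemma θ_symm (a b : Fin 4) : X.θ a b = X.θ b a := by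
  rw [θ, θ, τ_symm, X.g_symm]

lemma s_symm (a b : Fin 4) : X.s a b = X.s b a := by rw [s, s, θ_symm]

lemma tr_θ : X.tr (fun a b => X.θ a b) = 0 := by
  simp only [θ, MetricAlgebra.tr_sub, MetricAlgebra.tr_smul, MetricAlgebra.tr_mul_left,
    X.tr_g_four]
  change X.t - _ = 0
  algebra

lemma tr_s : X.tr (fun a b => X.s a b) = 0 := by
  simp only [s, MetricAlgebra.tr_mul_left, tr_θ, mul_zero]

/-- The trace of the field equation, divided by −2. It makes N + λ divisible by Ω, which is what
permits the division by Ω in `cov1_w`. -/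
lemma N_add_lam : X.N + algebraMap ℝ R X.lam
    = 2 * X.Om * X.ρ + (1 / 12 : ℝ) • (X.Om ^ (X.q + 2) * X.t) := by
  have h := X.tr_congr X.einstein
  simp only [MetricAlgebra.tr_sub, MetricAlgebra.tr_add, MetricAlgebra.tr_smul,
    MetricAlgebra.tr_mul_left, X.tr_g_four] at h
  change X.Om * X.lap X.Om + X.Om ^ 2 * X.J - (1 / 2 : ℝ) • ((X.N + algebraMap ℝ R X.lam) * 4)
    = (1 / 2 : ℝ) • (X.Om ^ (X.q + 2) * (X.t - (1 / 3 : ℝ) • (X.t * 4))) at h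
  rw [ρ]
  linear_combination (norm := algebra) (-1 / 2 : ℝ) • h

/-- The almost Einstein equation with its source term. -/
lemma cov1_w (a b : Fin 4) :
    X.cov1 X.w a b = - (X.Om * X.schouten a b) + X.ρ * X.g a b + X.s a b := by
  have h1 := X.einstein a b
  have h2 := X.N_add_lam
  change X.Om * X.cov1 X.w a b + X.Om ^ 2 * X.schouten a b
    - (1 / 2 : ℝ) • ((X.N + algebraMap ℝ R X.lam) * X.g a b)
    = (1 / 2 : ℝ) • (X.Om ^ (X.q + 2) * (X.τ a b - (1 / 3 : ℝ) • (X.t * X.g a b))) at h1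
  refine sub_eq_zero.1 (X.Om_cancel _ ?_)
  rw [h2] at h1
  simp only [s, f, θ]
  linear_combination (norm := algebra) h1

lemma cov2_cov1_w (a b c : Fin 4) : X.cov2 (X.cov1 X.w) a b c
    = - (X.w a * X.schouten b c + X.Om * X.cov2 X.schouten a b c) + X.grad X.ρ a * X.g b c
      + X.cov2 X.s a b c := by
  rw [show X.cov1 X.w = fun a b => (-(X.Om * X.schouten a b) + X.ρ * X.g a b) + X.s a b from by
    funext a b; exact X.cov1_w a b, X.cov2_add (fun a b => -(X.Om * X.schouten a b)
      + X.ρ * X.g a b) X.s, X.cov2_add (fun a b => -(X.Om * X.schouten a b)), X.cov2_mul_g,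
    X.cov2_neg (fun a b => X.Om * X.schouten a b), X.cov2_mul]
  rfl

/-- The source term of the equation for the Weyl tensor. -/
def Q (a b c : Fin 4) : R :=
  X.u a * X.g b c - X.u b * X.g a c + X.cov2 X.s a b c - X.cov2 X.s b a c

/-- The integrability condition of `cov1_w`: in the Ricci identity for w, the Schouten part of the
Riemann tensor partly cancels against w ⊗ P and otherwise combines with ∇ρ into u. -/
lemma weyl_w (a b c : Fin 4) :
    X.tr (fun x y => X.weyl a b c x * X.w y) + X.Om * X.cotton c a b = X.Q a b c := by
  have h := X.ricci_identity X.w a b c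
  rw [cov2_cov1_w, cov2_cov1_w] at h
  have h2 : X.tr (fun x y => X.riem a b x c * X.w y)
      = - X.tr (fun x y => X.weyl a b c x * X.w y) - X.g c a * X.ctr X.schouten X.w b
        + X.g c b * X.ctr X.schouten X.w a - X.w b * X.schouten a c
        + X.w a * X.schouten b c := by
    have e : ∀ x y, X.riem a b x c * X.w y = - (X.weyl a b c x * X.w y)
        - X.g c a * (X.schouten b x * X.w y) + X.g c b * (X.schouten a x * X.w y)
        - X.g x b * X.w y * X.schouten a c + X.g x a * X.w y * X.schouten b c := by
      intro x y
      rw [X.riem_antisymm_right, MetricAlgebra.weyl]; ring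
    rw [X.tr_congr e]
    simp only [MetricAlgebra.tr_sub, MetricAlgebra.tr_add, MetricAlgebra.tr_neg,
      MetricAlgebra.tr_mul_left, MetricAlgebra.tr_mul_right, MetricAlgebra.tr_g_left]
    rfl
  rw [h2] at h
  rw [MetricAlgebra.cotton, Q, u, u]
  rw [X.g_symm c a, X.g_symm c b] at h
  linear_combination -h

/-- The trace of `weyl_w` over its last two indices. The Weyl, Cotton and source traces vanish, and
3 is n − 1. -/
lemma div_s (a : Fin 4) : X.div X.s a = 3 * X.u a := by
  have h := X.tr_congr fun b c => X.weyl_w a b c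
  rw [show X.Q a = fun b c => X.u a * X.g b c - X.u b * X.g a c + X.cov2 X.s a b c
    - X.cov2 X.s b a c from rfl] at h
  simp only [MetricAlgebra.tr_add, MetricAlgebra.tr_sub, MetricAlgebra.tr_mul_left] at h
  have h1 : X.tr (fun b c => X.tr (fun x y => X.weyl a b c x * X.w y)) = 0 := by
    rw [X.tr_comm]
    simp only [MetricAlgebra.tr_mul_right, X.tr_weyl', zero_mul, X.tr_zero]
  have h2 : X.tr (fun b c => X.cotton c a b) = 0 := by
    rw [← neg_eq_zero, ← X.tr_neg, ← X.tr_swap, ← X.tr_cotton a]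
    exact X.tr_congr fun _ _ => by rw [X.cotton_antisymm]; ring
  have h3 : X.tr (fun b c => X.u b * X.g a c) = X.u a := by
    simp only [mul_comm (X.u _)]
    exact X.tr_g_right' X.u a
  have h4 : X.tr (fun b c => X.cov2 X.s a b c) = 0 := by
    rw [← X.D_tr_cov, show X.tr X.s = 0 from X.tr_s, map_zero]
  rw [h1, h2, h3, h4, X.tr_g_four] at h
  rw [MetricAlgebra.div]
  linear_combination h

/-- The gradient of `N_add_lam`, with ∇N computed from `cov1_w`: the terms ρ w cancel, and Ω∇ρ and
ΩP·w join to Ωu. -/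
lemma ctr_s (a : Fin 4) : 2 * X.ctr X.s X.w a - 2 * X.Om * X.u a
    = (1 / 12 : ℝ) • X.grad (X.Om ^ (X.q + 2) * X.t) a := by
  have h := congrArg (fun r => X.grad r a) X.N_add_lam
  simp only [MetricAlgebra.grad, map_add, N, MetricAlgebra.dot, X.D_tr_mul,
    Derivation.map_smul, Derivation.map_algebraMap, X.D_mul] at h
  have h0 : X.D a (2 : R) = 0 := by
    have := (X.D a).map_algebraMap 2
    rwa [map_ofNat] at this
  have h1 : X.tr (fun x y => X.cov1 X.w a x * X.w y)
      = - (X.Om * X.ctr X.schouten X.w a) + X.ρ * X.w a + X.ctr X.s X.w a := by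
    simp only [cov1_w, add_mul, neg_mul, mul_assoc, MetricAlgebra.tr_add, MetricAlgebra.tr_neg,
      MetricAlgebra.tr_mul_left, X.tr_g_left']
    rfl
  have h2 : X.tr (fun x y => X.w x * X.cov1 X.w a y)
      = X.tr (fun x y => X.cov1 X.w a x * X.w y) := by
    rw [← X.tr_swap]; exact X.tr_congr fun _ _ => mul_comm _ _
  rw [X.tr_add, h2, h1, h0] at h
  simp only [MetricAlgebra.grad, X.D_mul, u]
  have h3 : X.w a = X.D a X.Om := rfl
  rw [h3] at h
  linear_combination (norm := algebra) h

lemma ctr_s_eq (a : Fin 4) :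
    X.ctr X.s X.w a = X.f * (X.ctr X.τ X.w a - (1 / 4 : ℝ) • (X.t * X.w a)) := by
  have h : ∀ x y, X.s a x * X.w y = X.f * (X.τ a x * X.w y - (1 / 4 : ℝ) • (X.t
      * (X.g a x * X.w y))) := fun x y => by rw [s, θ]; algebra
  simp only [MetricAlgebra.ctr, h, MetricAlgebra.tr_mul_left, MetricAlgebra.tr_sub,
    MetricAlgebra.tr_smul, X.tr_g_left']

/-- This is `ctr_s` divided by −2Ω. It removes the third derivatives of Ω and the Schouten tensor
contained in u, so that later source terms involve only τ, Ω and their derivatives. -/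
lemma u_eq (a : Fin 4) : X.u a = X.Om ^ X.q * ((1 / 2 : ℝ) • X.ctr X.τ X.w a
    - ((X.q + 5) / 24 : ℝ) • (X.t * X.w a)) - (1 / 24 : ℝ) • (X.Om ^ (X.q + 1) * X.grad X.t a) := by
  have h := X.ctr_s a
  rw [ctr_s_eq, X.grad_mul, X.grad_pow] at h
  have hw : X.grad X.Om a = X.w a := rfl
  rw [hw] at h
  refine sub_eq_zero.1 (X.Om_cancel _ ?_)
  rw [f] at h
  push_cast at h
  linear_combination (norm := algebra) (-1 / 2 : ℝ) • h

lemma grad_f (a : Fin 4) : X.grad X.f a = ((X.q + 1) / 2 : ℝ) • (X.Om ^ X.q * X.w a) := by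
  have : X.grad X.f a = (1 / 2 : ℝ) • X.grad (X.Om ^ (X.q + 1)) a := by
    simp only [MetricAlgebra.grad, f, Derivation.map_smul]
  rw [this, X.grad_pow, smul_smul]
  change _ = ((X.q + 1) / 2 : ℝ) • (X.Om ^ X.q * X.grad X.Om a)
  congr 1; ring

lemma div_θ (a : Fin 4) : X.div X.θ a = X.div X.τ a - (1 / 4 : ℝ) • X.grad X.t a := by
  rw [show X.θ = fun a b => X.τ a b - ((1 / 4 : ℝ) • X.t) * X.g a b from by
    funext a b; rw [θ]; algebra, X.div_sub, X.div_mul_g]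
  simp only [MetricAlgebra.grad, Derivation.map_smul]

/-- The conservation law of the stress-energy tensor in the unphysical scale. -/
lemma conservation (a : Fin 4) :
    X.Om * X.div X.τ a + ((X.q : ℝ) - 2) • X.ctr X.τ X.w a + X.t * X.w a = 0 := by
  -- There are now two expressions for u, one from `div_s` and one from `u_eq`; equating them leaves
  -- the conservation law times Ω^q.
  have h := X.div_s a
  rw [show X.s = fun a b => X.f * X.θ a b from rfl, X.div_mul, u_eq, div_θ] at h
  have h1 : X.ctr X.θ (X.grad X.f) a = ((X.q + 1) / 2 : ℝ) • (X.Om ^ X.q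
      * (X.ctr X.τ X.w a - (1 / 4 : ℝ) • (X.t * X.w a))) := by
    have e : ∀ x y, X.θ a x * X.grad X.f y = ((X.q + 1) / 2 : ℝ) • (X.Om ^ X.q
      * (X.τ a x * X.w y - (1 / 4 : ℝ) • (X.t * (X.g a x * X.w y)))) := fun x y => by
      rw [grad_f, θ]; algebra
    simp only [MetricAlgebra.ctr, e, MetricAlgebra.tr_mul_left, MetricAlgebra.tr_sub,
      MetricAlgebra.tr_smul, X.tr_g_left']
  rw [h1] at h
  refine X.pow_cancel X.q ?_
  rw [f] at h
  linear_combination (norm := algebra) (2 : ℝ) • h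

end MatterAlgebra

end

/-! ## Consequences of the Einstein equations -/

section

namespace MatterAlgebra

variable {R : Type*} [CommRing R] [Algebra ℝ R] (X : MatterAlgebra R)

/-- The divergence of a covector. -/
def div₁ (v : Fin 4 → R) : R := X.tr (fun a b => X.cov1 v a b)

/-- The contraction `C_{abcd} T^{ad}`. -/
def weylCtr (T : Fin 4 → Fin 4 → R) (b c : Fin 4) : R :=
  X.tr (fun e a => X.tr (fun x y => X.weyl a b c x * T e y))

lemma cov4_weyl_pair (e a b c d : Fin 4) : X.cov4 X.weyl e a b c d = X.cov4 X.weyl e c d a b := by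
  conv_lhs => rw [show X.weyl = fun a b c d => X.weyl c d a b from by
    funext a b c d; exact X.weyl_pair_symm a b c d]
  exact X.cov4_swap_pair X.weyl e a b c d

lemma bach_eq (b c : Fin 4) : X.bach c b
    = X.tr (fun e a => X.cov3 X.cotton e c a b) - X.weylCtr X.schouten b c := by
  have h1 : - X.tr (fun x d => X.cov3 X.cotton d c b x)
      = X.tr (fun e a => X.cov3 X.cotton e c a b) := by
    rw [← X.tr_neg, ← X.tr_swap]
    exact X.tr_congr fun _ _ => by rw [X.cov3_cotton_antisymm]; ring
  have h2 : X.tr (fun d e => X.tr (fun x f => X.schouten e f * X.weyl d c x b))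
      = - X.weylCtr X.schouten b c := by
    rw [weylCtr, ← X.tr_neg, X.tr_comm, ← X.tr_swap]
    refine X.tr_congr fun x f => ?_
    rw [← X.tr_neg]
    refine X.tr_congr fun d e => ?_
    rw [X.schouten_symm, X.weyl_pair_symm, X.weyl_antisymm_right]; ring
  rw [MetricAlgebra.bach, h1, h2]; ring

/-- The divergence of `weyl_w` in its first index. The divergence of C is a Cotton tensor, the
factor ∇w contributes −Ω C·P + C·s (its ρ part is a trace of C), and the terms with an explicit Ω
assemble into ΩB. The cyclic identity collects the remaining Cotton terms into one that is
antisymmetric in b and c. -/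
lemma div_weyl_w (b c : Fin 4) :
    X.Om * X.bach c b = X.div₁ X.u * X.g b c - X.cov1 X.u c b + X.lap₂ X.s b c
      - X.tr (fun e a => X.cov3 (X.cov2 X.s) e b a c) - X.weylCtr X.s b c
      + X.tr (fun x y => X.cotton x b c * X.w y) := by
  have h : ∀ e a, X.tr (fun x y => X.cov4 X.weyl e a b c x * X.w y)
      + X.tr (fun x y => X.weyl a b c x * X.cov1 X.w e y)
      + (X.w e * X.cotton c a b + X.Om * X.cov3 X.cotton e c a b)
      = X.cov1 X.u e a * X.g b c - X.cov1 X.u e b * X.g a c + X.cov3 (X.cov2 X.s) e a b c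
        - X.cov3 (X.cov2 X.s) e b a c := by
    intro e a
    have k := congrArg (fun T => X.cov3 T e a b c)
      (show (fun a b c => X.tr (fun x y => X.weyl a b c x * X.w y) + X.Om * X.cotton c a b) = X.Q
        from by funext a b c; exact X.weyl_w a b c)
    beta_reduce at k
    rw [X.cov3_add (fun a b c => X.tr (fun x y => X.weyl a b c x * X.w y)), X.cov3_tr_mul,
      X.cov3_mul X.Om (fun a b c => X.cotton c a b), X.tr_add] at k
    have k2 : X.cov3 (fun a b c => X.cotton c a b) e a b c = X.cov3 X.cotton e c a b := by
      simp only [MetricAlgebra.cov3]; ring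
    have k3 : X.cov3 X.Q e a b c = X.cov1 X.u e a * X.g b c - X.cov1 X.u e b * X.g a c
        + X.cov3 (X.cov2 X.s) e a b c - X.cov3 (X.cov2 X.s) e b a c := by
      simp only [MetricAlgebra.cov3, Q, map_sub, map_add, X.D_mul, X.D_g, X.Γ_sub, X.Γ_add,
        X.Γ_mul_left, X.Γ_mul_right, MetricAlgebra.cov1]
      ring
    rw [k2, k3] at k
    exact k
  have h' := X.tr_congr h
  simp only [X.tr_add, X.tr_sub, X.tr_mul_left, X.tr_mul_right] at h'
  have h1 : X.tr (fun e a => X.tr (fun x y => X.cov4 X.weyl e a b c x * X.w y))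
      = X.tr (fun x y => X.cotton b c x * X.w y) := by
    rw [X.tr_comm]
    refine X.tr_congr fun x y => ?_
    rw [X.tr_mul_right]
    simp only [X.cov4_weyl_pair _ _ b c x, X.div_weyl]
  have h2 : X.tr (fun e a => X.tr (fun x y => X.weyl a b c x * X.cov1 X.w e y))
      = - (X.Om * X.weylCtr X.schouten b c) + X.weylCtr X.s b c := by
    have k : ∀ e a x y, X.weyl a b c x * X.cov1 X.w e y
        = - (X.Om * (X.weyl a b c x * X.schouten e y)) + X.ρ * (X.g e y * X.weyl a b c x)
          + X.weyl a b c x * X.s e y := fun e a x y => by rw [cov1_w]; ring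
    simp only [k, X.tr_add, X.tr_neg, X.tr_mul_left, X.tr_g_right' (fun x => X.weyl _ b c x)]
    have k2 : X.tr (fun e a => X.weyl a b c e) = 0 := by
      rw [← neg_eq_zero, ← X.tr_neg, ← X.tr_weyl b c, ← X.tr_swap]
      exact X.tr_congr fun _ _ => by rw [X.weyl_antisymm_right]; ring
    rw [k2, mul_zero, add_zero]
    rfl
  have h3 : X.tr (fun e a => X.w e * X.cotton c a b) = X.tr (fun x y => X.cotton c x b * X.w y) := by
    rw [← X.tr_swap]; exact X.tr_congr fun _ _ => mul_comm _ _
  have h4 : X.tr (fun e a => X.cov1 X.u e b * X.g a c) = X.cov1 X.u c b := by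
    simp only [mul_comm (X.cov1 X.u _ _)]
    exact X.tr_g_right (fun e => X.cov1 X.u e b) c
  have h5 : X.tr (fun x y => X.cotton x b c * X.w y)
      = - X.tr (fun x y => X.cotton b c x * X.w y) - X.tr (fun x y => X.cotton c x b * X.w y) := by
    rw [← X.tr_neg, ← X.tr_sub]
    exact X.tr_congr fun x y => by linear_combination X.cotton_cyclic x b c * X.w y
  rw [h1, h2, h3, h4] at h'
  rw [bach_eq, h5]
  rw [div₁, MetricAlgebra.lap₂]
  linear_combination h'

/-- The terms of the equation for the Bach tensor that are of order zero in the source. -/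
def Z (T : Fin 4 → Fin 4 → R) (b c : Fin 4) : R :=
  - X.tr (fun x y => X.ric b x * T c y) - X.tr (fun x y => X.ric c x * T b y)
    + X.tr (fun e a => X.tr (fun x y => X.riem e b x c * T y a))
    + X.tr (fun e a => X.tr (fun x y => X.riem e c x b * T y a))
    - X.weylCtr T b c - X.weylCtr T c b

lemma Z_mul (r : R) (T : Fin 4 → Fin 4 → R) (b c : Fin 4) :
    X.Z (fun b c => r * T b c) b c = r * X.Z T b c := by
  simp only [Z, weylCtr, mul_left_comm _ r, X.tr_mul_left]; ring

lemma cov3_cov2_symm {T : Fin 4 → Fin 4 → R} (hT : ∀ a b, T a b = T b a) (e a b c : Fin 4) :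
    X.cov3 (X.cov2 T) e a b c = X.cov3 (X.cov2 T) e a c b := by
  conv_lhs => rw [show X.cov2 T = fun a b c => X.cov2 T a c b from by
    funext a b c; exact X.cov2_symm hT a b c]
  simp only [MetricAlgebra.cov3]; ring

/-- Symmetrising `div_weyl_w` removes the contraction of the Cotton tensor with w. The 4 is 1 + 3:
one ∇u is explicit, and three arise when ∇^a∇_b s_ca is commuted to ∇_b of the divergence of s,
which is 3u by `div_s`. -/
lemma two_mul_Om_mul_bach (b c : Fin 4) :
    2 * (X.Om * X.bach b c) = 2 * (X.div₁ X.u * X.g b c) + 2 * X.lap₂ X.s b c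
      - 4 * (X.cov1 X.u b c + X.cov1 X.u c b) + X.f * X.Z X.θ b c := by
  have h1 := X.div_weyl_w b c
  have h2 := X.div_weyl_w c b
  have h3 : ∀ b c, X.tr (fun e a => X.cov3 (X.cov2 X.s) e b a c) = 3 * X.cov1 X.u b c
      + X.tr (fun x y => X.ric b x * X.s c y)
      - X.tr (fun e a => X.tr (fun x y => X.riem e b x c * X.s y a)) := by
    intro b c
    have k1 : X.cov1 (X.div X.s) b c = 3 * X.cov1 X.u b c := by
      rw [show X.div X.s = fun a => (3 : ℝ) • X.u a from by
        funext a; rw [div_s]; algebra, X.cov1_smul]; algebra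
    rw [← k1, ← X.div_cov2_comm]
    exact X.tr_congr fun e a => X.cov3_cov2_symm X.s_symm _ _ _ _
  have h4 : X.lap₂ X.s c b = X.lap₂ X.s b c :=
    X.tr_congr fun _ _ => X.cov3_cov2_symm X.s_symm _ _ _ _
  have h5 : X.tr (fun x y => X.cotton x c b * X.w y) = - X.tr (fun x y => X.cotton x b c * X.w y) := by
    rw [← X.tr_neg]
    exact X.tr_congr fun _ _ => by rw [X.cotton_antisymm]; ring
  rw [h3] at h1 h2
  rw [h4, h5, X.bach_symm b c, X.g_symm c b] at h2
  rw [← Z_mul, X.bach_symm b c]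
  change _ = _ + X.Z X.s b c
  rw [Z]
  linear_combination h1 + h2

end MatterAlgebra

end

/-! ## Evaluation of tensor calculus at a point -/

section

namespace MetricAlgebra

variable {n : ℕ} {R : Type*} [CommRing R] [Algebra ℝ R] (G : MetricAlgebra n R)

/-- The values of a metric at a point. -/
def eval (ev : R →ₐ[ℝ] ℝ) : MetricAlgebra n ℝ where
  -- At a point only the algebraic part of the calculus is used, so the derivations are irrelevant.
  D := 0
  g a b := ev (G.g a b)
  gi a b := ev (G.gi a b)
  D_comm _ _ _ := rfl
  g_symm a b := by rw [G.g_symm]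
  gi_symm a b := by rw [G.gi_symm]
  gi_mul_g a b := by
    simp only [← map_mul, ← map_sum, G.gi_mul_g]
    split_ifs <;> simp

lemma ev_tr (ev : R →ₐ[ℝ] ℝ) (F : Fin n → Fin n → R) :
    ev (G.tr F) = (G.eval ev).tr (fun a b => ev (F a b)) := by
  simp only [tr, map_sum, map_mul, eval]

lemma ev_dot (ev : R →ₐ[ℝ] ℝ) (v w : Fin n → R) :
    ev (G.dot v w) = (G.eval ev).dot (fun a => ev (v a)) (fun a => ev (w a)) := by
  simp only [dot, ev_tr, map_mul]

lemma ev_ctr (ev : R →ₐ[ℝ] ℝ) (T : Fin n → Fin n → R) (w : Fin n → R) (a : Fin n) :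
    ev (G.ctr T w a) = (G.eval ev).ctr (fun a b => ev (T a b)) (fun a => ev (w a)) a := by
  simp only [ctr, ev_tr, map_mul]

end MetricAlgebra

namespace MatterAlgebra

variable {R : Type*} [CommRing R] [Algebra ℝ R] (X : MatterAlgebra R)

lemma grad_N (e : Fin 4) : X.grad X.N e = 2 * X.ctr (X.cov1 X.w) X.w e := by
  have h2 : X.tr (fun x y => X.w x * X.cov1 X.w e y)
      = X.tr (fun x y => X.cov1 X.w e x * X.w y) := by
    rw [← X.tr_swap]; exact X.tr_congr fun _ _ => mul_comm _ _
  rw [MetricAlgebra.grad, N, MetricAlgebra.dot, X.D_tr_mul, X.tr_add, h2, MetricAlgebra.ctr]; ring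

lemma cov1_conservation (e a : Fin 4) :
    X.w e * X.div X.τ a + X.Om * X.cov1 (X.div X.τ) e a
      + ((X.q : ℝ) - 2) • (X.ctr (X.cov2 X.τ e) X.w a + X.ctr X.τ (X.cov1 X.w e) a)
      + X.grad X.t e * X.w a + X.t * X.cov1 X.w e a = 0 := by
  have k := congrArg (fun v => X.cov1 v e a)
    (show (fun a => X.Om * X.div X.τ a + ((X.q : ℝ) - 2) • X.ctr X.τ X.w a + X.t * X.w a)
      = fun _ => (0 : R) from funext X.conservation)
  beta_reduce at k
  rw [X.cov1_add (fun a => X.Om * X.div X.τ a + ((X.q : ℝ) - 2) • X.ctr X.τ X.w a),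
    X.cov1_add (fun a => X.Om * X.div X.τ a), X.cov1_mul, X.cov1_mul, X.cov1_smul,
    show X.ctr X.τ X.w = fun a => X.tr (fun x y => X.τ a x * X.w y) from rfl, X.cov1_tr_mul,
    X.tr_add] at k
  have h0 : X.cov1 (fun _ => 0) e a = 0 := by simp [MetricAlgebra.cov1, MetricAlgebra.Γ]
  rw [h0] at k
  rw [← k]
  simp only [MetricAlgebra.ctr, MetricAlgebra.grad, w]
  ring

/-- The subleading coefficient of `u`, up to the factor `Ω^{q + 1}`, for `q = 0`. -/
def y₀ (a : Fin 4) : R := (1 / 4 : ℝ) • X.div X.τ a - (1 / 24 : ℝ) • X.grad X.t a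

/-- The subleading coefficient of `u`, up to the factor `Ω^{q + 1}`, for `q = 1`. -/
def y₁ (a : Fin 4) : R := (1 / 2 : ℝ) • X.div X.τ a - (1 / 24 : ℝ) • X.grad X.t a

/-- The leading coefficient of `u`, up to the factor `Ω^q`, for `q = 2`. -/
def v₂ (a : Fin 4) : R := (1 / 2 : ℝ) • X.ctr X.τ X.w a - (7 / 24 : ℝ) • (X.t * X.w a)

/-! ### Expansions of the source terms in powers of the defining function -/

section

/-- For q = 0 the conservation law gives τ·w = ½(t w + Ω div τ), and then `u_eq` becomes u = t w /
24 + Ω y₀. -/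
lemma cov1_u_zero (hq : X.q = 0) (b c : Fin 4) : X.cov1 X.u b c
    = (1 / 24 : ℝ) • (X.grad X.t b * X.w c + X.t * X.cov1 X.w b c) + X.w b * X.y₀ c
      + X.Om * X.cov1 X.y₀ b c := by
  have h : X.u = fun a => (1 / 24 : ℝ) • (X.t * X.w a) + X.Om * X.y₀ a := by
    funext a
    have h1 := X.conservation a
    rw [u_eq, y₀]
    rw [hq] at h1 ⊢
    push_cast at h1 ⊢
    simp only [pow_zero, zero_add, pow_one]
    linear_combination (norm := algebra) (-1 / 4 : ℝ) • h1
  rw [h, X.cov1_add (fun a => (1 / 24 : ℝ) • (X.t * X.w a)), X.cov1_smul _ (fun a => X.t * X.w a),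
    X.cov1_mul, X.cov1_mul]
  simp only [MetricAlgebra.grad, w]
  ring

/-- For q = 1 the conservation law gives τ·w = t w + Ω div τ, and then `u_eq` becomes u = Ω t w / 4
+ Ω² y₁. -/
lemma cov1_u_one (hq : X.q = 1) (b c : Fin 4) : X.cov1 X.u b c
    = (1 / 4 : ℝ) • (X.t * X.w b * X.w c)
      + X.Om * ((1 / 4 : ℝ) • (X.grad X.t b * X.w c + X.t * X.cov1 X.w b c)
        + 2 * X.w b * X.y₁ c)
      + X.Om ^ 2 * X.cov1 X.y₁ b c := by
  have h : X.u = fun a => X.Om * ((1 / 4 : ℝ) • (X.t * X.w a)) + X.Om * (X.Om * X.y₁ a) := by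
    funext a
    have h1 := X.conservation a
    rw [u_eq, y₁]
    rw [hq] at h1 ⊢
    push_cast at h1 ⊢
    simp only [pow_one]
    linear_combination (norm := algebra) (-1 / 2 : ℝ) • (X.Om * h1)
  rw [h, X.cov1_add (fun a => X.Om * ((1 / 4 : ℝ) • (X.t * X.w a))), X.cov1_mul, X.cov1_mul,
    X.cov1_smul _ (fun a => X.t * X.w a), X.cov1_mul, X.cov1_mul]
  simp only [MetricAlgebra.grad, w]
  algebra

/-- For q = 2 the factor q − 2 vanishes and τ·w cannot be eliminated; u = Ω² v₂ − Ω³∇t / 24 is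
`u_eq` as it stands. -/
lemma cov1_u_two (hq : X.q = 2) (b c : Fin 4) : X.cov1 X.u b c
    = 2 * X.Om * X.w b * X.v₂ c + X.Om ^ 2 * (X.cov1 X.v₂ b c
      - (1 / 8 : ℝ) • (X.w b * X.grad X.t c)
      - (1 / 24 : ℝ) • (X.Om * X.cov1 (X.grad X.t) b c)) := by
  have h : X.u = fun a => X.Om * (X.Om * X.v₂ a)
      + (-1 / 24 : ℝ) • (X.Om * (X.Om * (X.Om * X.grad X.t a))) := by
    funext a
    rw [u_eq, v₂, hq]
    push_cast
    algebra
  rw [h, X.cov1_add (fun a => X.Om * (X.Om * X.v₂ a)), X.cov1_smul, X.cov1_mul, X.cov1_mul,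
    X.cov1_mul, X.cov1_mul, X.cov1_mul]
  simp only [MetricAlgebra.grad, w]
  algebra

lemma lap_f_zero (hq : X.q = 0) : X.lap X.f = (1 / 2 : ℝ) • X.lap X.Om := by
  have h : X.grad X.f = fun a => (1 / 2 : ℝ) • X.grad X.Om a := by
    funext a; rw [grad_f, hq, w]; norm_num
  rw [MetricAlgebra.lap, h]
  simp only [X.cov1_smul, X.tr_smul, MetricAlgebra.lap]

lemma lap_f_one (hq : X.q = 1) : X.lap X.f = X.N + X.Om * X.lap X.Om := by
  have h : X.grad X.f = fun a => X.Om * X.grad X.Om a := by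
    funext a; rw [grad_f, hq, w]; norm_num
  rw [MetricAlgebra.lap, h]
  simp only [X.cov1_mul, X.tr_add, X.tr_mul_left, MetricAlgebra.lap]
  rfl

lemma lap_f_two (hq : X.q = 2) :
    X.lap X.f = 3 * X.Om * X.N + (3 / 2 : ℝ) • (X.Om ^ 2 * X.lap X.Om) := by
  have h : X.grad X.f = fun a => (3 / 2 : ℝ) • (X.Om * (X.Om * X.grad X.Om a)) := by
    funext a; rw [grad_f, hq, w]; push_cast; algebra
  rw [MetricAlgebra.lap, h]
  simp only [X.cov1_smul, X.cov1_mul, X.tr_add, X.tr_mul_left, X.tr_smul, MetricAlgebra.lap]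
  have h1 : X.tr (fun a b => X.D a X.Om * (X.Om * X.grad X.Om b)) = X.Om * X.N := by
    rw [N, MetricAlgebra.dot, ← X.tr_mul_left]
    exact X.tr_congr fun _ _ => by simp only [w, MetricAlgebra.grad]; ring
  have h2 : X.tr (fun a b => X.D a X.Om * X.grad X.Om b) = X.N := rfl
  have h3 : X.tr (X.cov1 (X.grad X.Om)) = X.tr (fun a b => X.cov1 (X.grad X.Om) a b) := rfl
  rw [h1, h2, h3]
  algebra

lemma dir_f (T : Fin 4 → Fin 4 → R) (b c : Fin 4) :
    X.dir₂ (X.grad X.f) T b c = ((X.q + 1) / 2 : ℝ) • (X.Om ^ X.q * X.dir₂ X.w T b c) := by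
  have e : ∀ x y, X.grad X.f x * X.cov2 T y b c
      = ((X.q + 1) / 2 : ℝ) • (X.Om ^ X.q * (X.w x * X.cov2 T y b c)) := fun x y => by
    rw [grad_f]; algebra
  simp only [MetricAlgebra.dir₂, e, X.tr_smul, X.tr_mul_left]

/-- The Bach equation for `q = 1`, expanded to second order. -/
lemma bach_expansion_one (hq : X.q = 1) (b c : Fin 4) : ∃ r,
    X.Om * (2 * X.bach b c - (2 * ((1 / 4 : ℝ) • (X.dot (X.grad X.t) X.w + X.t * X.lap X.Om)
        + 2 * X.dot X.w X.y₁) * X.g b c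
      + 2 * X.lap X.Om * X.θ b c + 4 * X.dir₂ X.w X.θ b c
      - 4 * ((1 / 4 : ℝ) • (X.grad X.t b * X.w c + X.grad X.t c * X.w b
          + X.t * (X.cov1 X.w b c + X.cov1 X.w c b)) + 2 * X.w b * X.y₁ c + 2 * X.w c * X.y₁ b)))
    = 2 * (X.N * X.τ b c - X.t * (X.w b * X.w c)) + X.Om ^ 2 * r := by
  have h := X.two_mul_Om_mul_bach b c
  have hd : X.div₁ X.u = (1 / 4 : ℝ) • (X.t * X.N)
      + X.Om * ((1 / 4 : ℝ) • (X.dot (X.grad X.t) X.w + X.t * X.lap X.Om)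
        + 2 * X.dot X.w X.y₁) + X.Om ^ 2 * X.div₁ X.y₁ := by
    simp only [div₁, cov1_u_one X hq, X.tr_add, X.tr_mul_left, X.tr_smul, mul_assoc]
    rfl
  rw [hd, cov1_u_one X hq, cov1_u_one X hq, show X.s = fun b c => X.f * X.θ b c from rfl,
    X.lap₂_mul, lap_f_one X hq, dir_f] at h
  refine ⟨2 * X.div₁ X.y₁ * X.g b c + X.lap₂ X.θ b c - 4 * (X.cov1 X.y₁ b c + X.cov1 X.y₁ c b)
    + (1 / 2 : ℝ) • X.Z X.θ b c, ?_⟩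
  have hf : X.f = (1 / 2 : ℝ) • X.Om ^ 2 := by rw [f, hq]
  -- At order Ω⁰ the trace term ½ t N g coming from the divergence of u completes 2Nθ to 2Nτ.
  have ht : X.τ b c = X.θ b c + (1 / 4 : ℝ) • (X.t * X.g b c) := by rw [θ]; ring
  rw [hf, hq] at h
  push_cast at h
  rw [ht]
  linear_combination (norm := algebra) h

/-- Here every term of `two_mul_Om_mul_bach` is divisible by Ω, so a single cancellation isolates
the Bach tensor up to multiples of Ω. -/
lemma bach_expansion_two (hq : X.q = 2) (b c : Fin 4) : ∃ r,
    2 * X.bach b c = 4 * X.dot X.w X.v₂ * X.g b c + 6 * X.N * X.θ b c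
      - 8 * (X.w b * X.v₂ c + X.w c * X.v₂ b) + X.Om * r := by
  have h := X.two_mul_Om_mul_bach b c
  have hd : X.div₁ X.u = 2 * X.Om * X.dot X.w X.v₂ + X.Om ^ 2 * (X.div₁ X.v₂
      - (1 / 8 : ℝ) • X.dot X.w (X.grad X.t) - (1 / 24 : ℝ) • (X.Om * X.div₁ (X.grad X.t))) := by
    simp only [div₁, cov1_u_two X hq, X.tr_add, X.tr_sub, X.tr_mul_left, X.tr_smul, mul_assoc]
    rfl
  rw [hd, cov1_u_two X hq, cov1_u_two X hq, show X.s = fun b c => X.f * X.θ b c from rfl,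
    X.lap₂_mul, lap_f_two X hq, dir_f] at h
  have hf : X.f = (1 / 2 : ℝ) • X.Om ^ 3 := by rw [f, hq]
  rw [hf, hq] at h
  push_cast at h
  refine ⟨2 * (X.div₁ X.v₂
      - (1 / 8 : ℝ) • X.dot X.w (X.grad X.t) - (1 / 24 : ℝ) • (X.Om * X.div₁ (X.grad X.t))) * X.g b c
      + (3 : ℝ) • (X.lap X.Om * X.θ b c) + 6 * X.dir₂ X.w X.θ b c + X.Om * X.lap₂ X.θ b c
      - 4 * (X.cov1 X.v₂ b c - (1 / 8 : ℝ) • (X.w b * X.grad X.t c)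
      - (1 / 24 : ℝ) • (X.Om * X.cov1 (X.grad X.t) b c) + (X.cov1 X.v₂ c b
      - (1 / 8 : ℝ) • (X.w c * X.grad X.t b)
      - (1 / 24 : ℝ) • (X.Om * X.cov1 (X.grad X.t) c b)))
      + (1 / 2 : ℝ) • (X.Om * X.Z X.θ b c), ?_⟩
  refine sub_eq_zero.1 (X.Om_cancel _ ?_)
  linear_combination (norm := algebra) h

end

end MatterAlgebra

end

/-! ## Projections and directional derivatives -/

section

namespace MetricAlgebra

variable {n : ℕ} {R : Type*} [CommRing R] [Algebra ℝ R] (G : MetricAlgebra n R)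

/-! ### Projections -/

/-- The projection of a covector on the annihilator of `w^a`; `Ni` is the inverse of `w_a w^a`. -/
def top1 (w : Fin n → R) (Ni : R) (v : Fin n → R) (a : Fin n) : R := v a - Ni * (w a * G.dot v w)

/-- The projection of a 2-tensor. -/
def top2 (w : Fin n → R) (Ni : R) (T : Fin n → Fin n → R) (a b : Fin n) : R :=
  G.top1 w Ni (fun b => G.top1 w Ni (fun a => T a b) a) b

lemma dot_add_left (u v w : Fin n → R) : G.dot (fun a => u a + v a) w = G.dot u w + G.dot v w := by
  simp only [dot, add_mul, tr_add]

lemma dot_sub_left (u v w : Fin n → R) : G.dot (fun a => u a - v a) w = G.dot u w - G.dot v w := by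
  simp only [dot, sub_mul, tr_sub]

lemma dot_mul_left (r : R) (v w : Fin n → R) : G.dot (fun a => r * v a) w = r * G.dot v w := by
  simp only [dot, mul_assoc, tr_mul_left]

lemma dot_mul_right (r : R) (v w : Fin n → R) : G.dot (fun a => v a * r) w = r * G.dot v w := by
  simp only [mul_comm _ r, dot_mul_left]

lemma dot_smul_left (r : ℝ) (v w : Fin n → R) : G.dot (fun a => r • v a) w = r • G.dot v w := by
  simp only [dot, smul_mul_assoc, tr_smul]

lemma dot_g_left (w : Fin n → R) (b : Fin n) : G.dot (fun a => G.g a b) w = w b :=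
  G.tr_g_left w b

lemma dot_g_right (w : Fin n → R) (a : Fin n) : G.dot (fun b => G.g a b) w = w a :=
  G.tr_g_left' w a

variable (w : Fin n → R) (Ni : R)

lemma top2_apply (T : Fin n → Fin n → R) (a b : Fin n) : G.top2 w Ni T a b
    = T a b - Ni * (w a * G.dot (fun a => T a b) w) - Ni * (w b * G.ctr T w a)
      + Ni ^ 2 * (w a * w b * G.dot (G.ctr T w) w) := by
  have h : G.dot (fun b => G.dot (fun a => T a b) w) w = G.dot (G.ctr T w) w := by
    simp only [dot, ctr, ← tr_mul_right]
    rw [tr_comm]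
    exact G.tr_congr fun _ _ => G.tr_congr fun _ _ => by ring
  simp only [top2, top1, dot_sub_left, dot_mul_left, h]
  rw [show G.dot (fun b => T a b) w = G.ctr T w a from rfl]
  ring

lemma top2_add (S T : Fin n → Fin n → R) (a b : Fin n) :
    G.top2 w Ni (fun a b => S a b + T a b) a b = G.top2 w Ni S a b + G.top2 w Ni T a b := by
  simp only [top2, top1, dot_add_left, dot_sub_left, dot_mul_left]; ring

lemma top2_mul (r : R) (T : Fin n → Fin n → R) (a b : Fin n) :
    G.top2 w Ni (fun a b => r * T a b) a b = r * G.top2 w Ni T a b := by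
  simp only [top2, top1, dot_sub_left, dot_mul_left]; ring

variable {w Ni}

lemma top1_self (h : G.dot w w * Ni = 1) (a : Fin n) : G.top1 w Ni w a = 0 := by
  rw [top1]; linear_combination -w a * h

lemma top2_mul_left (h : G.dot w w * Ni = 1) (z : Fin n → R) (a b : Fin n) :
    G.top2 w Ni (fun a b => w a * z b) a b = 0 := by
  have : ∀ b a, G.top1 w Ni (fun a => w a * z b) a = 0 := fun b a => by
    rw [top1, dot_mul_right]; linear_combination -w a * z b * h
  simp only [top2, this]
  simp [top1, dot, tr_zero]

lemma top2_mul_right (h : G.dot w w * Ni = 1) (z : Fin n → R) (a b : Fin n) :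
    G.top2 w Ni (fun a b => z a * w b) a b = 0 := by
  have : ∀ b a, G.top1 w Ni (fun a => z a * w b) a = G.top1 w Ni z a * w b := fun b a => by
    rw [top1, dot_mul_right, top1]; ring
  simp only [top2, this]
  rw [top1, dot_mul_left]; linear_combination - G.top1 w Ni z a * w b * h

lemma top2_g (h : G.dot w w * Ni = 1) (a b : Fin n) :
    G.top2 w Ni G.g a b = G.g a b - Ni * (w a * w b) := by
  rw [top2_apply, show G.ctr G.g w = w from funext fun a => G.dot_g_right w a,
    G.dot_g_left w b]
  linear_combination (Ni * w a * w b) * h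

lemma tr_top2 (h : G.dot w w * Ni = 1) (T : Fin n → Fin n → R) :
    G.tr (G.top2 w Ni T) = G.tr T - Ni * G.dot (G.ctr T w) w := by
  rw [show G.top2 w Ni T = fun a b => T a b - Ni * (w a * G.dot (fun a => T a b) w)
    - Ni * (w b * G.ctr T w a) + Ni ^ 2 * (w a * w b * G.dot (G.ctr T w) w) from by
      funext a b; exact G.top2_apply w Ni T a b]
  simp only [tr_sub, tr_add, tr_mul_left, tr_mul_right]
  have h1 : G.tr (fun a b => w a * G.dot (fun a => T a b) w) = G.dot (G.ctr T w) w := by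
    simp only [dot, ctr, ← tr_mul_right, ← tr_mul_left]
    rw [tr_comm]
    refine G.tr_congr fun x y => ?_
    rw [← tr_swap]
    exact G.tr_congr fun _ _ => by ring
  have h2 : G.tr (fun a b => w b * G.ctr T w a) = G.dot (G.ctr T w) w := by
    rw [dot]; exact G.tr_congr fun _ _ => mul_comm _ _
  rw [h1, h2, show G.tr (fun a b => w a * w b) = G.dot w w from rfl]
  linear_combination (Ni * G.dot (G.ctr T w) w) * h

/-! ### Directional derivatives -/

variable (w)

/-- The directional derivative `w^c ∇_c v_a`. -/
def dir₁ (v : Fin n → R) (a : Fin n) : R := G.tr (fun x y => w x * G.cov1 v y a)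

lemma dir₂_add (S T : Fin n → Fin n → R) (a b : Fin n) :
    G.dir₂ w (fun a b => S a b + T a b) a b = G.dir₂ w S a b + G.dir₂ w T a b := by
  simp only [dir₂, cov2_add, mul_add, tr_add]

lemma dir₂_sub (S T : Fin n → Fin n → R) (a b : Fin n) :
    G.dir₂ w (fun a b => S a b - T a b) a b = G.dir₂ w S a b - G.dir₂ w T a b := by
  simp only [dir₂, cov2_sub, mul_sub, tr_sub]

lemma dir₂_mul (f : R) (T : Fin n → Fin n → R) (a b : Fin n) :
    G.dir₂ w (fun a b => f * T a b) a b = G.dot w (G.grad f) * T a b + f * G.dir₂ w T a b := by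
  simp only [dir₂, cov2_mul, mul_add, tr_add, ← mul_assoc, tr_mul_right]
  congr 1
  rw [← tr_mul_left]; exact G.tr_congr fun _ _ => by ring

lemma dir₂_prod (u v : Fin n → R) (a b : Fin n) :
    G.dir₂ w (fun a b => u a * v b) a b = G.dir₁ w u a * v b + u a * G.dir₁ w v b := by
  simp only [dir₂, cov2_prod, mul_add, tr_add, ← mul_assoc, tr_mul_right, dir₁]
  congr 1
  rw [← tr_mul_left]; exact G.tr_congr fun _ _ => by ring

lemma dir₂_swap (T : Fin n → Fin n → R) (a b : Fin n) :
    G.dir₂ w (fun a b => T b a) a b = G.dir₂ w T b a := by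
  simp only [dir₂, cov2_swap]

lemma dir₁_mul (f : R) (v : Fin n → R) (a : Fin n) :
    G.dir₁ w (fun a => f * v a) a = G.dot w (G.grad f) * v a + f * G.dir₁ w v a := by
  simp only [dir₁, cov1_mul, mul_add, tr_add, ← mul_assoc, tr_mul_right]
  congr 1
  rw [← tr_mul_left]; exact G.tr_congr fun _ _ => by ring

lemma dir₁_smul (r : ℝ) (v : Fin n → R) (a : Fin n) :
    G.dir₁ w (fun a => r • v a) a = r • G.dir₁ w v a := by
  simp only [dir₁, cov1_smul, mul_smul_comm, tr_smul]

lemma dir₂_smul (r : ℝ) (T : Fin n → Fin n → R) (a b : Fin n) :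
    G.dir₂ w (fun a b => r • T a b) a b = r • G.dir₂ w T a b := by
  simp only [dir₂, cov2_smul, mul_smul_comm, tr_smul]

lemma dir₁_ctr (T : Fin n → Fin n → R) (v : Fin n → R) (a : Fin n) :
    G.dir₁ w (G.ctr T v) a = G.ctr (G.dir₂ w T) v a + G.ctr T (G.dir₁ w v) a := by
  rw [show G.ctr T v = fun a => G.tr (fun x y => T a x * v y) from rfl]
  simp only [dir₁, cov1_tr_mul, tr_add, mul_add]
  congr 1
  · simp only [ctr, dir₂, ← tr_mul_right, ← tr_mul_left]
    rw [tr_comm]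
    exact G.tr_congr fun _ _ => G.tr_congr fun _ _ => by ring
  · simp only [ctr, dir₁, ← tr_mul_left]
    rw [tr_comm]
    exact G.tr_congr fun _ _ => G.tr_congr fun _ _ => by ring

lemma dot_grad_dot (u v : Fin n → R) :
    G.dot w (G.grad (G.dot u v)) = G.dot (G.dir₁ w u) v + G.dot u (G.dir₁ w v) := by
  simp only [dot, grad, D_tr_mul, tr_add, mul_add, dir₁, ← tr_mul_left, ← tr_mul_right]
  congr 1
  · rw [tr_comm]
    exact G.tr_congr fun _ _ => G.tr_congr fun _ _ => by ring
  · rw [tr_comm]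
    exact G.tr_congr fun _ _ => G.tr_congr fun _ _ => by ring

lemma dot_grad_mul (f h : R) :
    G.dot w (G.grad (f * h)) = G.dot w (G.grad f) * h + f * G.dot w (G.grad h) := by
  simp only [dot, ← tr_mul_left, ← tr_mul_right, ← tr_add, grad_mul]
  exact G.tr_congr fun _ _ => by ring

/-- If ∇_w w = ρ w at the point, differentiating N · Ni = 1 shows that Ni has derivative −2ρ Ni
along w there, so the tensor Ni w ⊗ w, and with it the projection, is parallel along w at the point.
Hence projecting before differentiating, as the theorem prescribes, agrees with projecting
afterwards. -/
lemma ev_dir₂_top2 (ev : R →ₐ[ℝ] ℝ) (h : G.dot w w * Ni = 1) {ρ : ℝ}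
    (hw : ∀ a, ev (G.dir₁ w w a) = ρ * ev (w a)) (T : Fin n → Fin n → R) (a b : Fin n) :
    ev (G.dir₂ w (G.top2 w Ni T) a b) = ev (G.top2 w Ni (G.dir₂ w T) a b) := by
  have e1 : ∀ v, ev (G.dot v (G.dir₁ w w)) = ρ * ev (G.dot v w) := fun v => by
    simp only [ev_dot, hw]
    simp only [dot, ← tr_mul_left]
    exact (G.eval ev).tr_congr fun _ _ => by ring
  have e2 : ev (G.dot w (G.grad Ni)) = - 2 * ρ * ev Ni := by
    have h1 := congrArg (fun r => ev (G.dot w (G.grad r))) h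
    simp only [dot_grad_mul, dot_grad_dot, map_add, map_mul] at h1
    rw [G.dot_comm (G.dir₁ w w) w, e1] at h1
    have h2 : G.dot w (G.grad 1) = 0 := by
      simp [dot, grad, tr_zero]
    have h3 : ev (G.dot w w) * ev Ni = 1 := by rw [← map_mul, h, map_one]
    rw [h2, map_zero] at h1
    linear_combination ev Ni * h1 - (ev (G.dot w (G.grad Ni)) + 2 * ρ * ev Ni) * h3
  have e3 : G.dot w (G.grad (-Ni)) = - G.dot w (G.grad Ni) := by
    simp [dot, grad, tr_neg]
  have key : ∀ (T : Fin n → Fin n → R) (a b : Fin n),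
      ev (G.dir₂ w (fun a b => G.top1 w Ni (fun b => T a b) b) a b)
        = ev (G.top1 w Ni (fun b => G.dir₂ w T a b) b) := by
    intro T a b
    rw [show (fun a b => G.top1 w Ni (fun b => T a b) b)
      = fun a b => T a b + (-Ni) * (G.ctr T w a * w b) from by
        funext a b; rw [top1, show G.dot (fun b => T a b) w = G.ctr T w a from rfl]; ring,
      dir₂_add, G.dir₂_mul w (-Ni) (fun a b => G.ctr T w a * w b), dir₂_prod, dir₁_ctr, top1, e3]
    have e4 : ev (G.ctr T (G.dir₁ w w) a) = ρ * ev (G.ctr T w a) := e1 _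
    have e5 : G.dot (fun b => G.dir₂ w T a b) w = G.ctr (G.dir₂ w T) w a := rfl
    rw [e5]
    simp only [map_add, map_sub, map_mul, map_neg, e4, e2, hw]
    ring
  have k1 := key (fun a b => G.top1 w Ni (fun a => T a b) a) a b
  rw [show (fun a b => G.top1 w Ni (fun b => (fun a b => G.top1 w Ni (fun a => T a b) a) a b) b)
    = G.top2 w Ni T from rfl] at k1
  rw [k1]
  have k2 : ∀ b, ev (G.dir₂ w (fun a b => G.top1 w Ni (fun a => T a b) a) a b)
      = ev (G.top1 w Ni (fun a => G.dir₂ w T a b) a) := by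
    intro b
    have := key (fun b a => T a b) b a
    rw [G.dir₂_swap w (fun a b => G.top1 w Ni (fun a => T a b) a)] at this
    rw [this]
    congr 2
    funext a
    rw [G.dir₂_swap w T]
  simp only [top2, top1, map_sub, map_mul, ev_dot] at k2 ⊢
  simp only [k2]

end MetricAlgebra

end

/-! ## Boundary quantities -/

section

namespace MetricAlgebra

variable {n : ℕ} {R : Type*} [CommRing R] [Algebra ℝ R] (G : MetricAlgebra n R)

lemma ev_top1 (ev : R →ₐ[ℝ] ℝ) (w : Fin n → R) (Ni : R) (v : Fin n → R) (a : Fin n) :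
    ev (G.top1 w Ni v a)
      = (G.eval ev).top1 (fun a => ev (w a)) (ev Ni) (fun a => ev (v a)) a := by
  simp only [top1, map_sub, map_mul, ev_dot]

lemma ev_top2 (ev : R →ₐ[ℝ] ℝ) (w : Fin n → R) (Ni : R) (T : Fin n → Fin n → R) (a b : Fin n) :
    ev (G.top2 w Ni T a b)
      = (G.eval ev).top2 (fun a => ev (w a)) (ev Ni) (fun a b => ev (T a b)) a b := by
  simp only [top2, ev_top1]

end MetricAlgebra

namespace MatterAlgebra

variable {R : Type*} [CommRing R] [Algebra ℝ R] (X : MatterAlgebra R)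

/-! ### The geometric quantities of the boundary, over the algebra of functions -/

/-- The unit normal; `κ` stands for `1 / √λ`. -/
def nrm (κ : ℝ) (a : Fin 4) : R := κ • X.w a

/-- The contraction `T_{an}`. -/
def cn (κ : ℝ) (T : Fin 4 → Fin 4 → R) (a : Fin 4) : R := κ • X.ctr T X.w a

/-- The contraction `T_{nn}`. -/
def cnn (κ : ℝ) (T : Fin 4 → Fin 4 → R) : R := κ • X.dot (X.cn κ T) X.w

/-- The derivative `∇_n f`. -/
def dn0 (κ : ℝ) (f : R) : R := κ • X.dot X.w (X.grad f)

/-- The derivative `∇_n v_a`. -/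
def dn1 (κ : ℝ) (v : Fin 4 → R) (a : Fin 4) : R := κ • X.dir₁ X.w v a

/-- The derivative `∇_n T_{ab}`. -/
def dn2 (κ : ℝ) (T : Fin 4 → Fin 4 → R) (a b : Fin 4) : R := κ • X.dir₂ X.w T a b

/-- The projection of a covector. -/
def pr1 (Ni : R) (v : Fin 4 → R) (a : Fin 4) : R := X.top1 X.w Ni v a

/-- The projection of a 2-tensor. -/
def pr2 (Ni : R) (T : Fin 4 → Fin 4 → R) (a b : Fin 4) : R := X.top2 X.w Ni T a b

/-- The first fundamental form. -/
def gbar (Ni : R) (a b : Fin 4) : R := X.pr2 Ni X.g a b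

/-- The second fundamental form. -/
def K (κ : ℝ) (Ni : R) (a b : Fin 4) : R := X.pr2 Ni (X.cov1 (X.nrm κ)) a b

/-- The mean curvature. -/
def H (κ : ℝ) (Ni : R) : R := X.tr (X.K κ Ni)

/-- The trace-free part of the projection of a 2-tensor. -/
def prFree (Ni : R) (T : Fin 4 → Fin 4 → R) (a b : Fin 4) : R :=
  X.pr2 Ni T a b - (1 / 3 : ℝ) • (X.tr (X.pr2 Ni T) * X.gbar Ni a b)

/-- The covector `(q - 2) τ_{an} + n_a τ`. -/
def constr (κ : ℝ) (a : Fin 4) : R := ((X.q : ℝ) - 2) • X.cn κ X.τ a + X.nrm κ a * X.t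

/-- The electric part of the Weyl tensor. -/
def weylE (κ : ℝ) (a b : Fin 4) : R :=
  κ ^ 2 • X.tr (fun c x => X.tr (fun d y => X.weyl c a d b * X.w x * X.w y))

/-- The conservation law once more, valid near the boundary and not only on it. Both matter
constraints follow: the covector vanishes with Ω, and its normal derivative is produced by the
factor Ω. -/
lemma constr_eq (κ : ℝ) (a : Fin 4) : X.constr κ a = - κ • (X.Om * X.div X.τ a) := by
  have h := X.conservation a
  rw [constr, cn, nrm]
  linear_combination (norm := algebra) κ • h

/-- `N_add_lam` times κ² = 1/λ. The last summand is the remainder of order q + 2 in explicit form.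
-/
lemma nn_eq {κ : ℝ} (hκ : κ ^ 2 * X.lam = 1) : κ ^ 2 • X.N
    = -1 + (2 / (4 * X.lam) : ℝ) • (X.Om * (X.lap X.Om + X.J * X.Om))
      + (κ ^ 2 / 12 : ℝ) • (X.Om ^ (X.q + 2) * X.t) := by
  have h := X.N_add_lam
  have hl : X.lam ≠ 0 := by rintro h; simp [h] at hκ
  have h1 : (2 / (4 * X.lam) : ℝ) = κ ^ 2 / 2 := by field_simp; linarith
  have h2 : κ ^ 2 • algebraMap ℝ R X.lam = 1 := by
    rw [Algebra.smul_def, ← map_mul, hκ, map_one]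
  rw [h1]
  rw [ρ] at h
  linear_combination (norm := algebra) κ ^ 2 • h - h2

/-- For `q = 1`, the tangential energy flux is divisible by the defining function. -/
lemma pr1_cn_one (hq : X.q = 1) {Ni : R} (hNi : X.N * Ni = 1) (κ : ℝ) (a : Fin 4) :
    X.pr1 Ni (X.cn κ X.τ) a = X.Om * (κ • X.pr1 Ni (X.div X.τ) a) := by
  have h : X.cn κ X.τ = fun a => κ • (X.t * X.w a + X.Om * X.div X.τ a) := by
    funext a
    have h := X.conservation a
    rw [hq] at h
    rw [cn]
    push_cast at h
    linear_combination (norm := algebra) (-κ) • h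
  rw [h, pr1, pr1, MetricAlgebra.top1, MetricAlgebra.top1, X.dot_smul_left, X.dot_add_left,
    X.dot_mul_left, X.dot_mul_left]
  change _ - Ni * (X.w a * (κ • (X.t * X.N + _))) = _
  linear_combination (norm := algebra) (-κ) • (X.t * X.w a * hNi)

/-! ### Evaluation at a boundary point -/

variable (ev : R →ₐ[ℝ] ℝ)

section

variable {X} {ev}

lemma ev_N (h0 : ev X.Om = 0) : ev X.N = - X.lam := by
  have h := congrArg ev X.N_add_lam
  simp only [map_add, map_mul, AlgHom.commutes, h0, map_smul, map_pow] at h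
  simp at h
  linarith

/-- On the boundary the Schouten term and the source of `cov1_w` both carry a factor Ω, so the
Hessian of Ω is pure trace. Umbilicity and most later simplifications rest on this. -/
lemma ev_cov1_w (h0 : ev X.Om = 0) (a b : Fin 4) :
    ev (X.cov1 X.w a b) = ev X.ρ * ev (X.g a b) := by
  rw [cov1_w, s, f]
  simp [h0]

lemma ev_lap_Om (h0 : ev X.Om = 0) : ev (X.lap X.Om) = 4 * ev X.ρ := by
  rw [ρ]; simp [h0]

lemma ev_f (h0 : ev X.Om = 0) : ev X.f = 0 := by rw [f]; simp [h0]

lemma ev_dir₁_w (h0 : ev X.Om = 0) (a : Fin 4) :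
    ev (X.dir₁ X.w X.w a) = ev X.ρ * ev (X.w a) := by
  simp only [MetricAlgebra.dir₁, X.ev_tr, map_mul, ev_cov1_w h0]
  have := (X.eval ev).tr_g_right (fun a => ev (X.w a)) a
  rw [← this, ← (X.eval ev).tr_mul_left]
  refine (X.eval ev).tr_congr fun x y => ?_
  simp only [MetricAlgebra.eval]; ring

lemma ev_Ni (h0 : ev X.Om = 0) {Ni : R} (hNi : X.N * Ni = 1) : X.lam * ev Ni = -1 := by
  have h := congrArg ev hNi
  rw [map_mul, ev_N h0, map_one] at h
  linarith

lemma ev_ctr_cov1_w (h0 : ev X.Om = 0) (T : Fin 4 → Fin 4 → R) (e a : Fin 4) :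
    ev (X.ctr T (X.cov1 X.w e) a) = ev X.ρ * ev (T a e) := by
  simp only [X.ev_ctr, ev_cov1_w h0]
  have := (X.eval ev).tr_g_right' (fun b => ev (T a b)) e
  rw [← this, ← (X.eval ev).tr_mul_left]
  refine (X.eval ev).tr_congr fun x y => ?_
  simp only [MetricAlgebra.eval]; ring

/-- The first derivative of the conservation law on the boundary. -/
lemma ev_conservation (h0 : ev X.Om = 0) (e a : Fin 4) :
    ev (X.w e) * ev (X.div X.τ a) + ((X.q : ℝ) - 2) * (ev (X.ctr (X.cov2 X.τ e) X.w a)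
      + ev X.ρ * ev (X.τ a e)) + ev (X.grad X.t e) * ev (X.w a)
      + ev X.t * (ev X.ρ * ev (X.g e a)) = 0 := by
  have h := congrArg ev (X.cov1_conservation e a)
  simp only [map_add, map_mul, map_smul, smul_eq_mul, ev_ctr_cov1_w h0, ev_cov1_w h0, h0,
    map_zero, zero_mul, add_zero] at h
  exact h

lemma ev_constraint (h0 : ev X.Om = 0) (a : Fin 4) :
    ((X.q : ℝ) - 2) * ev (X.ctr X.τ X.w a) + ev X.t * ev (X.w a) = 0 := by
  have h := congrArg ev (X.conservation a)
  simpa only [map_add, map_mul, map_smul, smul_eq_mul, h0, zero_mul, zero_add, map_zero] using h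

lemma ctr_dir₂ (T : Fin 4 → Fin 4 → R) (a : Fin 4) :
    X.ctr (X.dir₂ X.w T) X.w a = X.dot X.w (fun e => X.ctr (X.cov2 T e) X.w a) := by
  simp only [MetricAlgebra.ctr, MetricAlgebra.dir₂, MetricAlgebra.dot, ← X.tr_mul_left,
    ← X.tr_mul_right]
  rw [X.tr_comm]
  exact X.tr_congr fun _ _ => X.tr_congr fun _ _ => by ring

/-- The normal component of the first derivative of the conservation law on the boundary. -/
lemma ev_conservation_dir (h0 : ev X.Om = 0) (a : Fin 4) :
    - X.lam * ev (X.div X.τ a) + ((X.q : ℝ) - 2) * (ev (X.ctr (X.dir₂ X.w X.τ) X.w a)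
      + ev X.ρ * ev (X.ctr X.τ X.w a)) + ev (X.dot X.w (X.grad X.t)) * ev (X.w a)
      + ev X.t * (ev X.ρ * ev (X.w a)) = 0 := by
  have hN : (X.eval ev).tr (fun x y => ev (X.w x) * ev (X.w y)) = - X.lam := by
    rw [← ev_N h0, N, X.ev_dot]; rfl
  rw [ctr_dir₂]
  have h := (X.eval ev).tr_congr fun x e =>
    congrArg (fun r => ev (X.w x) * r) (ev_conservation h0 e a)
  have e1 : ∀ x e, ev (X.w x) * (ev (X.w e) * ev (X.div X.τ a)
      + ((X.q : ℝ) - 2) * (ev (X.ctr (X.cov2 X.τ e) X.w a)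
      + ev X.ρ * ev (X.τ a e)) + ev (X.grad X.t e) * ev (X.w a)
      + ev X.t * (ev X.ρ * ev (X.g e a)))
      = ev (X.w x) * ev (X.w e) * ev (X.div X.τ a)
      + ((X.q : ℝ) - 2) * (ev (X.w x) * ev (X.ctr (X.cov2 X.τ e) X.w a)
      + ev X.ρ * (ev (X.τ a e) * ev (X.w x))) + ev (X.w x) * ev (X.grad X.t e) * ev (X.w a)
      + ev X.t * (ev X.ρ * (ev (X.g e a) * ev (X.w x))) := fun x e => by ring
  have e2 : (X.eval ev).tr (fun x e => ev (X.g e a) * ev (X.w x)) = ev (X.w a) :=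
    (X.eval ev).tr_g_right (fun x => ev (X.w x)) a
  have e3 : (X.eval ev).tr (fun x e => ev (X.τ a e) * ev (X.w x)) = ev (X.ctr X.τ X.w a) := by
    rw [X.ev_ctr, ← (X.eval ev).tr_swap]; rfl
  simp only [e1, mul_zero, (X.eval ev).tr_add, (X.eval ev).tr_mul_left, (X.eval ev).tr_mul_right,
    (X.eval ev).tr_zero, hN, e2, e3] at h
  rw [X.ev_dot, X.ev_dot]
  exact h

lemma dot_ctr_swap (T : Fin 4 → Fin 4 → R) : X.tr (fun e a => X.ctr (X.cov2 T e) X.w a)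
    = X.tr (fun x y => X.tr (fun e a => X.cov2 T e a x) * X.w y) := by
  simp only [MetricAlgebra.ctr, ← X.tr_mul_right]
  exact X.tr_comm _

/-- The trace of the first derivative of the conservation law on the boundary. -/
lemma ev_conservation_tr (h0 : ev X.Om = 0) :
    ev (X.dot X.w (X.div X.τ)) + ((X.q : ℝ) - 2) * (ev (X.dot X.w (X.div X.τ))
      + ev X.ρ * ev X.t) + ev (X.dot X.w (X.grad X.t)) + 4 * ev X.t * ev X.ρ = 0 := by
  have h := (X.eval ev).tr_congr fun e a => ev_conservation h0 e a
  have e1 : (X.eval ev).tr (fun e a => ev (X.ctr (X.cov2 X.τ e) X.w a))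
      = ev (X.dot X.w (X.div X.τ)) := by
    rw [← X.ev_tr, dot_ctr_swap, X.dot_comm]
    congr 1
    refine X.tr_congr fun x y => ?_
    rw [MetricAlgebra.div]
    congr 1
    exact X.tr_congr fun e a => X.cov2_symm X.τ_symm e a x
  have e2 : (X.eval ev).tr (fun e a => ev (X.τ a e)) = ev X.t := by
    rw [t, X.ev_tr, ← (X.eval ev).tr_swap]
  have e3 : (X.eval ev).tr (fun e a => ev (X.g e a)) = 4 := (X.eval ev).tr_g_four
  have e4 : (X.eval ev).tr (fun e a => ev (X.grad X.t e) * ev (X.w a))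
      = ev (X.dot X.w (X.grad X.t)) := by
    rw [X.dot_comm, X.ev_dot]; rfl
  have e5 : (X.eval ev).tr (fun e a => ev (X.w e) * ev (X.div X.τ a))
      = ev (X.dot X.w (X.div X.τ)) := by
    rw [X.ev_dot]; rfl
  simp only [(X.eval ev).tr_add, (X.eval ev).tr_mul_left, (X.eval ev).tr_zero, e1, e2, e3, e4,
    e5] at h
  linear_combination h

end

end MatterAlgebra

end

/-! ## The results over algebras: general facts -/

section

namespace MetricAlgebra

variable {n : ℕ} {R : Type*} [CommRing R] [Algebra ℝ R] (G : MetricAlgebra n R)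
  {w z : Fin n → R} {Ni α : R} {S T : Fin n → Fin n → R}

/-- Terms with a free factor w die under the projection. This allows the tangential part of a tensor
to be read off from a decomposition modulo w. -/
lemma top2_decomp (h : G.dot w w * Ni = 1)
    (hT : ∀ b c, T b c = S b c + α * G.g b c + w b * z c + z b * w c) (a b : Fin n) :
    G.top2 w Ni T a b = G.top2 w Ni S a b + α * G.top2 w Ni G.g a b := by
  rw [show T = fun b c => S b c + α * G.g b c + w b * z c + z b * w c from by
    funext b c; exact hT b c, G.top2_add w Ni (fun b c => S b c + α * G.g b c + w b * z c),
    G.top2_add w Ni (fun b c => S b c + α * G.g b c), G.top2_add w Ni S, top2_mul,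
    G.top2_mul_left h, G.top2_mul_right h]
  ring

lemma ctr_decomp (hT : ∀ b c, T b c = S b c + α * G.g b c + w b * z c + z b * w c) (b : Fin n) :
    G.ctr T w b = G.ctr S w b + α * w b + w b * G.dot z w + z b * G.dot w w := by
  have : ∀ x y, T b x * w y = S b x * w y + α * (G.g b x * w y) + w b * (z x * w y)
      + z b * (w x * w y) := fun x y => by rw [hT]; ring
  simp only [ctr, this, tr_add, tr_mul_left, dot]
  rw [G.tr_g_left' w b]

lemma top1_add (u v : Fin n → R) (a : Fin n) :
    G.top1 w Ni (fun a => u a + v a) a = G.top1 w Ni u a + G.top1 w Ni v a := by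
  simp only [top1, dot_add_left]; ring

lemma top1_mul (r : R) (v : Fin n → R) (a : Fin n) :
    G.top1 w Ni (fun a => r * v a) a = r * G.top1 w Ni v a := by
  simp only [top1, dot_mul_left]; ring

lemma tr_top2_g (h : G.dot w w * Ni = 1) : G.tr (G.top2 w Ni G.g) = n - 1 := by
  rw [G.tr_top2 h, show G.ctr G.g w = w from funext fun a => G.dot_g_right w a,
    show G.tr G.g = n from G.tr_g]
  linear_combination -h

end MetricAlgebra

namespace MatterAlgebra

variable {R : Type*} [CommRing R] [Algebra ℝ R] {X : MatterAlgebra R} {ev : R →ₐ[ℝ] ℝ}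

variable (X ev) in
/-- The value of the gradient of the defining function. -/
def W (a : Fin 4) : ℝ := ev (X.w a)

lemma ev_dot_W {Ni : R} (hNi : X.N * Ni = 1) :
    (X.eval ev).dot (X.W ev) (X.W ev) * ev Ni = 1 := by
  rw [← map_one ev, ← hNi, map_mul, N, X.ev_dot]; rfl

lemma dot_W (h0 : ev X.Om = 0) : (X.eval ev).dot (X.W ev) (X.W ev) = - X.lam := by
  rw [← ev_N h0, N, X.ev_dot]; rfl

lemma ev_Ni_eq (h0 : ev X.Om = 0) {Ni : R} (hNi : X.N * Ni = 1) {κ : ℝ}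
    (hκ : κ ^ 2 * X.lam = 1) : ev Ni = - κ ^ 2 := by
  have h := ev_Ni h0 hNi
  linear_combination (- ev Ni) * hκ + κ ^ 2 * h

lemma ev_gbar (Ni : R) (a b : Fin 4) :
    ev (X.gbar Ni a b) = (X.eval ev).top2 (X.W ev) (ev Ni) (X.eval ev).g a b :=
  X.ev_top2 ev _ _ _ _ _

lemma ev_K (h0 : ev X.Om = 0) (Ni : R) (κ : ℝ) (a b : Fin 4) :
    ev (X.K κ Ni a b) = κ * ev X.ρ * ev (X.gbar Ni a b) := by
  rw [ev_gbar, K, pr2, X.ev_top2, ← MetricAlgebra.top2_mul]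
  congr 1
  funext a b
  rw [show X.nrm κ = fun a => κ • X.w a from rfl, X.cov1_smul, map_smul, ev_cov1_w h0,
    smul_eq_mul]
  simp only [MetricAlgebra.eval]; ring

lemma ev_H (h0 : ev X.Om = 0) {Ni : R} (hNi : X.N * Ni = 1) (κ : ℝ) :
    ev (X.H κ Ni) = 3 * κ * ev X.ρ := by
  have h := (X.eval ev).tr_top2_g (ev_dot_W hNi)
  rw [H, X.ev_tr]
  simp only [ev_K h0, ev_gbar, MetricAlgebra.tr_mul_left]
  rw [show (X.eval ev).tr (fun a b => (X.eval ev).top2 (X.W ev) (ev Ni) (X.eval ev).g a b) = 3 from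
    h.trans (by norm_num)]
  ring

lemma ev_Kfree (h0 : ev X.Om = 0) {Ni : R} (hNi : X.N * Ni = 1) (κ : ℝ) (a b : Fin 4) :
    ev (X.K κ Ni a b) - ev (X.H κ Ni) / 3 * ev (X.gbar Ni a b) = 0 := by
  rw [ev_K h0, ev_H h0 hNi]; ring

/-- By `constr_eq` the covector is −κΩ div τ, so on the boundary only the derivative of Ω counts; it
contributes −κ²N = 1. -/
lemma ev_dn1_constr (h0 : ev X.Om = 0) {κ : ℝ} (hκ : κ ^ 2 * X.lam = 1) (a : Fin 4) :
    ev (X.dn1 κ (X.constr κ) a) = ev (X.div X.τ a) := by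
  rw [show X.constr κ = fun a => - κ • (X.Om * X.div X.τ a) from funext fun a => X.constr_eq κ a,
    dn1, X.dir₁_smul, X.dir₁_mul, show X.dot X.w (X.grad X.Om) = X.N from rfl]
  simp only [map_smul, map_add, map_mul, h0, ev_N h0, smul_eq_mul]
  linear_combination ev (X.div X.τ a) * hκ

lemma dir_θ (a b : Fin 4) : X.dir₂ X.w X.θ a b = X.dir₂ X.w X.τ a b
    - (1 / 4 : ℝ) • (X.dot X.w (X.grad X.t) * X.g a b) := by
  rw [show X.θ = fun a b => X.τ a b - (1 / 4 : ℝ) • (X.t * X.g a b) from rfl, X.dir₂_sub,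
    X.dir₂_smul X.w _ (fun a b => X.t * X.g a b), X.dir₂_mul]
  have : X.dir₂ X.w X.g a b = 0 := by simp [MetricAlgebra.dir₂, X.cov2_g, X.tr_zero]
  rw [this]; algebra

lemma ev_θ (a b : Fin 4) : ev (X.θ a b) = ev (X.τ a b) - 1 / 4 * (ev X.t * ev (X.g a b)) := by
  simp only [θ, map_sub, map_smul, map_mul, smul_eq_mul]

lemma ev_pr2_eq (Ni : R) (T : Fin 4 → Fin 4 → R) (a b : Fin 4) : ev (X.pr2 Ni T a b)
    = (X.eval ev).top2 (X.W ev) (ev Ni) (fun a b => ev (T a b)) a b := X.ev_top2 ev _ _ _ _ _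

lemma ev_prFree (Ni : R) (T : Fin 4 → Fin 4 → R) (a b : Fin 4) : ev (X.prFree Ni T a b)
    = (X.eval ev).top2 (X.W ev) (ev Ni) (fun a b => ev (T a b)) a b
      - 1 / 3 * ((X.eval ev).tr ((X.eval ev).top2 (X.W ev) (ev Ni) (fun a b => ev (T a b)))
        * (X.eval ev).top2 (X.W ev) (ev Ni) (X.eval ev).g a b) := by
  rw [prFree, map_sub, map_smul, map_mul, ev_pr2_eq, X.ev_tr, ev_gbar, smul_eq_mul]
  simp only [ev_pr2_eq]

lemma ev_dn2_pr2 (h0 : ev X.Om = 0) {Ni : R} (hNi : X.N * Ni = 1) (κ : ℝ)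
    (T : Fin 4 → Fin 4 → R) (a b : Fin 4) : ev (X.dn2 κ (X.pr2 Ni T) a b)
      = κ * (X.eval ev).top2 (X.W ev) (ev Ni) (fun a b => ev (X.dir₂ X.w T a b)) a b := by
  rw [dn2, map_smul, smul_eq_mul, show X.pr2 Ni T = X.top2 X.w Ni T from rfl,
    X.ev_dir₂_top2 X.w ev hNi (ev_dir₁_w h0), X.ev_top2]
  rfl

/-! #### The case `q = 0` -/

lemma ev_ctr_zero (h0 : ev X.Om = 0) (hq : X.q = 0) (a : Fin 4) :
    ev (X.ctr X.τ X.w a) = 1 / 2 * (ev X.t * X.W ev a) := by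
  have h := ev_constraint h0 a
  rw [hq] at h
  push_cast at h
  rw [W]; linarith

/-- The boundary value of `two_mul_Om_mul_bach`: ΩB and the term with Z vanish, but f = Ω/2 has the
gradient w/2, so a derivative of τ along w survives. The coefficient of the metric is zero by the
traced conservation law and is kept so that `top2_decomp` applies. -/
lemma ev_dir_zero (h0 : ev X.Om = 0) (hq : X.q = 0) : ∃ z : Fin 4 → ℝ, ∀ b c,
    ev (X.dir₂ X.w X.τ b c) = -2 * ev X.ρ * ev (X.τ b c) + 0 * (X.eval ev).g b c
      + X.W ev b * z c + z b * X.W ev c := by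
  -- The covector z consists of the terms of twice the symmetrised ∇u that contain a factor w.
  refine ⟨fun a => 1 / 12 * ev (X.grad X.t a) + 2 * ev (X.y₀ a), fun b c => ?_⟩
  have h := congrArg ev (X.two_mul_Om_mul_bach b c)
  rw [show X.s = fun b c => X.f * X.θ b c from rfl, X.lap₂_mul, lap_f_zero X hq, dir_f, dir_θ,
    cov1_u_zero X hq, cov1_u_zero X hq, hq] at h
  simp only [map_add, map_sub, map_mul, map_smul, smul_eq_mul, h0, ev_f h0, ev_cov1_w h0,
    ev_lap_Om h0, pow_zero, map_one, map_ofNat, ev_θ] at h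
  have hd : ev (X.div₁ X.u) = 1 / 24 * (ev (X.dot X.w (X.grad X.t)) + 4 * ev X.t * ev X.ρ)
      + ev (X.dot X.w X.y₀) := by
    have : X.div₁ X.u = (1 / 24 : ℝ) • (X.dot (X.grad X.t) X.w + X.t * X.lap X.Om)
        + X.dot X.w X.y₀ + X.Om * X.div₁ X.y₀ := by
      simp only [div₁, cov1_u_zero X hq, X.tr_add, X.tr_mul_left, X.tr_smul]
      rfl
    rw [this, X.dot_comm]
    simp only [map_add, map_mul, map_smul, smul_eq_mul, h0, ev_lap_Om h0]
    ring
  have hy : ev (X.dot X.w X.y₀) = 1 / 4 * ev (X.dot X.w (X.div X.τ))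
      - 1 / 24 * ev (X.dot X.w (X.grad X.t)) := by
    rw [X.dot_comm, show X.y₀ = fun a => (1 / 4 : ℝ) • X.div X.τ a - (1 / 24 : ℝ) • X.grad X.t a
      from rfl, X.dot_sub_left, X.dot_smul_left, X.dot_smul_left, X.dot_comm, X.dot_comm _ X.w]
    simp only [map_sub, map_smul, smul_eq_mul]
  have ht := ev_conservation_tr h0
  rw [hd, hy] at h
  rw [hq] at ht
  have hg : ev (X.g c b) = ev (X.g b c) := by rw [X.g_symm]
  rw [hg] at h
  push_cast at h ht
  simp only [MetricAlgebra.eval, W]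
  linear_combination (-1/2) * h + (1/4 * ev (X.g b c)) * ht

lemma ev_dn2_zero (h0 : ev X.Om = 0) (hq : X.q = 0) {Ni : R} (hNi : X.N * Ni = 1) (κ : ℝ)
    (a b : Fin 4) : ev (X.dn2 κ (X.pr2 Ni X.τ) a b)
      + 2 / 3 * ev (X.H κ Ni) * ev (X.pr2 Ni X.τ a b) = 0 := by
  obtain ⟨z, hz⟩ := ev_dir_zero h0 hq
  rw [ev_dn2_pr2 h0 hNi, ev_H h0 hNi, ev_pr2_eq]
  rw [(X.eval ev).top2_decomp (ev_dot_W hNi) hz, MetricAlgebra.top2_mul _ _ _ (-2 * ev X.ρ)]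
  ring

/-- In `weyl_w` the Cotton term vanishes with Ω, whereas the gradient w/2 of f does not; it is
through this gradient that τ enters the Weyl tensor on the boundary when q = 0. -/
lemma ev_weyl_w_zero (h0 : ev X.Om = 0) (hq : X.q = 0) (a b c : Fin 4) :
    ev (X.tr (fun x y => X.weyl a b c x * X.w y))
      = ev X.t / 24 * (ev (X.w a) * ev (X.g b c) - ev (X.w b) * ev (X.g a c))
        + 1 / 2 * (ev (X.w a) * ev (X.θ b c) - ev (X.w b) * ev (X.θ a c)) := by
  have h := congrArg ev (X.weyl_w a b c)
  have hs : ∀ a b c, ev (X.cov2 X.s a b c) = 1 / 2 * (ev (X.w a) * ev (X.θ b c)) := by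
    intro a b c
    rw [show X.s = fun b c => X.f * X.θ b c from rfl, X.cov2_mul,
      show X.D a X.f = X.grad X.f a from rfl, grad_f, hq]
    simp only [map_add, map_mul, map_smul, smul_eq_mul, ev_f h0, pow_zero, map_one]
    push_cast; ring
  have hu : ∀ a, ev (X.u a) = ev X.t / 24 * ev (X.w a) := by
    intro a
    rw [u_eq, hq]
    simp only [map_sub, map_mul, map_smul, smul_eq_mul, pow_zero, map_one, zero_add, pow_one, h0,
      ev_ctr_zero h0 hq, W]
    push_cast; ring
  simp only [Q, map_add, map_sub, map_mul, h0, hs, hu] at h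
  linear_combination h

/-- A second contraction of `ev_weyl_w_zero` with w. Because τ·w = ½ t w on the boundary, the terms
containing w complete the result to the trace-free projection of τ. -/
lemma ev_weylE_zero (h0 : ev X.Om = 0) (hq : X.q = 0) {Ni : R} (hNi : X.N * Ni = 1) {κ : ℝ}
    (hκ : κ ^ 2 * X.lam = 1) (a b : Fin 4) :
    ev (X.weylE κ a b) = 1 / 2 * ev (X.prFree Ni X.τ a b) := by
  have hN := dot_W h0
  have hW := ev_dot_W (ev := ev) hNi
  have hni := ev_Ni_eq h0 hNi hκ
  have hτ : (X.eval ev).ctr (fun a b => ev (X.τ a b)) (X.W ev)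
      = fun a => 1 / 2 * ev X.t * X.W ev a := by
    funext a
    rw [mul_assoc, ← ev_ctr_zero h0 hq, X.ev_ctr]
    rfl
  have hτ' : ∀ b, (X.eval ev).dot (fun a => ev (X.τ a b)) (X.W ev) = 1 / 2 * ev X.t * X.W ev b := by
    intro b
    rw [← congrFun hτ b]
    simp only [τ_symm X _ b]
    rfl
  have htr : (X.eval ev).tr (fun a b => ev (X.τ a b)) = ev X.t := by rw [t, X.ev_tr]
  have hl : X.weylE κ a b
      = - κ ^ 2 • X.tr (fun c x => X.tr (fun d y => X.weyl c a b d * X.w y) * X.w x) := by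
    rw [weylE, neg_smul, ← smul_neg, ← X.tr_neg]
    congr 1
    refine X.tr_congr fun c x => ?_
    rw [← X.tr_mul_right, ← X.tr_neg]
    exact X.tr_congr fun d y => by rw [X.weyl_antisymm_right]; ring
  have hθ : (X.eval ev).tr (fun c x => ev (X.θ c b) * ev (X.w x)) = 1 / 4 * ev X.t * X.W ev b := by
    have := hτ' b
    simp only [ev_θ, sub_mul, mul_assoc, MetricAlgebra.tr_sub, MetricAlgebra.tr_mul_left]
    have h2 : (X.eval ev).tr (fun c x => ev (X.g c b) * ev (X.w x)) = X.W ev b :=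
      (X.eval ev).tr_g_left (X.W ev) b
    simp only [MetricAlgebra.dot, W] at this h2 ⊢
    rw [this, h2]; ring
  have hg : (X.eval ev).tr (fun c x => ev (X.g c b) * ev (X.w x)) = X.W ev b :=
    (X.eval ev).tr_g_left (X.W ev) b
  have hww : (X.eval ev).tr (fun c x => ev (X.w c) * ev (X.w x)) = - X.lam := hN
  have hlhs : ev (X.weylE κ a b) = - κ ^ 2 * (ev X.t / 24 * (- X.lam * ev (X.g a b)
      - X.W ev a * X.W ev b) + 1 / 2 * (- X.lam * ev (X.θ a b)
      - X.W ev a * (1 / 4 * ev X.t * X.W ev b))) := by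
    rw [hl, map_smul, X.ev_tr, smul_eq_mul]
    congr 1
    have e : ∀ c x, ev (X.tr (fun d y => X.weyl c a b d * X.w y) * X.w x)
        = ev X.t / 24 * ((ev (X.w c) * ev (X.w x)) * ev (X.g a b)
          - ev (X.w a) * (ev (X.g c b) * ev (X.w x)))
        + 1 / 2 * ((ev (X.w c) * ev (X.w x)) * ev (X.θ a b)
          - ev (X.w a) * (ev (X.θ c b) * ev (X.w x))) := by
      intro c x
      rw [map_mul, ev_weyl_w_zero h0 hq]; ring
    simp only [e, MetricAlgebra.tr_sub, MetricAlgebra.tr_add, MetricAlgebra.tr_mul_left,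
      MetricAlgebra.tr_mul_right, hg, hww, hθ]
    rfl
  have hd : (X.eval ev).dot (fun a => 1 / 2 * ev X.t * X.W ev a) (X.W ev)
      = 1 / 2 * ev X.t * - X.lam := by
    rw [MetricAlgebra.dot_mul_left, hN]
  have hgg : (X.eval ev).g a b = ev (X.g a b) := rfl
  rw [hlhs, ev_prFree, MetricAlgebra.tr_top2 _ hW, MetricAlgebra.top2_g _ hW,
    MetricAlgebra.top2_apply, hτ, hτ', htr, hd, ev_θ, hni, hgg]
  linear_combination (-1/6 * ev X.t * ev (X.g a b) + 1/6 * ev X.t * κ ^ 2 * X.W ev a * X.W ev b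
    + 1/2 * ev (X.τ a b)) * hκ

end MatterAlgebra

end

/-! ## The results over algebras: the Bach tensor -/

section

namespace MatterAlgebra

variable {R : Type*} [CommRing R] [Algebra ℝ R] {X : MatterAlgebra R} {ev : R →ₐ[ℝ] ℝ}

/-! #### Tensors that are pure trace modulo the normal -/

/-- As `top2_decomp`, but now the multiple of the metric disappears as well, the induced metric
having trace 3. -/
lemma ev_prFree_decomp {Ni : R} (hNi : X.N * Ni = 1) {T : Fin 4 → Fin 4 → R}
    {S : Fin 4 → Fin 4 → ℝ} {α : ℝ} {z : Fin 4 → ℝ}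
    (hT : ∀ b c, ev (T b c) = S b c + α * (X.eval ev).g b c + X.W ev b * z c + z b * X.W ev c)
    (a b : Fin 4) : ev (X.prFree Ni T a b)
      = (X.eval ev).top2 (X.W ev) (ev Ni) S a b
        - 1 / 3 * ((X.eval ev).tr ((X.eval ev).top2 (X.W ev) (ev Ni) S)
        * (X.eval ev).top2 (X.W ev) (ev Ni) (X.eval ev).g a b) := by
  have h := fun a b => (X.eval ev).top2_decomp (ev_dot_W hNi) hT a b
  have h3 := (X.eval ev).tr_top2_g (ev_dot_W hNi)
  rw [ev_prFree, h]
  rw [show (X.eval ev).top2 (X.W ev) (ev Ni) (fun a b => ev (T a b))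
    = fun a b => (X.eval ev).top2 (X.W ev) (ev Ni) S a b
      + α * (X.eval ev).top2 (X.W ev) (ev Ni) (X.eval ev).g a b from by funext a b; exact h a b,
    MetricAlgebra.tr_add, MetricAlgebra.tr_mul_left,
    show (X.eval ev).tr (fun a b => (X.eval ev).top2 (X.W ev) (ev Ni) (X.eval ev).g a b) = 3 from
    h3.trans (by norm_num)]
  change _ = _ - 1 / 3 * ((X.eval ev).tr (fun a b => (X.eval ev).top2 (X.W ev) (ev Ni) S a b) * _)
  ring

lemma ev_cn (κ : ℝ) (T : Fin 4 → Fin 4 → R) (a : Fin 4) : ev (X.cn κ T a)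
    = κ * (X.eval ev).ctr (fun a b => ev (T a b)) (X.W ev) a := by
  rw [cn, map_smul, X.ev_ctr]; rfl

lemma ev_cnn (κ : ℝ) (T : Fin 4 → Fin 4 → R) : ev (X.cnn κ T)
    = κ ^ 2 * (X.eval ev).dot ((X.eval ev).ctr (fun a b => ev (T a b)) (X.W ev)) (X.W ev) := by
  rw [cnn, map_smul, X.ev_dot]
  simp only [ev_cn, MetricAlgebra.dot_mul_left, smul_eq_mul]
  change _ * (_ * (X.eval ev).dot ((X.eval ev).ctr (fun a b => ev (T a b)) (X.W ev)) (X.W ev)) = _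
  ring

lemma ev_pr1_eq (Ni : R) (v : Fin 4 → R) (a : Fin 4) : ev (X.pr1 Ni v a)
    = (X.eval ev).top1 (X.W ev) (ev Ni) (fun a => ev (v a)) a := X.ev_top1 ev _ _ _ _

/-! #### The case `q = 2` -/

/-- For q = 2 the algebraic constraint is t w = 0, and contraction with w gives −λ t = 0. -/
lemma ev_t_two (h0 : ev X.Om = 0) (hl : X.lam ≠ 0) (hq : X.q = 2) : ev X.t = 0 := by
  have h : ∀ a, ev X.t * X.W ev a = 0 := fun a => by
    have h := ev_constraint h0 a
    rw [hq] at h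
    simpa [W] using h
  have h2 := dot_W h0
  have h3 : ev X.t * (X.eval ev).dot (X.W ev) (X.W ev) = 0 := by
    rw [← MetricAlgebra.dot_mul_left]
    simp only [h, MetricAlgebra.dot, zero_mul, MetricAlgebra.tr_zero]
  rw [h2] at h3
  simpa [hl] using h3

lemma ev_bach_two (h0 : ev X.Om = 0) (hl : X.lam ≠ 0) (hq : X.q = 2) (b c : Fin 4) :
    ev (X.bach b c) = -3 * X.lam * ev (X.τ b c)
      + (X.eval ev).dot ((X.eval ev).ctr (fun a b => ev (X.τ a b)) (X.W ev)) (X.W ev)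
        * (X.eval ev).g b c
      + X.W ev b * (-2 * (X.eval ev).ctr (fun a b => ev (X.τ a b)) (X.W ev) c)
      + (-2 * (X.eval ev).ctr (fun a b => ev (X.τ a b)) (X.W ev) b) * X.W ev c := by
  obtain ⟨r, hr⟩ := X.bach_expansion_two hq b c
  have h := congrArg ev hr
  have ht := ev_t_two h0 hl hq
  have hv : ∀ a, ev (X.v₂ a) = 1 / 2 * (X.eval ev).ctr (fun a b => ev (X.τ a b)) (X.W ev) a := by
    intro a
    rw [v₂, map_sub, map_smul, map_smul, map_mul, ht, X.ev_ctr]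
    simp
    rfl
  have hd : ev (X.dot X.w X.v₂)
      = 1 / 2 * (X.eval ev).dot ((X.eval ev).ctr (fun a b => ev (X.τ a b)) (X.W ev)) (X.W ev) := by
    rw [X.dot_comm, X.ev_dot, ← MetricAlgebra.dot_mul_left]
    simp only [hv]
    rfl
  simp only [map_add, map_sub, map_mul, h0, ev_N h0, hv, hd, ev_θ, ht, map_ofNat] at h
  simp only [MetricAlgebra.eval, W] at h ⊢
  linear_combination (1 / 2) * h

lemma ev_prFree_bach_two (h0 : ev X.Om = 0) (hl : X.lam ≠ 0) (hq : X.q = 2) {Ni : R}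
    (hNi : X.N * Ni = 1) (a b : Fin 4) :
    ev (X.prFree Ni (fun a b => X.bach a b + (3 * X.lam) • X.τ a b) a b) = 0 := by
  rw [ev_prFree_decomp hNi (S := fun _ _ => 0)
    (α := (X.eval ev).dot ((X.eval ev).ctr (fun a b => ev (X.τ a b)) (X.W ev)) (X.W ev))
    (z := fun a => -2 * (X.eval ev).ctr (fun a b => ev (X.τ a b)) (X.W ev) a)]
  · have : (X.eval ev).top2 (X.W ev) (ev Ni) (fun _ _ => (0 : ℝ)) = fun _ _ => 0 := by
      funext a b
      simp [MetricAlgebra.top2, MetricAlgebra.top1, MetricAlgebra.dot, MetricAlgebra.tr_zero]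
    rw [this, MetricAlgebra.tr_zero]; ring
  · intro b c
    rw [map_add, map_smul, ev_bach_two h0 hl hq, smul_eq_mul]; ring

lemma ev_ctr_bach_two (h0 : ev X.Om = 0) (hl : X.lam ≠ 0) (hq : X.q = 2) (b : Fin 4) :
    (X.eval ev).ctr (fun a b => ev (X.bach a b)) (X.W ev) b
      = - X.lam * (X.eval ev).ctr (fun a b => ev (X.τ a b)) (X.W ev) b
        - (X.eval ev).dot ((X.eval ev).ctr (fun a b => ev (X.τ a b)) (X.W ev)) (X.W ev)
          * X.W ev b := by
  rw [(X.eval ev).ctr_decomp (fun b c => ev_bach_two h0 hl hq b c) b,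
    MetricAlgebra.dot_mul_left, dot_W h0]
  have : (X.eval ev).ctr (fun b c => -3 * X.lam * ev (X.τ b c)) (X.W ev) b
      = -3 * X.lam * (X.eval ev).ctr (fun b c => ev (X.τ b c)) (X.W ev) b := by
    simp only [MetricAlgebra.ctr, mul_assoc, MetricAlgebra.tr_mul_left]
  rw [this]
  change _ + _ * _ + _ * (_ * (X.eval ev).dot ((X.eval ev).ctr (fun a b => ev (X.τ a b))
    (X.W ev)) (X.W ev)) + _ = _
  ring

lemma ev_cnn_bach_two (h0 : ev X.Om = 0) (hl : X.lam ≠ 0) (hq : X.q = 2) (κ : ℝ) :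
    ev (X.cnn κ X.bach) = 0 := by
  rw [ev_cnn, show (X.eval ev).ctr (fun a b => ev (X.bach a b)) (X.W ev) = _ from
    funext fun b => ev_ctr_bach_two h0 hl hq b, MetricAlgebra.dot_sub_left,
    MetricAlgebra.dot_mul_left, MetricAlgebra.dot_mul_left, dot_W h0]
  change _ * (_ * (X.eval ev).dot ((X.eval ev).ctr (fun a b => ev (X.τ a b))
    (X.W ev)) (X.W ev) - _) = _
  ring

lemma ev_pr1_cn_bach_two (h0 : ev X.Om = 0) (hl : X.lam ≠ 0) (hq : X.q = 2) {Ni : R}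
    (hNi : X.N * Ni = 1) (κ : ℝ) (a : Fin 4) :
    ev (X.pr1 Ni (X.cn κ X.bach) a) = - X.lam * ev (X.pr1 Ni (X.cn κ X.τ) a) := by
  rw [ev_pr1_eq, ev_pr1_eq]
  simp only [ev_cn, ev_ctr_bach_two h0 hl hq, MetricAlgebra.top1_mul]
  have h := (X.eval ev).top1_add (w := X.W ev) (Ni := ev Ni)
    (fun b => - X.lam * (X.eval ev).ctr (fun a b => ev (X.τ a b)) (X.W ev) b)
    (fun b => - (X.eval ev).dot ((X.eval ev).ctr (fun a b => ev (X.τ a b)) (X.W ev)) (X.W ev)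
          * X.W ev b) a
  rw [MetricAlgebra.top1_mul, MetricAlgebra.top1_mul,
    show (X.eval ev).top1 (X.W ev) (ev Ni) (fun b => X.W ev b) a = 0 from
      (X.eval ev).top1_self (ev_dot_W hNi) a] at h
  simp only [neg_mul _ (X.W ev _), ← sub_eq_add_neg] at h
  rw [h]; ring

/-! #### The case `q = 1` -/

lemma ev_ctr_one (h0 : ev X.Om = 0) (hq : X.q = 1) (a : Fin 4) :
    ev (X.ctr X.τ X.w a) = ev X.t * X.W ev a := by
  have h := ev_constraint h0 a
  rw [hq] at h
  push_cast at h
  rw [W]; linarith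

/-- The order Ω⁰ of `bach_expansion_one` is Nτ = t w ⊗ w, and N = −λ on the boundary. -/
lemma ev_τ_one (h0 : ev X.Om = 0) (hq : X.q = 1) {κ : ℝ} (hκ : κ ^ 2 * X.lam = 1)
    (a b : Fin 4) : ev (X.τ a b) = - κ ^ 2 * (ev X.t * (X.W ev a * X.W ev b)) := by
  obtain ⟨r, hr⟩ := X.bach_expansion_one hq a b
  have h := congrArg ev hr
  rw [map_mul, h0, zero_mul] at h
  simp only [map_add, map_sub, map_mul, h0, ev_N h0, map_pow, map_ofNat] at h
  rw [W, W]
  linear_combination (κ ^ 2 / 2) * h - ev (X.τ a b) * hκ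

/-- With q − 2 = −1 the two contractions of w with the divergence of τ in `ev_conservation_tr`
cancel, and a transport equation for t along w remains. -/
lemma ev_t_w_one (h0 : ev X.Om = 0) (hq : X.q = 1) :
    ev (X.dot X.w (X.grad X.t)) = -3 * ev X.ρ * ev X.t := by
  have h := ev_conservation_tr h0
  rw [hq] at h
  push_cast at h
  linear_combination h

lemma ev_dot_grad_N (h0 : ev X.Om = 0) :
    ev (X.dot X.w (X.grad X.N)) = -2 * X.lam * ev X.ρ := by
  have h : ∀ e, ev (X.grad X.N e) = 2 * ev X.ρ * X.W ev e := by
    intro e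
    rw [grad_N, map_mul, map_ofNat, X.ev_ctr]
    simp only [ev_cov1_w h0]
    have := (X.eval ev).tr_g_left' (X.W ev) e
    rw [W] at this ⊢
    rw [mul_assoc, ← this, ← MetricAlgebra.tr_mul_left]
    congr 1
    exact (X.eval ev).tr_congr fun _ _ => by simp only [MetricAlgebra.eval, W]; ring
  rw [X.dot_comm, X.ev_dot]
  simp only [h, MetricAlgebra.dot_mul_left]
  rw [show (X.eval ev).dot (fun a => X.W ev a) (fun a => ev (X.w a)) = _ from dot_W h0]
  ring

/-- The order Ω¹ of `bach_expansion_one`, obtained by differentiating it along w before evaluating: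
the factor Ω contributes N = −λ, and the remainder Ω²r contributes nothing. -/
lemma ev_bach_one (h0 : ev X.Om = 0) (hq : X.q = 1) {κ : ℝ} (hκ : κ ^ 2 * X.lam = 1)
    (b c : Fin 4) : ev (X.bach b c) = 3 * ev (X.dir₂ X.w X.τ b c)
      + ev (X.dot X.w (X.div X.τ)) * (X.eval ev).g b c
      + X.W ev b * (-1 / 3 * ev (X.grad X.t c) - 2 * ev (X.div X.τ c)
        - 7 / 2 * ev X.ρ * κ ^ 2 * ev X.t * X.W ev c)
      + (-1 / 3 * ev (X.grad X.t b) - 2 * ev (X.div X.τ b)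
        - 7 / 2 * ev X.ρ * κ ^ 2 * ev X.t * X.W ev b) * X.W ev c := by
  -- The remainders must form a tensor, so that the expansion can be differentiated covariantly.
  choose r hr using X.bach_expansion_one hq
  have hf := congrArg (fun T => ev (X.dir₂ X.w T b c)) (funext₂ hr)
  beta_reduce at hf
  rw [X.dir₂_mul, X.dir₂_add X.w (fun b c => 2 * (X.N * X.τ b c - X.t * (X.w b * X.w c))),
    X.dir₂_mul X.w 2, X.dir₂_sub X.w (fun b c => X.N * X.τ b c), X.dir₂_mul, X.dir₂_mul,
    X.dir₂_mul, X.dir₂_prod, show X.dot X.w (X.grad X.Om) = X.N from rfl,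
    show X.Om ^ 2 = X.Om * X.Om from sq _, X.dot_grad_mul,
    show X.dot X.w (X.grad X.Om) = X.N from rfl] at hf
  have h2 : X.dot X.w (X.grad 2) = 0 := by
    have : ∀ a, X.grad 2 a = 0 := fun a => by
      have := (X.D a).map_algebraMap 2
      rwa [map_ofNat] at this
    simp only [MetricAlgebra.dot, this, mul_zero, MetricAlgebra.tr_zero]
  have hy : ev (X.dot X.w X.y₁) = 1 / 2 * ev (X.dot X.w (X.div X.τ))
      - 1 / 24 * ev (X.dot X.w (X.grad X.t)) := by
    rw [X.dot_comm, show X.y₁ = fun a => (1 / 2 : ℝ) • X.div X.τ a - (1 / 24 : ℝ) • X.grad X.t a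
      from rfl, X.dot_sub_left, X.dot_smul_left, X.dot_smul_left, X.dot_comm, X.dot_comm _ X.w]
    simp only [map_sub, map_smul, smul_eq_mul]
  have hyy : ∀ a, ev (X.y₁ a) = 1 / 2 * ev (X.div X.τ a) - 1 / 24 * ev (X.grad X.t a) := by
    intro a; rw [y₁]; simp only [map_sub, map_smul, smul_eq_mul]
  have ht := ev_t_w_one h0 hq
  rw [h2, dir_θ, X.dot_comm (X.grad X.t)] at hf
  simp only [map_add, map_sub, map_mul, map_smul, smul_eq_mul, h0, ev_N h0, map_ofNat, map_zero,
    ev_dir₁_w h0, ev_dot_grad_N h0, ev_cov1_w h0, ev_lap_Om h0, ev_θ, hy, hyy, ht,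
    ev_τ_one h0 hq hκ] at hf
  have hg : ev (X.g c b) = ev (X.g b c) := by rw [X.g_symm]
  rw [hg] at hf
  simp only [MetricAlgebra.eval, W] at hf ⊢
  linear_combination (- κ ^ 2 / 2) * hf
    - (ev (X.bach b c) + 1 / 3 * ev (X.w b) * ev (X.grad X.t c)
      + 2 * ev (X.w b) * ev (X.div X.τ c) + 1 / 3 * ev (X.w c) * ev (X.grad X.t b)
      + 2 * ev (X.w c) * ev (X.div X.τ b) - 3 * ev (X.dir₂ X.w X.τ b c)
      - ev (X.dot X.w (X.div X.τ)) * ev (X.g b c)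
      + 6 * κ ^ 2 * ev X.t * ev (X.w b) * ev (X.w c) * ev X.ρ) * hκ

lemma ev_ctr_dir_one (h0 : ev X.Om = 0) (hq : X.q = 1) (a : Fin 4) :
    (X.eval ev).ctr (fun a b => ev (X.dir₂ X.w X.τ a b)) (X.W ev) a
      = - X.lam * ev (X.div X.τ a) - 3 * ev X.ρ * ev X.t * X.W ev a := by
  have h := ev_conservation_dir h0 a
  rw [hq, ev_ctr_one h0 hq, ev_t_w_one h0 hq, X.ev_ctr] at h
  push_cast at h
  change _ + _ * ((X.eval ev).ctr (fun a b => ev (X.dir₂ X.w X.τ a b)) (X.W ev) a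
    + _ * (_ * X.W ev a)) + _ * X.W ev a + _ * (_ * X.W ev a) = 0 at h
  linear_combination -h

/-- Only the class modulo w matters for the tangential projection, so the coefficient β of w is left
unspecified. -/
lemma ev_ctr_bach_one (h0 : ev X.Om = 0) (hq : X.q = 1) {κ : ℝ} (hκ : κ ^ 2 * X.lam = 1) :
    ∃ β : ℝ, ∀ b, (X.eval ev).ctr (fun a b => ev (X.bach a b)) (X.W ev) b
      = X.lam * (1 / 3 * ev (X.grad X.t b) - ev (X.div X.τ b)) + β * X.W ev b := by
  set z : Fin 4 → ℝ := fun c => -1 / 3 * ev (X.grad X.t c) - 2 * ev (X.div X.τ c)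
        - 7 / 2 * ev X.ρ * κ ^ 2 * ev X.t * X.W ev c with hz
  refine ⟨-9 * ev X.ρ * ev X.t + ev (X.dot X.w (X.div X.τ)) + (X.eval ev).dot z (X.W ev)
    + 7 / 2 * ev X.ρ * ev X.t, fun b => ?_⟩
  rw [(X.eval ev).ctr_decomp (fun b c => ev_bach_one h0 hq hκ b c) b, dot_W h0]
  have : (X.eval ev).ctr (fun b c => 3 * ev (X.dir₂ X.w X.τ b c)) (X.W ev) b
      = 3 * (X.eval ev).ctr (fun b c => ev (X.dir₂ X.w X.τ b c)) (X.W ev) b := by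
    simp only [MetricAlgebra.ctr, mul_assoc, MetricAlgebra.tr_mul_left]
  rw [this, ev_ctr_dir_one h0 hq]
  change _ + _ * _ + _ * (X.eval ev).dot z (X.W ev) + z b * _ = _
  rw [hz]
  linear_combination (7 / 2 * ev X.ρ * ev X.t * X.W ev b) * hκ

lemma ev_dot_div_W : (X.eval ev).dot (fun b => ev (X.div X.τ b)) (X.W ev)
    = ev (X.dot X.w (X.div X.τ)) := by
  rw [X.dot_comm, X.ev_dot]; rfl

lemma ev_dot_grad_t_W : (X.eval ev).dot (fun b => ev (X.grad X.t b)) (X.W ev)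
    = ev (X.dot X.w (X.grad X.t)) := by
  rw [X.dot_comm, X.ev_dot]; rfl

/-- For the normal-normal component the coefficient of w in the contraction does matter; it is
computed through the product `hzw`, and everything cancels by `ev_t_w_one`. -/
lemma ev_cnn_bach_one (h0 : ev X.Om = 0) (hq : X.q = 1) {κ : ℝ} (hκ : κ ^ 2 * X.lam = 1) :
    ev (X.cnn κ X.bach) = 0 := by
  set z : Fin 4 → ℝ := fun c => -1 / 3 * ev (X.grad X.t c) - 2 * ev (X.div X.τ c)
        - 7 / 2 * ev X.ρ * κ ^ 2 * ev X.t * X.W ev c with hz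
  have hzw : (X.eval ev).dot z (X.W ev) = ev X.ρ * ev X.t
      - 2 * ev (X.dot X.w (X.div X.τ)) + 7 / 2 * ev X.ρ * ev X.t := by
    rw [hz, MetricAlgebra.dot_sub_left, MetricAlgebra.dot_sub_left, MetricAlgebra.dot_mul_left,
      MetricAlgebra.dot_mul_left, MetricAlgebra.dot_mul_left, ev_dot_div_W, ev_dot_grad_t_W,
      show (X.eval ev).dot (fun a => X.W ev a) (X.W ev) = _ from dot_W h0, ev_t_w_one h0 hq]
    linear_combination (7 / 2 * ev X.ρ * ev X.t) * hκ
  have hB : ∀ b, (X.eval ev).ctr (fun a b => ev (X.bach a b)) (X.W ev) b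
      = X.lam / 3 * ev (X.grad X.t b) + (- X.lam) * ev (X.div X.τ b)
        + (X.lam * 0 - 9 * ev X.ρ * ev X.t + ev (X.dot X.w (X.div X.τ)) + (ev X.ρ * ev X.t
      - 2 * ev (X.dot X.w (X.div X.τ)) + 7 / 2 * ev X.ρ * ev X.t)
          + 7 / 2 * ev X.ρ * ev X.t) * X.W ev b := by
    intro b
    rw [(X.eval ev).ctr_decomp (fun b c => ev_bach_one h0 hq hκ b c) b, dot_W h0]
    have : (X.eval ev).ctr (fun b c => 3 * ev (X.dir₂ X.w X.τ b c)) (X.W ev) b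
        = 3 * (X.eval ev).ctr (fun b c => ev (X.dir₂ X.w X.τ b c)) (X.W ev) b := by
      simp only [MetricAlgebra.ctr, mul_assoc, MetricAlgebra.tr_mul_left]
    rw [this, ev_ctr_dir_one h0 hq]
    change _ + _ * _ + _ * (X.eval ev).dot z (X.W ev) + z b * _ = _
    rw [hzw, hz]
    linear_combination (7 / 2 * ev X.ρ * ev X.t * X.W ev b) * hκ
  rw [ev_cnn, show (X.eval ev).ctr (fun a b => ev (X.bach a b)) (X.W ev) = _ from
    funext fun b => hB b, MetricAlgebra.dot_add_left, MetricAlgebra.dot_add_left,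
    MetricAlgebra.dot_mul_left, MetricAlgebra.dot_mul_left, MetricAlgebra.dot_mul_left,
    ev_dot_div_W, ev_dot_grad_t_W,
    show (X.eval ev).dot (fun a => X.W ev a) (X.W ev) = _ from dot_W h0, ev_t_w_one h0 hq]
  ring

/-- By `pr1_cn_one` the tangential flux is Ω times κ div τ, projected; the derivative falls on Ω,
and κ²N = −1. -/
lemma ev_dn1_pr1_cn_one (h0 : ev X.Om = 0) (hq : X.q = 1) {Ni : R} (hNi : X.N * Ni = 1) {κ : ℝ}
    (hκ : κ ^ 2 * X.lam = 1) (a : Fin 4) :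
    ev (X.dn1 κ (X.pr1 Ni (X.cn κ X.τ)) a) = - ev (X.pr1 Ni (X.div X.τ) a) := by
  rw [show X.pr1 Ni (X.cn κ X.τ) = fun a => X.Om * (κ • X.pr1 Ni (X.div X.τ) a) from
    funext fun a => X.pr1_cn_one hq hNi κ a, dn1, X.dir₁_mul,
    show X.dot X.w (X.grad X.Om) = X.N from rfl]
  simp only [map_smul, map_add, map_mul, h0, ev_N h0, smul_eq_mul]
  linear_combination (- ev (X.pr1 Ni (X.div X.τ) a)) * hκ

lemma ev_pr1_cn_bach (h0 : ev X.Om = 0) (hq : X.q = 1) {Ni : R} (hNi : X.N * Ni = 1) {κ : ℝ}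
    (hκ : κ ^ 2 * X.lam = 1) (a : Fin 4) :
    ev (X.pr1 Ni (X.cn κ X.bach) a) = κ * X.lam * (1 / 3 * ev (X.pr1 Ni (X.grad X.t) a)
      - ev (X.pr1 Ni (X.div X.τ) a)) := by
  obtain ⟨β, hβ⟩ := ev_ctr_bach_one h0 hq hκ
  rw [ev_pr1_eq, ev_pr1_eq, ev_pr1_eq]
  simp only [ev_cn, MetricAlgebra.top1_mul]
  rw [show (X.eval ev).ctr (fun a b => ev (X.bach a b)) (X.W ev) = fun b =>
      (X.lam / 3 * ev (X.grad X.t b) + (- X.lam) * ev (X.div X.τ b)) + β * X.W ev b from by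
    funext b; rw [hβ]; ring]
  rw [MetricAlgebra.top1_add, (X.eval ev).top1_add (fun b => X.lam / 3 * ev (X.grad X.t b)),
    MetricAlgebra.top1_mul, MetricAlgebra.top1_mul, MetricAlgebra.top1_mul,
    show (X.eval ev).top1 (X.W ev) (ev Ni) (fun b => X.W ev b) a = 0 from
      (X.eval ev).top1_self (ev_dot_W hNi) a]
  ring

lemma ev_pr1_cn_bach_one (h0 : ev X.Om = 0) (hq : X.q = 1) {Ni : R} (hNi : X.N * Ni = 1) {κ : ℝ}
    (hκ : κ ^ 2 * X.lam = 1) (a : Fin 4) :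
    ev (X.pr1 Ni (X.cn κ X.bach) a) = κ * X.lam * (ev (X.dn1 κ (X.pr1 Ni (X.cn κ X.τ)) a)
      + 1 / 3 * ev (X.pr1 Ni (X.grad X.t) a)) := by
  rw [ev_pr1_cn_bach h0 hq hNi hκ, ev_dn1_pr1_cn_one h0 hq hNi hκ]; ring

/-- For q = 1, τ is a multiple of w ⊗ w on the boundary. In particular the term with Hτ^⊤ in the
formula for the Bach tensor is zero there. -/
lemma ev_pr2_τ_one (h0 : ev X.Om = 0) (hq : X.q = 1) {Ni : R} (hNi : X.N * Ni = 1) {κ : ℝ}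
    (hκ : κ ^ 2 * X.lam = 1) (a b : Fin 4) : ev (X.pr2 Ni X.τ a b) = 0 := by
  rw [ev_pr2_eq, show (fun a b => ev (X.τ a b)) = fun a b => (- κ ^ 2 * ev X.t) * (X.W ev a
    * X.W ev b) from by funext a b; rw [ev_τ_one h0 hq hκ]; ring, MetricAlgebra.top2_mul,
    (X.eval ev).top2_mul_left (ev_dot_W hNi)]
  ring

lemma dot_ctr_τ_one (h0 : ev X.Om = 0) (hq : X.q = 1) :
    ev (X.dot (X.ctr X.τ X.w) X.w) = - X.lam * ev X.t := by
  rw [X.ev_dot]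
  simp only [ev_ctr_one h0 hq, MetricAlgebra.dot_mul_left]
  rw [show (X.eval ev).dot (fun a => X.W ev a) (fun a => ev (X.w a)) = _ from dot_W h0]
  ring

lemma tr_dir₂ (T : Fin 4 → Fin 4 → R) :
    X.tr (X.dir₂ X.w T) = X.dot X.w (X.grad (X.tr T)) := by
  rw [show X.tr (X.dir₂ X.w T) = X.tr (fun a b => X.tr (fun x y => X.w x * X.cov2 T y a b))
    from rfl, X.tr_comm]
  simp only [MetricAlgebra.tr_mul_left, MetricAlgebra.dot, MetricAlgebra.grad, X.D_tr_cov]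

/-- The trace-free tangential part of the Bach tensor for `q = 1`. -/
lemma ev_prFree_bach_one (h0 : ev X.Om = 0) (hq : X.q = 1) {Ni : R} (hNi : X.N * Ni = 1) {κ : ℝ}
    (hκ : κ ^ 2 * X.lam = 1) (a b : Fin 4) :
    ev (X.prFree Ni X.bach a b) = κ * X.lam / 3 * (9 * ev (X.dn2 κ (X.pr2 Ni X.τ) a b)
      - 3 * ev (X.gbar Ni a b) * ev (X.dn0 κ (X.cnn κ X.τ))
      + 8 * ev (X.H κ Ni) * ev (X.pr2 Ni X.τ a b)
      - ev (X.H κ Ni) * ev (X.gbar Ni a b) * ev (X.cnn κ X.τ)) := by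
  have hcnn : X.cnn κ X.τ = κ ^ 2 • X.dot (X.ctr X.τ X.w) X.w := by
    rw [cnn, show X.cn κ X.τ = fun a => κ • X.ctr X.τ X.w a from rfl, X.dot_smul_left]; algebra
  have hdww : ev (X.dot (X.ctr (X.dir₂ X.w X.τ) X.w) X.w)
      = - X.lam * ev (X.dot X.w (X.div X.τ)) + 3 * ev X.ρ * ev X.t * X.lam := by
    rw [X.ev_dot]
    have : ∀ a, ev (X.ctr (X.dir₂ X.w X.τ) X.w a)
        = - X.lam * ev (X.div X.τ a) - 3 * ev X.ρ * ev X.t * X.W ev a := fun a => by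
      rw [← ev_ctr_dir_one h0 hq, X.ev_ctr]; rfl
    simp only [this, MetricAlgebra.dot_sub_left, MetricAlgebra.dot_mul_left]
    rw [show (X.eval ev).dot (fun a => X.W ev a) (fun a => ev (X.w a)) = _ from dot_W h0,
      show (X.eval ev).dot (fun a => ev (X.div X.τ a)) (fun a => ev (X.w a)) = _
        from ev_dot_div_W]
    ring
  have hdn0 : ev (X.dn0 κ (X.cnn κ X.τ)) = κ ^ 3 * (ev (X.dot (X.ctr (X.dir₂ X.w X.τ) X.w) X.w)
      - 2 * ev X.ρ * X.lam * ev X.t) := by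
    rw [dn0, hcnn]
    have : X.grad (κ ^ 2 • X.dot (X.ctr X.τ X.w) X.w)
        = fun a => κ ^ 2 • X.grad (X.dot (X.ctr X.τ X.w) X.w) a := by
      funext a; simp only [MetricAlgebra.grad, Derivation.map_smul]
    rw [this, X.dot_comm, X.dot_smul_left, X.dot_comm, X.dot_grad_dot]
    have e1 : ev (X.dot (X.dir₁ X.w (X.ctr X.τ X.w)) X.w)
        = ev (X.dot (X.ctr (X.dir₂ X.w X.τ) X.w) X.w) - X.lam * ev X.ρ * ev X.t := by
      rw [show X.dir₁ X.w (X.ctr X.τ X.w) = fun a => X.ctr (X.dir₂ X.w X.τ) X.w a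
        + X.ctr X.τ (X.dir₁ X.w X.w) a from funext fun a => X.dir₁_ctr _ _ _ a, X.dot_add_left,
        map_add]
      have : ev (X.dot (fun a => X.ctr X.τ (X.dir₁ X.w X.w) a) X.w)
          = ev X.ρ * ev (X.dot (X.ctr X.τ X.w) X.w) := by
        have h1 : ∀ a, ev (X.ctr X.τ (X.dir₁ X.w X.w) a) = ev X.ρ * ev (X.ctr X.τ X.w a) := by
          intro a
          rw [X.ev_ctr, X.ev_ctr]
          simp only [ev_dir₁_w h0, MetricAlgebra.ctr, ← MetricAlgebra.tr_mul_left]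
          exact (X.eval ev).tr_congr fun _ _ => by ring
        rw [X.ev_dot, X.ev_dot]
        simp only [h1, MetricAlgebra.dot_mul_left]
      rw [this, dot_ctr_τ_one h0 hq]; ring
    have e2 : ev (X.dot (X.ctr X.τ X.w) (X.dir₁ X.w X.w)) = - X.lam * ev X.ρ * ev X.t := by
      rw [X.dot_comm, X.ev_dot]
      simp only [ev_dir₁_w h0, MetricAlgebra.dot_mul_left]
      rw [← X.ev_dot, X.dot_comm, dot_ctr_τ_one h0 hq]; ring
    simp only [map_smul, map_add, smul_eq_mul, e1, e2]
    ring
  -- Since Ni = −κ², the trace of the projected derivative is ∇_w t plus κ² times the normal-normal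
  -- component; so removing the trace produces the terms in ∇_n τ_nn and H τ_nn.
  have htr : (X.eval ev).tr ((X.eval ev).top2 (X.W ev) (ev Ni) (fun a b => ev (X.dir₂ X.w X.τ a b)))
      = -3 * ev X.ρ * ev X.t + κ ^ 2 * ev (X.dot (X.ctr (X.dir₂ X.w X.τ) X.w) X.w) := by
    rw [(X.eval ev).tr_top2 (ev_dot_W hNi), ← X.ev_tr]
    have e1 : ev (X.tr (fun a b => X.dir₂ X.w X.τ a b)) = -3 * ev X.ρ * ev X.t := by
      rw [← ev_t_w_one h0 hq]; exact congrArg ev (X.tr_dir₂ _)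
    have e2 : (X.eval ev).dot ((X.eval ev).ctr (fun a b => ev (X.dir₂ X.w X.τ a b)) (X.W ev))
        (X.W ev) = ev (X.dot (X.ctr (X.dir₂ X.w X.τ) X.w) X.w) := by
      rw [X.ev_dot]; simp only [X.ev_ctr]; rfl
    rw [e1, e2, ev_Ni_eq h0 hNi hκ]; ring
  rw [ev_prFree_decomp hNi (fun b c => ev_bach_one h0 hq hκ b c),
    show (X.eval ev).top2 (X.W ev) (ev Ni) (fun b c => 3 * ev (X.dir₂ X.w X.τ b c))
      = fun a b => 3 * (X.eval ev).top2 (X.W ev) (ev Ni) (fun b c => ev (X.dir₂ X.w X.τ b c)) a b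
      from funext₂ fun a b => MetricAlgebra.top2_mul _ _ _ _ _ _ _,
    MetricAlgebra.tr_mul_left, ev_dn2_pr2 h0 hNi, ev_pr2_τ_one h0 hq hNi hκ, ev_H h0 hNi,
    ev_gbar, hdn0, hcnn, map_smul, smul_eq_mul, dot_ctr_τ_one h0 hq,
    show (X.eval ev).tr (fun a b => (X.eval ev).top2 (X.W ev) (ev Ni)
      (fun a b => ev (X.dir₂ X.w X.τ a b)) a b) = _ from htr]
  linear_combination (-(3 * (X.eval ev).top2 (X.W ev) (ev Ni)
      (fun b c => ev (X.dir₂ X.w X.τ b c)) a b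
    - κ ^ 2 * ev (X.dot (X.ctr (X.dir₂ X.w X.τ) X.w) X.w)
      * (X.eval ev).top2 (X.W ev) (ev Ni) (X.eval ev).g a b
    + 3 * ev X.ρ * ev X.t * (X.eval ev).top2 (X.W ev) (ev Ni) (X.eval ev).g a b
      * (κ ^ 2 * X.lam + 1))) * hκ

end MatterAlgebra

end

/-! ## Vanishing of the Weyl tensor -/

section

/-! ### Curvature-type tensors in three dimensions -/

lemma eq_zero_of_antisymm_three {f : Fin 3 → Fin 3 → ℝ} (h : ∀ i j, f i j = - f j i)
    (h01 : f 0 1 = 0) (h02 : f 0 2 = 0) (h12 : f 1 2 = 0) (i j : Fin 3) : f i j = 0 := by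
  have h00 := h 0 0
  have h11 := h 1 1
  have h22 := h 2 2
  have h10 := h 1 0
  have h20 := h 2 0
  have h21 := h 2 1
  fin_cases i <;> fin_cases j <;> simp <;> linarith

/-- A curvature-type tensor of a three-dimensional metric with vanishing Ricci contraction
vanishes. -/
lemma curvature_three_eq_zero {γ : Fin 3 → Fin 3 → ℝ} (hγ : ∀ i j, γ i j = γ j i)
    (hdet : (Matrix.of γ).det ≠ 0) {C : Fin 3 → Fin 3 → Fin 3 → Fin 3 → ℝ}
    (hl : ∀ a b c d, C a b c d = - C b a c d) (hr : ∀ a b c d, C a b c d = - C a b d c)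
    (hp : ∀ a b c d, C a b c d = C c d a b)
    (htr : ∀ b d, ∑ i, ∑ j, γ i j * C i b j d = 0) (a b c d : Fin 3) : C a b c d = 0 := by
  have hll : ∀ a c d, C a a c d = 0 := fun a c d => by have := hl a a c d; linarith
  have hrr : ∀ a c d, C c d a a = 0 := fun a c d => by have := hr c d a a; linarith
  rw [Matrix.det_fin_three] at hdet
  simp only [Matrix.of_apply] at hdet
  have r00 := htr 0 0
  have r11 := htr 1 1
  have r22 := htr 2 2
  have r01 := htr 0 1
  have r02 := htr 0 2
  have r12 := htr 1 2
  simp only [Fin.sum_univ_three, hll, hrr, mul_zero, zero_add, add_zero] at r00 r11 r22 r01 r02 r12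
  simp only [hl 1 0, hl 2 0, hl 2 1, fun a b => hr a b 1 0, fun a b => hr a b 2 0,
    fun a b => hr a b 2 1, hp 0 2 0 1, hp 1 2 0 1, hp 1 2 0 2, hγ 1 0, hγ 2 0, hγ 2 1]
    at r00 r11 r22 r01 r02 r12 hdet
  -- In dimension three the curvature is g ∧ (Ric − ¼ R g). Here γ is the inverse metric, so g is
  -- the adjugate of γ divided by its determinant; multiplication by that determinant makes all
  -- coefficients quadratic in γ.
  have c0101 : C 0 1 0 1 = 0 := by
    refine (mul_eq_zero.1 ?_).resolve_left hdet
    linear_combination (1) * ((1/2 * γ 2 2 * γ 0 0 - γ 0 2 * γ 0 2) * r00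
      + (γ 2 2 * γ 0 1 - γ 0 2 * γ 1 2 - γ 1 2 * γ 0 2) * r01
      + (γ 2 2 * γ 0 2 - γ 0 2 * γ 2 2 - γ 2 2 * γ 0 2) * r02
      + (1/2 * γ 2 2 * γ 1 1 - γ 1 2 * γ 1 2) * r11
      + (γ 2 2 * γ 1 2 - γ 1 2 * γ 2 2 - γ 2 2 * γ 1 2) * r12
      + (1/2 * γ 2 2 * γ 2 2 - γ 2 2 * γ 2 2) * r22)
  have c0202 : C 0 2 0 2 = 0 := by
    refine (mul_eq_zero.1 ?_).resolve_left hdet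
    linear_combination (1) * ((1/2 * γ 1 1 * γ 0 0 - γ 0 1 * γ 0 1) * r00
      + (γ 1 1 * γ 0 1 - γ 0 1 * γ 1 1 - γ 1 1 * γ 0 1) * r01
      + (γ 1 1 * γ 0 2 - γ 0 1 * γ 1 2 - γ 1 2 * γ 0 1) * r02
      + (1/2 * γ 1 1 * γ 1 1 - γ 1 1 * γ 1 1) * r11
      + (γ 1 1 * γ 1 2 - γ 1 1 * γ 1 2 - γ 1 2 * γ 1 1) * r12
      + (1/2 * γ 1 1 * γ 2 2 - γ 1 2 * γ 1 2) * r22)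
  have c1212 : C 1 2 1 2 = 0 := by
    refine (mul_eq_zero.1 ?_).resolve_left hdet
    linear_combination (1) * ((1/2 * γ 0 0 * γ 0 0 - γ 0 0 * γ 0 0) * r00
      + (γ 0 0 * γ 0 1 - γ 0 0 * γ 0 1 - γ 0 1 * γ 0 0) * r01
      + (γ 0 0 * γ 0 2 - γ 0 0 * γ 0 2 - γ 0 2 * γ 0 0) * r02
      + (1/2 * γ 0 0 * γ 1 1 - γ 0 1 * γ 0 1) * r11
      + (γ 0 0 * γ 1 2 - γ 0 1 * γ 0 2 - γ 0 2 * γ 0 1) * r12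
      + (1/2 * γ 0 0 * γ 2 2 - γ 0 2 * γ 0 2) * r22)
  have c0102 : C 0 1 0 2 = 0 := by
    refine (mul_eq_zero.1 ?_).resolve_left hdet
    linear_combination (-1) * ((1/2 * γ 1 2 * γ 0 0 - γ 0 1 * γ 0 2) * r00
      + (γ 1 2 * γ 0 1 - γ 0 1 * γ 1 2 - γ 1 1 * γ 0 2) * r01
      + (γ 1 2 * γ 0 2 - γ 0 1 * γ 2 2 - γ 1 2 * γ 0 2) * r02
      + (1/2 * γ 1 2 * γ 1 1 - γ 1 1 * γ 1 2) * r11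
      + (γ 1 2 * γ 1 2 - γ 1 1 * γ 2 2 - γ 1 2 * γ 1 2) * r12
      + (1/2 * γ 1 2 * γ 2 2 - γ 1 2 * γ 2 2) * r22)
  have c0112 : C 0 1 1 2 = 0 := by
    refine (mul_eq_zero.1 ?_).resolve_left hdet
    linear_combination (1) * ((1/2 * γ 0 2 * γ 0 0 - γ 0 0 * γ 0 2) * r00
      + (γ 0 2 * γ 0 1 - γ 0 0 * γ 1 2 - γ 0 1 * γ 0 2) * r01
      + (γ 0 2 * γ 0 2 - γ 0 0 * γ 2 2 - γ 0 2 * γ 0 2) * r02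
      + (1/2 * γ 0 2 * γ 1 1 - γ 0 1 * γ 1 2) * r11
      + (γ 0 2 * γ 1 2 - γ 0 1 * γ 2 2 - γ 0 2 * γ 1 2) * r12
      + (1/2 * γ 0 2 * γ 2 2 - γ 0 2 * γ 2 2) * r22)
  have c0212 : C 0 2 1 2 = 0 := by
    refine (mul_eq_zero.1 ?_).resolve_left hdet
    linear_combination (-1) * ((1/2 * γ 0 1 * γ 0 0 - γ 0 0 * γ 0 1) * r00
      + (γ 0 1 * γ 0 1 - γ 0 0 * γ 1 1 - γ 0 1 * γ 0 1) * r01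
      + (γ 0 1 * γ 0 2 - γ 0 0 * γ 1 2 - γ 0 2 * γ 0 1) * r02
      + (1/2 * γ 0 1 * γ 1 1 - γ 0 1 * γ 1 1) * r11
      + (γ 0 1 * γ 1 2 - γ 0 1 * γ 1 2 - γ 0 2 * γ 1 1) * r12
      + (1/2 * γ 0 1 * γ 2 2 - γ 0 2 * γ 1 2) * r22)
  refine eq_zero_of_antisymm_three (f := fun a b => C a b c d) (fun a b => hl a b c d)
    ?_ ?_ ?_ a b
  · exact eq_zero_of_antisymm_three (fun c d => hr 0 1 c d) c0101 c0102 c0112 c d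
  · exact eq_zero_of_antisymm_three (fun c d => hr 0 2 c d) (by rw [hp, c0102]) c0202 c0212 c d
  · exact eq_zero_of_antisymm_three (fun c d => hr 1 2 c d) (by rw [hp, c0112]) (by rw [hp, c0212])
      c1212 c d

/-! ### The hypersurface `y⁰ = 0` -/

namespace MetricAlgebra

section Hypersurface

variable (G : MetricAlgebra 4 ℝ)

/-- The inverse of the metric induced on the hypersurface `y⁰ = 0`. -/
def tang (i j : Fin 3) : ℝ := G.gi i.succ j.succ - G.gi 0 i.succ * G.gi 0 j.succ / G.gi 0 0

variable {G} (h0 : G.gi 0 0 ≠ 0)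
include h0

/-- The inverse of a diagonal block of g is the Schur complement of `gi 0 0` in the inverse matrix.
-/
lemma tang_mul_g (i k : Fin 3) :
    ∑ j : Fin 3, G.tang i j * G.g j.succ k.succ = if i = k then 1 else 0 := by
  have h1 := G.gi_mul_g i.succ k.succ
  have h2 := G.gi_mul_g 0 k.succ
  rw [Fin.sum_univ_succ] at h1 h2
  have h3 : (0 : Fin 4) ≠ k.succ := (Fin.succ_ne_zero k).symm
  simp only [Fin.succ_inj, if_neg h3] at h1 h2
  have h4 : ∑ j : Fin 3, G.tang i j * G.g j.succ k.succ
      = ∑ j : Fin 3, G.gi i.succ j.succ * G.g j.succ k.succ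
        - G.gi 0 i.succ / G.gi 0 0 * ∑ j : Fin 3, G.gi 0 j.succ * G.g j.succ k.succ := by
    rw [Finset.mul_sum, ← Finset.sum_sub_distrib]
    exact Finset.sum_congr rfl fun j _ => by rw [tang]; ring
  rw [h4, ← h1, eq_neg_of_add_eq_zero_right h2, G.gi_symm i.succ 0]
  field_simp
  ring

/-- The vector `gi 0` is normal to the hypersurface: the trace over tangential indices is the full
trace minus the normal-normal part. -/
lemma sum_tang (F : Fin 4 → Fin 4 → ℝ) : ∑ i : Fin 3, ∑ j : Fin 3, G.tang i j * F i.succ j.succ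
    = G.tr F - (∑ a, ∑ b, G.gi 0 a * G.gi 0 b * F a b) / G.gi 0 0 := by
  simp only [tr, Fin.sum_univ_succ (n := 3), tang, G.gi_symm (Fin.succ _) 0]
  have e : ∀ i j : Fin 3, (G.gi i.succ j.succ - G.gi 0 i.succ * G.gi 0 j.succ / G.gi 0 0)
      * F i.succ j.succ = G.gi i.succ j.succ * F i.succ j.succ
        - (G.gi 0 0)⁻¹ * (G.gi 0 i.succ * G.gi 0 j.succ * F i.succ j.succ) := fun i j => by
    field_simp
  simp only [e, Finset.sum_sub_distrib, ← Finset.mul_sum, Finset.sum_add_distrib]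
  have e1 : ∑ i : Fin 3, G.gi 0 i.succ * G.gi 0 0 * F i.succ 0
      = G.gi 0 0 * ∑ i : Fin 3, G.gi 0 i.succ * F i.succ 0 := by
    rw [Finset.mul_sum]; exact Finset.sum_congr rfl fun _ _ => by ring
  have e2 : ∑ i : Fin 3, G.gi 0 0 * G.gi 0 i.succ * F 0 i.succ
      = G.gi 0 0 * ∑ i : Fin 3, G.gi 0 i.succ * F 0 i.succ := by
    rw [Finset.mul_sum]; exact Finset.sum_congr rfl fun _ _ => by ring
  rw [e1, e2]
  field_simp
  ring

lemma eq_zero_of_sum_gi {f : Fin 4 → ℝ} (h : ∑ d, G.gi 0 d * f d = 0)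
    (hf : ∀ i : Fin 3, f i.succ = 0) (d : Fin 4) : f d = 0 := by
  rw [Fin.sum_univ_succ] at h
  simp only [hf, mul_zero, Finset.sum_const_zero, add_zero] at h
  have := (mul_eq_zero.1 h).resolve_left h0
  exact Fin.cases this hf d

lemma tang_det : (Matrix.of G.tang).det ≠ 0 := by
  have h : Matrix.of G.tang * Matrix.of (fun j k : Fin 3 => G.g j.succ k.succ) = 1 := by
    ext i k
    rw [Matrix.mul_apply, Matrix.one_apply]
    exact G.tang_mul_g h0 i k
  exact left_ne_zero_of_mul_eq_one (by rw [← Matrix.det_mul, h, Matrix.det_one])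

/-- A trace-free curvature-type tensor in dimension four which is annihilated by a non-null vector
vanishes. -/
lemma curvature_four_eq_zero {C : Fin 4 → Fin 4 → Fin 4 → Fin 4 → ℝ}
    (hl : ∀ a b c d, C a b c d = - C b a c d) (hr : ∀ a b c d, C a b c d = - C a b d c)
    (hp : ∀ a b c d, C a b c d = C c d a b) (htr : ∀ b d, G.tr (fun x y => C x b y d) = 0)
    (hw : ∀ a b c, ∑ d, G.gi 0 d * C a b c d = 0) (a b c d : Fin 4) : C a b c d = 0 := by
  have hw3 : ∀ a b d, ∑ c, G.gi 0 c * C a b c d = 0 := fun a b d => by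
    rw [← neg_eq_zero, ← Finset.sum_neg_distrib, ← hw a b d]
    exact Finset.sum_congr rfl fun c _ => by rw [hr]; ring
  have hw2 : ∀ a c d, ∑ b, G.gi 0 b * C a b c d = 0 := fun a c d => by
    rw [← hw c d a]; exact Finset.sum_congr rfl fun b _ => by rw [hp]
  have hw1 : ∀ b c d, ∑ a, G.gi 0 a * C a b c d = 0 := fun b c d => by
    rw [← hw3 c d b]; exact Finset.sum_congr rfl fun b _ => by rw [hp]
  -- The tangential components form a curvature tensor of the induced metric. Its Ricci contraction
  -- equals the vanishing four-dimensional one, since the normal annihilates C.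
  have h3 : ∀ i j k l : Fin 3, C i.succ j.succ k.succ l.succ = 0 := by
    refine curvature_three_eq_zero (γ := G.tang)
      (C := fun i j k l => C i.succ j.succ k.succ l.succ) (fun i j => ?_) (tang_det h0)
      (fun i j k l => hl _ _ _ _) (fun i j k l => hr _ _ _ _) (fun i j k l => hp _ _ _ _)
      (fun j l => ?_)
    · rw [tang, tang, G.gi_symm i.succ]; ring
    · have := G.sum_tang h0 (fun x y => C x j.succ y l.succ)
      rw [this, htr]
      have : ∑ a, ∑ b, G.gi 0 a * G.gi 0 b * C a j.succ b l.succ = 0 := by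
        refine Finset.sum_eq_zero fun a _ => ?_
        simp only [mul_assoc, ← Finset.mul_sum, hw3, mul_zero]
      rw [this]; simp
  refine eq_zero_of_sum_gi h0 (hw1 b c d) (fun i => ?_) a
  refine eq_zero_of_sum_gi h0 (hw2 _ c d) (fun j => ?_) b
  refine eq_zero_of_sum_gi h0 (hw3 _ _ d) (fun k => ?_) c
  exact eq_zero_of_sum_gi h0 (hw _ _ _) (fun l => h3 i j k l) d

end Hypersurface

end MetricAlgebra

namespace MatterAlgebra

variable {R : Type*} [CommRing R] [Algebra ℝ R] {X : MatterAlgebra R} {ev : R →ₐ[ℝ] ℝ}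

/-! #### The Weyl and the Cotton tensor on the boundary for `q ≥ 1` -/

/-- For q ≥ 1, both u and the gradient of f contain a positive power of Ω, so that the right-hand
side of `weyl_w` vanishes on the boundary. -/
lemma ev_weyl_w (h0 : ev X.Om = 0) (hq : X.q ≠ 0) (a b c : Fin 4) :
    ev (X.tr (fun x y => X.weyl a b c x * X.w y)) = 0 := by
  have h := congrArg ev (X.weyl_w a b c)
  have hs : ∀ a b c, ev (X.cov2 X.s a b c) = 0 := by
    intro a b c
    rw [show X.s = fun b c => X.f * X.θ b c from rfl, X.cov2_mul,
      show X.D a X.f = X.grad X.f a from rfl, grad_f]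
    simp [h0, ev_f h0, hq]
  have hu : ∀ a, ev (X.u a) = 0 := by
    intro a
    rw [u_eq]
    simp [h0, hq]
  simpa only [Q, map_add, map_sub, map_mul, h0, hs, hu, zero_mul, add_zero, sub_zero] using h

/-- The boundary lies in the hyperplane `y⁰ = 0`. -/
lemma dot_W_eq (hw : ∀ i : Fin 3, X.W ev i.succ = 0) (v : Fin 4 → ℝ) :
    (X.eval ev).dot v (X.W ev) = X.W ev 0 * ∑ d, (X.eval ev).gi 0 d * v d := by
  simp only [MetricAlgebra.dot, MetricAlgebra.tr]
  rw [Finset.mul_sum]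
  refine Finset.sum_congr rfl fun a _ => ?_
  rw [Fin.sum_univ_succ]
  simp only [hw, mul_zero, Finset.sum_const_zero, add_zero]
  rw [(X.eval ev).gi_symm a 0]; ring

lemma W_zero_ne (h0 : ev X.Om = 0) (hl : X.lam ≠ 0) (hw : ∀ i : Fin 3, X.W ev i.succ = 0) :
    X.W ev 0 ≠ 0 ∧ (X.eval ev).gi 0 0 ≠ 0 := by
  have h := dot_W h0
  rw [dot_W_eq hw, Fin.sum_univ_succ] at h
  simp only [hw, mul_zero, Finset.sum_const_zero, add_zero] at h
  constructor <;> rintro h1 <;> simp [h1] at h <;> exact hl h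

lemma ev_weyl (h0 : ev X.Om = 0) (hl : X.lam ≠ 0) (hq : X.q ≠ 0)
    (hw : ∀ i : Fin 3, X.W ev i.succ = 0) (a b c d : Fin 4) : ev (X.weyl a b c d) = 0 := by
  obtain ⟨hw0, hg0⟩ := W_zero_ne h0 hl hw
  refine MetricAlgebra.curvature_four_eq_zero hg0
    (C := fun a b c d => ev (X.weyl a b c d))
    (fun a b c d => by rw [X.weyl_antisymm_left, map_neg])
    (fun a b c d => by rw [X.weyl_antisymm_right, map_neg])
    (fun a b c d => by rw [X.weyl_pair_symm])
    (fun b d => by rw [← X.ev_tr, X.tr_weyl, map_zero]) (fun a b c => ?_) a b c d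
  have h := ev_weyl_w h0 hq a b c
  rw [show X.tr (fun x y => X.weyl a b c x * X.w y) = X.dot (X.weyl a b c) X.w from rfl, X.ev_dot,
    show (X.eval ev).dot (fun d => ev (X.weyl a b c d)) (fun a => ev (X.w a)) = _
      from dot_W_eq hw _] at h
  exact (mul_eq_zero.1 h).resolve_left hw0

lemma tr_tr_cotton_w (a : Fin 4) :
    X.tr (fun b z => X.tr (fun x y => X.cotton a x b * X.w y) * X.w z) = 0 := by
  have h : X.tr (fun b z => X.tr (fun x y => X.cotton a x b * X.w y) * X.w z)
      = - X.tr (fun b z => X.tr (fun x y => X.cotton a x b * X.w y) * X.w z) := by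
    conv_lhs => simp only [← X.tr_mul_right]
    rw [X.tr_comm, ← X.tr_neg]
    refine X.tr_congr fun b z => ?_
    rw [← neg_mul, ← X.tr_neg, ← X.tr_mul_right]
    exact X.tr_congr fun x y => by rw [X.cotton_antisymm]; ring
  have h2 : (2 : ℝ) • X.tr (fun b z => X.tr (fun x y => X.cotton a x b * X.w y) * X.w z) = 0 := by
    linear_combination (norm := algebra) h
  simpa using h2

/-- Contracting the third index of `weyl_w` with w removes the Weyl term by antisymmetry and leaves
Ω A_xab w^x on the left. The right-hand side is divisible by Ω²: for q = 2 by counting powers, for q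
= 1 because the conservation law makes τ·w parallel to w modulo Ω. -/
lemma cotton_w_eq (hq : X.q = 1 ∨ X.q = 2) (a b : Fin 4) :
    ∃ r, X.tr (fun x y => X.cotton x a b * X.w y) = X.Om * r := by
  have hW : X.tr (fun c z => X.tr (fun x y => X.weyl a b c x * X.w y) * X.w z) = 0 := by
    have h : X.tr (fun c z => X.tr (fun x y => X.weyl a b c x * X.w y) * X.w z)
        = - X.tr (fun c z => X.tr (fun x y => X.weyl a b c x * X.w y) * X.w z) := by
      conv_lhs => simp only [← X.tr_mul_right]
      rw [X.tr_comm, ← X.tr_neg]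
      refine X.tr_congr fun b z => ?_
      rw [← neg_mul, ← X.tr_neg, ← X.tr_mul_right]
      exact X.tr_congr fun x y => by rw [X.weyl_antisymm_right]; ring
    have h2 : (2 : ℝ) • X.tr (fun c z => X.tr (fun x y => X.weyl a b c x * X.w y) * X.w z) = 0 := by
      linear_combination (norm := algebra) h
    simpa using h2
  have h := X.tr_congr fun c z => congrArg (· * X.w z) (X.weyl_w a b c)
  simp only [add_mul, X.tr_add, mul_assoc X.Om, X.tr_mul_left, hW, zero_add] at h
  have hs : ∀ a b c, X.cov2 X.s a b c = ((X.q + 1) / 2 : ℝ) • (X.Om ^ X.q * (X.w a * X.θ b c))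
      + X.f * X.cov2 X.θ a b c := by
    intro a b c
    rw [show X.s = fun b c => X.f * X.θ b c from rfl, X.cov2_mul,
      show X.D a X.f = X.grad X.f a from rfl, grad_f]
    algebra
  have hθ : ∀ b, X.tr (fun c z => X.θ b c * X.w z)
      = X.ctr X.τ X.w b - (1 / 4 : ℝ) • (X.t * X.w b) := by
    intro b
    have : ∀ c z, X.θ b c * X.w z = X.τ b c * X.w z - (1 / 4 : ℝ) • (X.t * (X.g b c * X.w z)) :=
      fun c z => by rw [θ]; algebra
    simp only [this, X.tr_sub, X.tr_smul, X.tr_mul_left, X.tr_g_left']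
    rfl
  have hQ : X.tr (fun c z => X.Q a b c * X.w z) = X.u a * X.w b - X.u b * X.w a
      + ((X.q + 1) / 2 : ℝ) • (X.Om ^ X.q * (X.w a * X.ctr X.τ X.w b - X.w b * X.ctr X.τ X.w a))
      + X.f * (X.ctr (X.cov2 X.θ a) X.w b - X.ctr (X.cov2 X.θ b) X.w a) := by
    have e : ∀ c z, X.Q a b c * X.w z = X.u a * (X.g b c * X.w z) - X.u b * (X.g a c * X.w z)
        + ((X.q + 1) / 2 : ℝ) • (X.Om ^ X.q * (X.w a * (X.θ b c * X.w z)
          - X.w b * (X.θ a c * X.w z)))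
        + X.f * (X.cov2 X.θ a b c * X.w z - X.cov2 X.θ b a c * X.w z) := fun c z => by
      rw [Q, hs, hs]; algebra
    simp only [e, X.tr_add, X.tr_sub, X.tr_smul, X.tr_mul_left, X.tr_g_left', hθ]
    simp only [MetricAlgebra.ctr]
    algebra
  rw [hQ, u_eq, u_eq, f] at h
  have ha := X.conservation a
  have hb := X.conservation b
  rcases hq with hq | hq
  · rw [hq] at h ha hb
    refine ⟨(1/2 : ℝ) • (X.w a * X.div X.τ b - X.w b * X.div X.τ a)
      - (1/24 : ℝ) • (X.grad X.t a * X.w b - X.grad X.t b * X.w a)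
      + (1/2 : ℝ) • (X.ctr (X.cov2 X.θ a) X.w b - X.ctr (X.cov2 X.θ b) X.w a), ?_⟩
    refine sub_eq_zero.1 (X.Om_cancel _ ?_)
    push_cast at h ha hb
    linear_combination (norm := algebra) h + (1/2 : ℝ) • (X.Om * X.w b * ha)
      - (1/2 : ℝ) • (X.Om * X.w a * hb)
  · rw [hq] at h
    refine ⟨(X.w a * X.ctr X.τ X.w b - X.w b * X.ctr X.τ X.w a)
      - (1/24 : ℝ) • (X.Om * (X.grad X.t a * X.w b - X.grad X.t b * X.w a))
      + (1/2 : ℝ) • (X.Om * (X.ctr (X.cov2 X.θ a) X.w b - X.ctr (X.cov2 X.θ b) X.w a)), ?_⟩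
    refine sub_eq_zero.1 (X.Om_cancel _ ?_)
    push_cast at h
    linear_combination (norm := algebra) h

lemma ev_cotton_w (h0 : ev X.Om = 0) (hq : X.q = 1 ∨ X.q = 2) (a b : Fin 4) :
    ev (X.tr (fun x y => X.cotton x a b * X.w y)) = 0 := by
  obtain ⟨r, hr⟩ := X.cotton_w_eq hq a b
  rw [hr, map_mul, h0, zero_mul]

end MatterAlgebra

end

/-! ## The divergence of the Cotton tensor on the boundary -/

section

namespace MetricAlgebra

variable {R : Type*} [CommRing R] [Algebra ℝ R] (G : MetricAlgebra 4 R) (ev : R →ₐ[ℝ] ℝ)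

/-- The Christoffel symbols of the metric induced on the hypersurface `y⁰ = 0`. -/
def bdryChr (c a b : Fin 3) : ℝ := (1 / 2) * ∑ d, (G.eval ev).tang c d
  * (ev (G.D a.succ (G.g d.succ b.succ)) + ev (G.D b.succ (G.g d.succ a.succ))
    - ev (G.D d.succ (G.g a.succ b.succ)))

variable {G ev}

/-- Both connections have the same tangential Christoffel symbols of the first kind. The inverse
metrics that raise the index differ by a multiple of the square of the normal `gi 0`, which
annihilates f. -/
lemma sum_bdryChr (h0 : (G.eval ev).gi 0 0 ≠ 0) {f : Fin 4 → ℝ}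
    (hf : ∑ d, (G.eval ev).gi 0 d * f d = 0) (k i : Fin 3) :
    ∑ l, G.bdryChr ev l k i * f l.succ = ∑ d, ev (G.chr d k.succ i.succ) * f d := by
  set L : Fin 4 → ℝ := fun e => 1 / 2 * (ev (G.D k.succ (G.g e i.succ))
    + ev (G.D i.succ (G.g e k.succ)) - ev (G.D e (G.g k.succ i.succ))) with hL
  have h := sum_tang h0 (fun a b => f a * L b)
  have h1 : ∑ a, ∑ b, (G.eval ev).gi 0 a * (G.eval ev).gi 0 b * (f a * L b) = 0 := by
    have e : ∀ a, ∑ b, (G.eval ev).gi 0 a * (G.eval ev).gi 0 b * (f a * L b)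
        = (G.eval ev).gi 0 a * f a * ∑ b, (G.eval ev).gi 0 b * L b := fun a => by
      rw [Finset.mul_sum]; exact Finset.sum_congr rfl fun b _ => by ring
    simp only [e, ← Finset.sum_mul, hf, zero_mul]
  rw [h1, zero_div, sub_zero] at h
  have h2 : ∀ l, G.bdryChr ev l k i * f l.succ
      = ∑ j, (G.eval ev).tang l j * (f l.succ * L j.succ) := fun l => by
    rw [bdryChr, Finset.mul_sum, Finset.sum_mul]
    exact Finset.sum_congr rfl fun j _ => by rw [hL]; ring
  have h3 : ∀ d, ev (G.chr d k.succ i.succ) * f d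
      = ∑ b, (G.eval ev).gi d b * (f d * L b) := fun d => by
    rw [chr, map_smul, map_sum, smul_eq_mul, Finset.mul_sum, Finset.sum_mul]
    refine Finset.sum_congr rfl fun b _ => ?_
    rw [hL, map_mul, map_sub, map_add]
    simp only [eval]; ring
  simp only [h2, h3]
  exact h

/-- For a tensor annihilated by the conormal in both slots, the divergence on the hypersurface
`y⁰ = 0` is the contraction of the covariant derivative with the induced metric. -/
lemma bdry_div_eq (h0 : (G.eval ev).gi 0 0 ≠ 0) (Y : Fin 4 → Fin 4 → R)
    (hY1 : ∀ j, ∑ d, (G.eval ev).gi 0 d * ev (Y d j) = 0)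
    (hY2 : ∀ i, ∑ d, (G.eval ev).gi 0 d * ev (Y i d) = 0) (i : Fin 3) :
    ∑ j : Fin 3, ∑ k : Fin 3, (G.eval ev).tang j k * (ev (G.D k.succ (Y i.succ j.succ))
      - ∑ l, G.bdryChr ev l k i * ev (Y l.succ j.succ)
      - ∑ l, G.bdryChr ev l k j * ev (Y i.succ l.succ))
    = (G.eval ev).tr (fun j k => ev (G.cov2 Y k i.succ j))
      - (∑ a, ∑ b, (G.eval ev).gi 0 a * (G.eval ev).gi 0 b * ev (G.cov2 Y b i.succ a))
        / (G.eval ev).gi 0 0 := by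
  rw [← sum_tang h0]
  refine Finset.sum_congr rfl fun j _ => Finset.sum_congr rfl fun k _ => ?_
  rw [sum_bdryChr h0 (hY1 j.succ), sum_bdryChr h0 (hY2 i.succ)]
  simp only [cov2, Γ, map_sub, map_sum, map_mul]

end MetricAlgebra

namespace MatterAlgebra

variable {R : Type*} [CommRing R] [Algebra ℝ R] (X : MatterAlgebra R)

/-- The tensor `A_{anb} = A_{acb} n^c`. -/
def cottonN (κ : ℝ) (a b : Fin 4) : R := κ • X.tr (fun x y => X.cotton a x b * X.w y)

variable {X} {ev : R →ₐ[ℝ] ℝ}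

/-- Tangentiality in the first slot is the content of `cotton_w_eq` and holds on the boundary only;
in the second slot it is the antisymmetry of the Cotton tensor and holds identically. -/
lemma ev_cottonN_left (h0 : ev X.Om = 0) (hl : X.lam ≠ 0) (hq : X.q = 1 ∨ X.q = 2)
    (hw : ∀ i : Fin 3, X.W ev i.succ = 0) (κ : ℝ) (j : Fin 4) :
    ∑ d, (X.eval ev).gi 0 d * ev (X.cottonN κ d j) = 0 := by
  have h : ev (X.dot (fun d => X.cottonN κ d j) X.w) = 0 := by
    have e : X.dot (fun d => X.cottonN κ d j) X.w
        = κ • X.tr (fun x y => X.tr (fun d z => X.cotton d x j * X.w z) * X.w y) := by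
      simp only [cottonN, X.dot_smul_left]
      congr 1
      simp only [MetricAlgebra.dot, ← X.tr_mul_right]
      rw [X.tr_comm]
      exact X.tr_congr fun _ _ => X.tr_congr fun _ _ => by ring
    rw [e, map_smul, X.ev_tr]
    simp only [map_mul, ev_cotton_w h0 hq, zero_mul, MetricAlgebra.tr_zero, smul_zero]
  rw [X.ev_dot, show (X.eval ev).dot _ (fun a => ev (X.w a)) = _ from dot_W_eq hw _] at h
  exact (mul_eq_zero.1 h).resolve_left (W_zero_ne h0 hl hw).1

lemma ctr_cottonN (κ : ℝ) (i : Fin 4) : X.ctr (X.cottonN κ) X.w i = 0 := by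
  have h := X.tr_tr_cotton_w i
  simp only [MetricAlgebra.ctr, cottonN, smul_mul_assoc, X.tr_smul, h, smul_zero]

lemma ev_cottonN_right (h0 : ev X.Om = 0) (hl : X.lam ≠ 0)
    (hw : ∀ i : Fin 3, X.W ev i.succ = 0) (κ : ℝ) (i : Fin 4) :
    ∑ d, (X.eval ev).gi 0 d * ev (X.cottonN κ i d) = 0 := by
  have h := congrArg ev (X.ctr_cottonN κ i)
  rw [map_zero, show X.ctr (X.cottonN κ) X.w i = X.dot (X.cottonN κ i) X.w from rfl, X.ev_dot,
    show (X.eval ev).dot (fun d => ev (X.cottonN κ i d)) (fun a => ev (X.w a)) = _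
      from dot_W_eq hw _] at h
  exact (mul_eq_zero.1 h).resolve_left (W_zero_ne h0 hl hw).1

/-- The contraction of the second slot with w vanishes identically and may be differentiated along
w; since ∇_w w = ρ w on the boundary, the normal-normal part of the derivative vanishes. -/
lemma ev_dir_cottonN (h0 : ev X.Om = 0) (hl : X.lam ≠ 0)
    (hw : ∀ i : Fin 3, X.W ev i.succ = 0) (κ : ℝ) (i : Fin 4) :
    ∑ a, ∑ b, (X.eval ev).gi 0 a * (X.eval ev).gi 0 b * ev (X.cov2 (X.cottonN κ) b i a) = 0 := by
  obtain ⟨hw0, hg0⟩ := W_zero_ne h0 hl hw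
  have h := congrArg ev (X.dir₁_ctr X.w (X.cottonN κ) X.w i)
  rw [show X.ctr (X.cottonN κ) X.w = fun _ => 0 from funext fun i => X.ctr_cottonN κ i] at h
  have e0 : X.dir₁ X.w (fun _ => (0 : R)) i = 0 := by
    simp [MetricAlgebra.dir₁, MetricAlgebra.cov1, MetricAlgebra.Γ, MetricAlgebra.tr]
  have e1 : ev (X.ctr (X.cottonN κ) (X.dir₁ X.w X.w) i) = 0 := by
    have : ev (X.ctr (X.cottonN κ) (X.dir₁ X.w X.w) i)
        = ev X.ρ * ev (X.ctr (X.cottonN κ) X.w i) := by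
      rw [X.ev_ctr, X.ev_ctr]
      simp only [ev_dir₁_w h0, MetricAlgebra.ctr, ← MetricAlgebra.tr_mul_left]
      exact (X.eval ev).tr_congr fun _ _ => by ring
    rw [this, ctr_cottonN, map_zero, mul_zero]
  rw [e0, map_add, e1, map_zero, add_zero, show X.ctr (X.dir₂ X.w (X.cottonN κ)) X.w i
    = X.dot (fun a => X.dot X.w (fun b => X.cov2 (X.cottonN κ) b i a)) X.w from rfl, X.ev_dot,
    show (X.eval ev).dot _ (fun a => ev (X.w a)) = _ from dot_W_eq hw _] at h
  have h2 := (mul_eq_zero.1 h.symm).resolve_left hw0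
  have e2 : ∀ a, ev (X.dot X.w (fun b => X.cov2 (X.cottonN κ) b i a))
      = X.W ev 0 * ∑ d, (X.eval ev).gi 0 d * ev (X.cov2 (X.cottonN κ) d i a) := fun a => by
    rw [X.dot_comm, X.ev_dot]
    exact dot_W_eq hw _
  simp only [e2] at h2
  have h3 : X.W ev 0 * ∑ a, ∑ b, (X.eval ev).gi 0 a * (X.eval ev).gi 0 b
      * ev (X.cov2 (X.cottonN κ) b i a) = 0 := by
    rw [← h2, Finset.mul_sum]
    refine Finset.sum_congr rfl fun a _ => ?_
    rw [Finset.mul_sum, Finset.mul_sum, Finset.mul_sum]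
    exact Finset.sum_congr rfl fun b _ => by ring
  exact (mul_eq_zero.1 h3).resolve_left hw0

/-- The term with ∇w = ρ g is a trace of the Cotton tensor over its antisymmetric pair. What remains
is the divergence in the definition of the Bach tensor, whose other term vanishes with the Weyl
tensor. -/
lemma ev_tr_cov2_cottonN (h0 : ev X.Om = 0) (hl : X.lam ≠ 0) (hq : X.q ≠ 0)
    (hw : ∀ i : Fin 3, X.W ev i.succ = 0) (κ : ℝ) (i : Fin 4) :
    (X.eval ev).tr (fun j k => ev (X.cov2 (X.cottonN κ) k i j)) = - ev (X.cn κ X.bach i) := by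
  have e1 : ∀ j k, ev (X.cov2 (X.cottonN κ) k i j)
      = κ * (ev (X.tr (fun x y => X.cov3 X.cotton k i x j * X.w y)) + ev X.ρ
        * ev (X.cotton i k j)) := by
    intro j k
    rw [show X.cottonN κ = fun a b => κ • X.tr (fun x y => X.cotton a x b * X.w y) from rfl,
      X.cov2_smul, X.cov2_tr_mul (fun a b x => X.cotton a x b), X.tr_add, map_smul, map_add,
      smul_eq_mul]
    congr 2
    · congr 1
      exact X.tr_congr fun x y => by simp only [MetricAlgebra.cov3]; ring
    · rw [X.ev_tr, ← (X.eval ev).tr_g_left' (fun x => ev (X.cotton i x j)) k,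
        ← MetricAlgebra.tr_mul_left, ← MetricAlgebra.tr_swap]
      refine (X.eval ev).tr_congr fun x y => ?_
      rw [map_mul, ev_cov1_w h0]
      simp only [MetricAlgebra.eval]; ring
  have e2 : (X.eval ev).tr (fun j k => ev (X.cotton i k j)) = 0 := by
    have : (X.eval ev).tr (fun j k => ev (X.cotton i k j))
        = - (X.eval ev).tr (fun j k => ev (X.cotton i k j)) := by
      conv_lhs => rw [← (X.eval ev).tr_swap]
      rw [← MetricAlgebra.tr_neg]
      exact (X.eval ev).tr_congr fun j k => by rw [X.cotton_antisymm, map_neg]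
    linarith
  have e3 : ∀ x, ev (X.bach i x) = - ev (X.tr (fun c d => X.cov3 X.cotton d i x c)) := by
    intro x
    rw [MetricAlgebra.bach, map_add, map_neg, X.ev_tr ev (fun d e => X.tr _)]
    have : ∀ d e, ev (X.tr (fun c f => X.schouten e f * X.weyl d i c x)) = 0 := fun d e => by
      rw [X.ev_tr]
      simp only [map_mul, ev_weyl h0 hl hq hw, mul_zero, MetricAlgebra.tr_zero]
    simp only [this, MetricAlgebra.tr_zero, add_zero]
  simp only [e1, MetricAlgebra.tr_mul_left, MetricAlgebra.tr_add, e2, mul_zero, add_zero]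
  rw [cn, map_smul, X.ev_ctr, smul_eq_mul, ← X.ev_tr, X.tr_comm, X.ev_tr,
    MetricAlgebra.ctr, ← mul_neg, ← MetricAlgebra.tr_neg]
  congr 1
  refine (X.eval ev).tr_congr fun x y => ?_
  rw [X.tr_mul_right, map_mul, e3]
  ring

/-- The divergence of `A_{anb}` on the hypersurface `y⁰ = 0`. -/
def divCotton (X : MatterAlgebra R) (ev : R →ₐ[ℝ] ℝ) (κ : ℝ) (i : Fin 3) : ℝ :=
  ∑ j : Fin 3, ∑ k : Fin 3, (X.eval ev).tang j k * (ev (X.D k.succ (X.cottonN κ i.succ j.succ))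
    - ∑ l, X.bdryChr ev l k i * ev (X.cottonN κ l.succ j.succ)
    - ∑ l, X.bdryChr ev l k j * ev (X.cottonN κ i.succ l.succ))

/-- By tangentiality the boundary divergence is the full divergence minus a vanishing normal part.
The projection may be inserted because w has no tangential components. -/
lemma divCotton_eq (h0 : ev X.Om = 0) (hl : X.lam ≠ 0) (hq : X.q = 1 ∨ X.q = 2)
    (hw : ∀ i : Fin 3, X.W ev i.succ = 0) (Ni : R) (κ : ℝ) (i : Fin 3) :
    X.divCotton ev κ i = - ev (X.pr1 Ni (X.cn κ X.bach) i.succ) := by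
  have hq0 : X.q ≠ 0 := by rcases hq with hq | hq <;> omega
  rw [divCotton, MetricAlgebra.bdry_div_eq (W_zero_ne h0 hl hw).2 (X.cottonN κ)
    (fun j => ev_cottonN_left h0 hl hq hw κ j) (fun j => ev_cottonN_right h0 hl hw κ j),
    ev_dir_cottonN h0 hl hw, ev_tr_cov2_cottonN h0 hl hq0 hw, ev_pr1_eq, MetricAlgebra.top1, hw]
  ring

lemma divCotton_one (h0 : ev X.Om = 0) (hq : X.q = 1) (hw : ∀ i : Fin 3, X.W ev i.succ = 0)
    {Ni : R} (hNi : X.N * Ni = 1) {κ : ℝ} (hκ : κ ^ 2 * X.lam = 1) (i : Fin 3) :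
    X.divCotton ev κ i = X.lam * ev (κ • X.pr1 Ni (X.div X.τ) i.succ)
      - κ * X.lam / 3 * ev (X.pr1 Ni (X.grad X.t) i.succ) := by
  have hl : X.lam ≠ 0 := by rintro h; simp [h] at hκ
  rw [divCotton_eq h0 hl (Or.inl hq) hw Ni, ev_pr1_cn_bach h0 hq hNi hκ, map_smul, smul_eq_mul]
  ring

lemma divCotton_two (h0 : ev X.Om = 0) (hl : X.lam ≠ 0) (hq : X.q = 2)
    (hw : ∀ i : Fin 3, X.W ev i.succ = 0) {Ni : R} (hNi : X.N * Ni = 1) (κ : ℝ) (i : Fin 3) :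
    X.divCotton ev κ i = X.lam * ev (X.pr1 Ni (X.cn κ X.τ) i.succ) := by
  rw [divCotton_eq h0 hl (Or.inr hq) hw Ni, ev_pr1_cn_bach_two h0 hl hq hNi]
  ring

end MatterAlgebra

end

/-! ## The Einstein equations under a conformal change -/

section

namespace MetricAlgebra

variable {R : Type*} [CommRing R] [Algebra ℝ R]

/-! ### Conformal changes of the metric -/

section Conformal

variable {n : ℕ} {G G' : MetricAlgebra n R} {Om o : R}

/-- The index raised with the inverse metric. -/
def up (G : MetricAlgebra n R) (p : Fin n → R) (a : Fin n) : R := ∑ b, G.gi a b * p b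

lemma sum_up_mul (p v : Fin n → R) : ∑ a, G.up p a * v a = G.dot p v := by
  simp only [up, dot, tr, Finset.sum_mul]
  rw [Finset.sum_comm]
  exact Finset.sum_congr rfl fun a _ => Finset.sum_congr rfl fun b _ => by
    rw [G.gi_symm]; ring

lemma sum_g_mul_up (p : Fin n → R) (c : Fin n) : ∑ a, G.g c a * G.up p a = p c := by
  simp only [up, Finset.mul_sum]
  rw [Finset.sum_comm]
  simp only [← mul_assoc, ← Finset.sum_mul, G.g_mul_gi]
  simp

lemma D_up (p : Fin n → R) (c a : Fin n) :
    G.D c (G.up p a) = ∑ b, G.gi a b * G.cov1 p c b - ∑ d, G.chr a c d * G.up p d := by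
  simp only [up, map_sum, D_mul, D_gi, cov1, Γ, mul_sub, Finset.sum_add_distrib,
    Finset.sum_sub_distrib, Finset.mul_sum, neg_mul, Finset.sum_neg_distrib, add_mul,
    Finset.sum_mul]
  have e1 : ∑ x, ∑ i, G.chr a c i * G.gi i x * p x = ∑ x, ∑ i, G.chr a c x * (G.gi x i * p i) := by
    rw [Finset.sum_comm]
    exact Finset.sum_congr rfl fun _ _ => Finset.sum_congr rfl fun _ _ => by ring
  have e2 : ∑ x, ∑ i, G.chr x c i * G.gi a i * p x = ∑ x, ∑ i, G.gi a x * (G.chr i c x * p i) := by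
    rw [Finset.sum_comm]
    exact Finset.sum_congr rfl fun _ _ => Finset.sum_congr rfl fun _ _ => by ring
  rw [e1, e2]; ring

lemma div_up (p : Fin n → R) : ∑ a, G.D a (G.up p a) + ∑ a, ∑ e, G.chr a a e * G.up p e
    = G.tr (G.cov1 p) := by
  simp only [D_up, Finset.sum_sub_distrib, tr]; ring

/-- The difference of the Christoffel symbols of two conformal metrics. -/
def confDiff (G : MetricAlgebra n R) (p : Fin n → R) (c a b : Fin n) : R :=
  (if c = a then p b else 0) + (if c = b then p a else 0) - G.up p c * G.g a b

lemma sum_confDiff (p : Fin n → R) (F : Fin n → R) (a b : Fin n) :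
    ∑ c, G.confDiff p c a b * F c
      = p b * F a + p a * F b - (∑ c, G.up p c * F c) * G.g a b := by
  simp only [confDiff, sub_mul, add_mul, ite_mul, zero_mul, Finset.sum_sub_distrib,
    Finset.sum_add_distrib, Finset.sum_ite_eq', Finset.mem_univ, if_true, Finset.sum_mul]
  congr 1
  exact Finset.sum_congr rfl fun _ _ => by ring

variable (hD : G'.D = G.D) (hg : ∀ a b, G'.g a b = o ^ 2 * G.g a b) (ho : Om * o = 1)
include hg ho

lemma gi_conf (a b : Fin n) : G'.gi a b = Om ^ 2 * G.gi a b := by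
  have h : ∀ b, ∑ d, G'.gi a d * ∑ c, G'.g d c * (Om ^ 2 * G.gi c b) = G'.gi a b := fun b => by
    have : ∀ d, ∑ c, G'.g d c * (Om ^ 2 * G.gi c b) = if d = b then 1 else 0 := fun d => by
      rw [← G.g_mul_gi d b]
      refine Finset.sum_congr rfl fun c _ => ?_
      rw [hg]
      linear_combination (G.g d c * G.gi c b * (Om * o + 1)) * ho
    simp [this]
  rw [← h]
  simp only [Finset.mul_sum]
  rw [Finset.sum_comm]
  simp only [← mul_assoc, ← Finset.sum_mul, G'.gi_mul_g]
  simp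

lemma tr_conf (F : Fin n → Fin n → R) : G'.tr F = Om ^ 2 * G.tr F := by
  simp only [tr, gi_conf hg ho, Finset.mul_sum, mul_assoc]

include hD

lemma chr_conf (c a b : Fin n) :
    G'.chr c a b = G.chr c a b + G.confDiff (fun a => Om * G.D a o) c a b := by
  have e : ∀ d, G'.gi c d * (G'.D a (G'.g d b) + G'.D b (G'.g d a) - G'.D d (G'.g a b))
      = G.gi c d * (G.D a (G.g d b) + G.D b (G.g d a) - G.D d (G.g a b))
        + 2 * (Om * G.D a o * (G.gi c d * G.g d b) + Om * G.D b o * (G.gi c d * G.g d a)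
          - G.gi c d * (Om * G.D d o) * G.g a b) := by
    intro d
    rw [gi_conf hg ho, hD, hg, hg, hg, D_mul, D_mul, D_mul]
    have : ∀ a, G.D a (o ^ 2) = 2 * o * G.D a o := fun a => by rw [sq, D_mul]; ring
    rw [this, this, this]
    linear_combination (G.gi c d * (G.D a (G.g d b) + G.D b (G.g d a) - G.D d (G.g a b))
      * (Om * o + 1) + 2 * Om * G.gi c d * (G.D a o * G.g d b + G.D b o * G.g d a
        - G.D d o * G.g a b)) * ho
  rw [chr, chr, Finset.sum_congr rfl fun d _ => e d, Finset.sum_add_distrib, ← Finset.mul_sum,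
    Finset.sum_sub_distrib, Finset.sum_add_distrib, ← Finset.mul_sum, ← Finset.mul_sum,
    ← Finset.sum_mul, G.gi_mul_g, G.gi_mul_g, confDiff, up]
  split_ifs <;> algebra

end Conformal

/-! ### The Ricci tensor and the Einstein equations under a conformal change in dimension four -/

section

variable {G G' : MetricAlgebra 4 R} {Om o : R}
 (hD : G'.D = G.D) (hg : ∀ a b, G'.g a b = o ^ 2 * G.g a b) (ho : Om * o = 1)
include hg ho hD

/-- Here p = d log o, and `hs` says that it is closed. Substituting the shifted Christoffel symbols
into the coordinate formula of the Ricci tensor gives linear and quadratic terms in the shift; the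
auxiliary identities contract them one by one. -/
lemma ric_conf_aux (p : Fin 4 → R) (hp : p = fun a => Om * G.D a o)
    (hs : ∀ a b, G.D a (p b) = G.D b (p a)) (b d : Fin 4) :
    G'.ric b d = G.ric b d - 2 * (G.cov1 p b d - p b * p d)
      - (G.tr (G.cov1 p) + 2 * G.dot p p) * G.g b d := by
  have hc : ∀ c a b, G'.chr c a b = G.chr c a b + G.confDiff p c a b := by
    rw [hp]; exact chr_conf hD hg ho
  have hl : ∀ (F : Fin 4 → R) (a b : Fin 4), ∑ c, F c * G.confDiff p c a b
      = p b * F a + p a * F b - (∑ c, G.up p c * F c) * G.g a b := fun F a b => by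
    rw [← sum_confDiff]; exact Finset.sum_congr rfl fun _ _ => mul_comm _ _
  have hS : ∀ d, ∑ a, G.confDiff p a a d = 4 * p d := fun d => by
    have : ∀ a, G.up p a * G.g a d = G.g d a * G.up p a := fun a => by rw [G.g_symm, mul_comm]
    simp only [confDiff, if_true, Finset.sum_sub_distrib, Finset.sum_add_distrib, this,
      sum_g_mul_up]
    simp
  have hb : ∀ a, G.D a (G.g b d) = ∑ x, G.chr x b a * G.g x d + ∑ x, G.chr x a d * G.g b x :=
    fun a => by
      rw [D_g, Γ, Γ]
      simp only [G.chr_symm _ b a]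
  have t1 : ∑ a, G.D a (G.confDiff p a b d) = G.D b (p d) + G.D d (p b)
      - (∑ a, G.D a (G.up p a)) * G.g b d - ∑ a, G.up p a * G.D a (G.g b d) := by
    simp only [confDiff, map_sub, map_add, apply_ite (G.D _), map_zero, D_mul,
      Finset.sum_sub_distrib, Finset.sum_add_distrib, Finset.sum_ite_eq', Finset.mem_univ, if_true,
      Finset.sum_mul]
    ring
  have t3 : ∑ a, ∑ e, G.chr a a e * G.confDiff p e b d
      = p d * (∑ a, G.chr a a b) + p b * (∑ a, G.chr a a d)
        - (∑ a, ∑ e, G.chr a a e * G.up p e) * G.g b d := by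
    simp only [hl, Finset.sum_sub_distrib, Finset.sum_add_distrib, Finset.mul_sum, Finset.sum_mul]
    congr 1
    exact Finset.sum_congr rfl fun _ _ => Finset.sum_congr rfl fun _ _ => by ring
  have t4 : ∀ F : Fin 4 → R, ∑ a, ∑ e, G.confDiff p a a e * F e = 4 * ∑ e, p e * F e := fun F => by
    rw [Finset.sum_comm]
    simp only [← Finset.sum_mul, hS, Finset.mul_sum, mul_assoc]
  have t6 : ∑ a, ∑ e, G.chr a b e * G.confDiff p e a d
      = p d * (∑ a, G.chr a a b) + ∑ a, p a * G.chr a b d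
        - ∑ a, ∑ e, G.up p e * G.chr a b e * G.g a d := by
    simp only [hl, Finset.sum_sub_distrib, Finset.sum_add_distrib, Finset.mul_sum, Finset.sum_mul,
      G.chr_symm _ b]
  have t7 : ∑ a, ∑ e, G.confDiff p a b e * G.chr e a d
      = ∑ e, p e * G.chr e b d + p b * (∑ a, G.chr a a d)
        - ∑ a, ∑ e, G.up p e * G.chr a e d * G.g b a := by
    rw [Finset.sum_comm]
    simp only [sum_confDiff, Finset.sum_sub_distrib, Finset.sum_add_distrib, Finset.mul_sum,
      Finset.sum_mul]
  have h8 : ∀ F : Fin 4 → R, ∑ c, p c * F c = ∑ c, F c * p c := fun F =>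
    Finset.sum_congr rfl fun _ _ => mul_comm _ _
  have h5 : ∑ e, p e * G.confDiff p e b d = 2 * p b * p d - G.dot p p * G.g b d := by
    rw [hl, sum_up_mul]; ring
  have t8 : ∑ a, ∑ e, G.confDiff p a b e * G.confDiff p e a d
      = 6 * p b * p d - 2 * G.dot p p * G.g b d := by
    rw [Finset.sum_comm]
    simp only [sum_confDiff, Finset.sum_sub_distrib, Finset.sum_add_distrib]
    have e1 : ∑ e, p b * G.confDiff p e e d = 4 * p b * p d := by
      rw [← Finset.mul_sum, hS]; ring
    have e2 : ∑ e, (∑ c, G.up p c * G.confDiff p e c d) * G.g b e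
        = G.dot p p * G.g b d := by
      have : ∀ e, (∑ c, G.up p c * G.confDiff p e c d) = p d * G.up p e
          + (if e = d then G.dot p p else 0) - G.up p e * p d := fun e => by
        have h1 : ∀ c, G.up p c * G.confDiff p e c d = (if e = c then G.up p c * p d else 0)
            + (if e = d then G.up p c * p c else 0) - G.up p e * (G.g d c * G.up p c) := fun c => by
          rw [confDiff, G.g_symm c d]; split_ifs <;> ring
        simp only [h1, Finset.sum_sub_distrib, Finset.sum_add_distrib, Finset.sum_ite_eq,
          Finset.mem_univ, if_true, ← Finset.mul_sum, sum_g_mul_up]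
        split_ifs with h
        · rw [sum_up_mul]; ring
        · simp; ring
      simp only [this, sub_mul, add_mul, ite_mul, zero_mul, Finset.sum_sub_distrib,
        Finset.sum_add_distrib, Finset.sum_ite_eq', Finset.mem_univ, if_true]
      have e3 : ∀ e, p d * G.up p e * G.g b e = G.up p e * p d * G.g b e := fun e => by ring
      simp only [e3]; ring
    rw [h5, e1, e2]
    ring
  have hdiv := G.div_up p
  have hcov : G.cov1 p b d = G.D b (p d) - ∑ e, p e * G.chr e b d := by
    rw [cov1, Γ]; congr 1; exact Finset.sum_congr rfl fun _ _ => mul_comm _ _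
  have h9 : ∑ a, G.up p a * G.D a (G.g b d) = ∑ a, ∑ e, G.up p e * G.chr a b e * G.g a d
      + ∑ a, ∑ e, G.up p e * G.chr a e d * G.g b a := by
    simp only [hb, mul_add, Finset.sum_add_distrib, Finset.mul_sum, mul_assoc]
    congr 1 <;> rw [Finset.sum_comm]
  have hcov' : ∑ a, p a * G.chr a b d = ∑ e, p e * G.chr e b d := rfl
  simp only [ric, riemUp, hD, hc, map_add, add_mul, mul_add, Finset.sum_add_distrib,
    Finset.sum_sub_distrib]
  rw [t1, ← map_sum (G.D b) (fun a => G.confDiff p a a d), hS, t3, t4, t4, t6, t7, t8, h5, h9,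
    hcov, ← hdiv, hs d b]
  have h4 : G.D b (4 * p d) = 4 * G.D b (p d) := by
    rw [D_mul]
    have := (G.D b).map_algebraMap 4
    rw [map_ofNat] at this
    rw [this]; ring
  rw [h4]
  ring

/-- The change of the Ricci tensor under a conformal change of the metric. -/
lemma ric_conf (b d : Fin 4) : G'.ric b d = G.ric b d + 2 * (o * G.cov1 (G.grad Om) b d)
    + (o * G.lap Om - 3 * (o ^ 2 * G.dot (G.grad Om) (G.grad Om))) * G.g b d := by
  have hDo : ∀ a, G.D a o = - o ^ 2 * G.D a Om := fun a => by
    have := congrArg (G.D a) ho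
    rw [D_mul, Derivation.map_one_eq_zero] at this
    linear_combination o * this - G.D a o * ho
  set p : Fin 4 → R := fun a => Om * G.D a o with hp
  have hp' : p = fun a => (-o) * G.grad Om a := by
    funext a; rw [hp, grad]; beta_reduce; rw [hDo]; linear_combination (- o * G.D a Om) * ho
  have hcov : ∀ a b, G.cov1 p a b = o ^ 2 * (G.grad Om a * G.grad Om b)
      - o * G.cov1 (G.grad Om) a b := fun a b => by
    have e : G.D a Om = G.grad Om a := rfl
    rw [hp', cov1_mul, map_neg, hDo, e]; ring
  have hs : ∀ a b, G.D a (p b) = G.D b (p a) := fun a b => by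
    have h1 : G.cov1 p a b = G.cov1 p b a := by
      rw [hcov, hcov, cov1_grad_symm]; ring
    rw [cov1, cov1, G.Γ_symm] at h1
    linear_combination h1
  have htr : G.tr (G.cov1 p) = o ^ 2 * G.dot (G.grad Om) (G.grad Om) - o * G.lap Om := by
    rw [show G.cov1 p = fun a b => o ^ 2 * (G.grad Om a * G.grad Om b)
      - o * G.cov1 (G.grad Om) a b from funext₂ hcov, tr_sub, tr_mul_left, tr_mul_left]
    rfl
  have hdot : G.dot p p = o ^ 2 * G.dot (G.grad Om) (G.grad Om) := by
    rw [hp']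
    simp only [dot, ← tr_mul_left]
    exact G.tr_congr fun _ _ => by ring
  rw [ric_conf_aux hD hg ho p rfl hs, hcov, htr, hdot, hp']
  ring

/-- The Einstein equations, written in terms of a conformal metric. -/
lemma einstein_conf {q : ℕ} {Λ : ℝ} {τ : Fin 4 → Fin 4 → R}
    (hE : ∀ a b, G'.ric a b - (1 / 2 : ℝ) • (G'.scal * G'.g a b) + Λ • G'.g a b
      = Om ^ q * τ a b) (a b : Fin 4) :
    Om * G.cov1 (G.grad Om) a b + Om ^ 2 * G.schouten a b
      - (1 / 2 : ℝ) • ((G.dot (G.grad Om) (G.grad Om) + algebraMap ℝ R (Λ / 3)) * G.g a b)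
    = (1 / 2 : ℝ) • (Om ^ (q + 2) * (τ a b - (1 / 3 : ℝ) • (G.tr τ * G.g a b))) := by
  have hs : G'.scal = Om ^ 2 * G.scal + 6 * (Om * G.lap Om)
      - 12 * G.dot (G.grad Om) (G.grad Om) := by
    rw [scal, show G'.ric = fun b d => G.ric b d + 2 * (o * G.cov1 (G.grad Om) b d)
      + (o * G.lap Om - 3 * (o ^ 2 * G.dot (G.grad Om) (G.grad Om))) * G.g b d from
      funext₂ (ric_conf hD hg ho), tr_conf hg ho, tr_add, tr_add, tr_mul_left, tr_mul_left,
      tr_mul_left, tr_g_four]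
    rw [show G.tr (fun a b => G.cov1 (G.grad Om) a b) = G.lap Om from rfl,
      show G.tr (fun a b => G.ric a b) = G.scal from rfl]
    linear_combination (6 * Om * G.lap Om - 12 * G.dot (G.grad Om) (G.grad Om) * (Om * o + 1)) * ho
  have ht : G'.scal = algebraMap ℝ R (4 * Λ) - Om ^ (q + 2) * G.tr τ := by
    have h := G'.tr_congr hE
    rw [tr_add, tr_sub, tr_smul, tr_smul, tr_mul_left, tr_mul_left, tr_g_four,
      show G'.tr (fun a b => G'.ric a b) = G'.scal from rfl, tr_conf hg ho] at h
    rw [show G.tr (fun a b => τ a b) = G.tr τ from rfl] at h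
    linear_combination (norm := algebra) -h
  -- The physical scalar curvature is eliminated by its trace equation `ht`; comparison with `hs`
  -- then eliminates the unphysical one contained in the Schouten tensor.
  have h := hE a b
  rw [ric_conf hD hg ho, ht, hg] at h
  rw [ht] at hs
  rw [schouten]
  linear_combination (norm := algebra) (1 / 2 : ℝ) • (Om ^ 2 * h) + (1 / 12 : ℝ) • (G.g a b * hs)
    - Om * G.cov1 (G.grad Om) a b * ho - (1 / 2 : ℝ) • (Om * G.lap Om * G.g a b * ho)
    + (3 / 2 : ℝ) • (G.dot (G.grad Om) (G.grad Om) * G.g a b * (Om * o + 1) * ho)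
    + ((1 / 4 : ℝ) • (algebraMap ℝ R (4 * Λ) - Om ^ (q + 2) * G.tr τ) - (Λ / 2) • (1 : R))
      * (G.g a b * (Om * o + 1)) * ho

end

end MetricAlgebra

end

/-! ## Algebras of smooth functions on regions -/

section

lemma two_le_infty : (2 : WithTop ℕ∞) ≤ ∞ := by
  exact WithTop.coe_le_coe.2 (le_top : (2 : ℕ∞) ≤ ⊤)

/-- A set on which the calculus of smooth functions with derivatives taken within the set is
well-behaved. -/
structure Region (n : ℕ) where
  /-- the underlying set -/
  carrier : Set (E n)
  uniqueDiffOn : UniqueDiffOn ℝ carrier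
  subset_closure_interior : carrier ⊆ closure (interior carrier)

namespace Region

variable {n : ℕ} (V : Region n)

/-- The extension by zero of a function on a region. -/
def ext (f : V.carrier → ℝ) : E n → ℝ := Function.extend Subtype.val f 0

variable {V} in
lemma ext_apply (f : V.carrier → ℝ) {y : E n} (hy : y ∈ V.carrier) : V.ext f y = f ⟨y, hy⟩ :=
  Subtype.val_injective.extend_apply f 0 ⟨y, hy⟩

/-- The algebra of smooth functions on a region. -/
def Alg : Subalgebra ℝ (V.carrier → ℝ) where
  carrier := {f | ContDiffOn ℝ ∞ (V.ext f) V.carrier}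
  mul_mem' {f h} hf hh := (ContDiffOn.mul hf hh).congr fun y hy => by simp [ext_apply _ hy]
  add_mem' {f h} hf hh := (ContDiffOn.add hf hh).congr fun y hy => by simp [ext_apply _ hy]
  algebraMap_mem' r := (contDiffOn_const (c := r)).congr fun y hy => by
    simp [ext_apply _ hy]

variable {V}

/-- The function on the whole space underlying a smooth function on a region. -/
def fn (f : V.Alg) : E n → ℝ := V.ext f.1

lemma contDiffOn_fn (f : V.Alg) : ContDiffOn ℝ ∞ (fn f) V.carrier := f.2

/-- Evaluation at a point. -/
def ev {y : E n} (hy : y ∈ V.carrier) : V.Alg →ₐ[ℝ] ℝ :=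
  (Pi.evalAlgHom ℝ (fun _ => ℝ) (⟨y, hy⟩ : V.carrier)).comp V.Alg.val

lemma ev_eq_fn {y : E n} (hy : y ∈ V.carrier) (f : V.Alg) : ev hy f = fn f y :=
  (ext_apply f.1 hy).symm

lemma alg_ext {f h : V.Alg} (H : ∀ y (hy : y ∈ V.carrier), ev hy f = ev hy h) : f = h :=
  Subtype.ext (funext fun y => H y.1 y.2)

/-- The element of the algebra defined by a function which is smooth on the region. -/
def of (F : E n → ℝ) (hF : ContDiffOn ℝ ∞ F V.carrier) : V.Alg :=
  ⟨fun y => F y.1, hF.congr fun _ hy => ext_apply _ hy⟩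

@[simp] lemma ev_of {y : E n} (hy : y ∈ V.carrier) (F : E n → ℝ)
    (hF : ContDiffOn ℝ ∞ F V.carrier) : ev hy (of F hF) = F y := rfl

lemma fn_of {y : E n} (hy : y ∈ V.carrier) (F : E n → ℝ)
    (hF : ContDiffOn ℝ ∞ F V.carrier) : fn (of F hF) y = F y := by
  rw [← ev_eq_fn hy, ev_of]

/-- A function vanishing in the interior of the region is zero. -/
lemma alg_ext_interior {f h : V.Alg} (H : ∀ y (hy : y ∈ interior V.carrier),
    ev (interior_subset hy) f = ev (interior_subset hy) h) : f = h := by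
  refine alg_ext fun y hy => ?_
  rw [ev_eq_fn, ev_eq_fn]
  have hc : ∀ f : V.Alg, Filter.Tendsto (fn f) (𝓝[interior V.carrier] y) (𝓝 (fn f y)) := fun f =>
    ((contDiffOn_fn f).continuousOn y hy).mono interior_subset
  have : (𝓝[interior V.carrier] y).NeBot :=
    mem_closure_iff_nhdsWithin_neBot.1 (V.subset_closure_interior hy)
  refine tendsto_nhds_unique (hc f) ((hc h).congr' ?_)
  filter_upwards [self_mem_nhdsWithin] with z hz
  have := H z hz
  rw [ev_eq_fn, ev_eq_fn] at this
  exact this.symm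

lemma isUnit_of_ne_zero {f : V.Alg} (H : ∀ y (hy : y ∈ V.carrier), ev hy f ≠ 0) : IsUnit f := by
  refine IsUnit.of_mul_eq_one (of (fun y => (fn f y)⁻¹) ?_) ?_
  · exact (contDiffOn_fn f).inv fun y hy => by rw [← ev_eq_fn hy]; exact H y hy
  · refine alg_ext fun y hy => ?_
    rw [map_mul, map_one, ev_of, ← ev_eq_fn hy]
    exact mul_inv_cancel₀ (H y hy)

/-- The partial derivatives. -/
def D (a : Fin n) : Derivation ℝ V.Alg V.Alg := Derivation.mk'
  { toFun := fun f => of (fun y => fderivWithin ℝ (fn f) V.carrier y (EuclideanSpace.single a 1))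
      (((contDiffOn_fn f).fderivWithin V.uniqueDiffOn (m := ∞) (by simp)).clm_apply
        contDiffOn_const)
    map_add' := fun f h => alg_ext fun y hy => by
      have hd : ∀ f : V.Alg, DifferentiableWithinAt ℝ (fn f) V.carrier y := fun f =>
        (contDiffOn_fn f).differentiableOn (by simp) y hy
      rw [map_add, ev_of, ev_of, ev_of, fderivWithin_congr (f := fun z => fn f z + fn h z)
        (fun z hz => by simp [← ev_eq_fn hz]) (by simp [← ev_eq_fn hy]),
        fderivWithin_fun_add (V.uniqueDiffOn y hy) (hd f) (hd h)]
      rfl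
    map_smul' := fun r f => alg_ext fun y hy => by
      have hd : DifferentiableWithinAt ℝ (fn f) V.carrier y :=
        (contDiffOn_fn f).differentiableOn (by simp) y hy
      rw [map_smul, ev_of, ev_of, fderivWithin_congr (f := fun z => r • fn f z)
        (fun z hz => by simp [← ev_eq_fn hz]) (by simp [← ev_eq_fn hy]),
        fderivWithin_fun_const_smul (V.uniqueDiffOn y hy) hd]
      rfl }
  fun f h => alg_ext fun y hy => by
    have hd : ∀ f : V.Alg, DifferentiableWithinAt ℝ (fn f) V.carrier y := fun f =>
        (contDiffOn_fn f).differentiableOn (by simp) y hy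
    simp only [LinearMap.coe_mk, AddHom.coe_mk, smul_eq_mul, map_add, map_mul, ev_of]
    rw [fderivWithin_congr (f := fun z => fn f z * fn h z)
        (fun z hz => by simp [← ev_eq_fn hz]) (by simp [← ev_eq_fn hy]),
        fderivWithin_fun_mul (V.uniqueDiffOn y hy) (hd f) (hd h)]
    simp [← ev_eq_fn hy]

lemma ev_D {y : E n} (hy : y ∈ V.carrier) (a : Fin n) (f : V.Alg) : ev hy (D a f)
    = fderivWithin ℝ (fn f) V.carrier y (EuclideanSpace.single a 1) := rfl

/-- Second derivatives within the region are symmetric also at its boundary points, because these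
are limits of interior points. -/
lemma D_comm (a b : Fin n) (f : V.Alg) : D a (D b f) = D b (D a f) := by
  refine alg_ext fun y hy => ?_
  have hf := contDiffOn_fn f
  have hd : DifferentiableWithinAt ℝ (fderivWithin ℝ (fn f) V.carrier) V.carrier y :=
    (hf.fderivWithin V.uniqueDiffOn (m := 1)
      (by rw [one_add_one_eq_two]; exact two_le_infty)).differentiableOn (by simp) y hy
  have h : ∀ a b, ev hy (D a (D b f)) = fderivWithin ℝ (fderivWithin ℝ (fn f) V.carrier) V.carrier y
      (EuclideanSpace.single a 1) (EuclideanSpace.single b 1) := by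
    intro a b
    rw [ev_D, fderivWithin_congr
      (f := fun z => fderivWithin ℝ (fn f) V.carrier z (EuclideanSpace.single b 1))
      (fun z hz => fn_of hz _ _) (fn_of hy _ _),
      fderivWithin_clm_apply (V.uniqueDiffOn y hy) hd (differentiableWithinAt_const _)]
    simp [fderivWithin_const_apply]
  rw [h, h]
  exact (hf y hy).isSymmSndFDerivWithinAt (by simpa using two_le_infty) V.uniqueDiffOn
    (V.subset_closure_interior hy) hy _ _

end Region

end

/-! ## Coordinate tensors as elements of the algebra of smooth functions -/

section

namespace Region

variable {n : ℕ} {V : Region n}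

/-- The function `F` represents the element `f` of the algebra of smooth functions. -/
def Rep (V : Region n) (F : E n → ℝ) (f : V.Alg) : Prop := ∀ y (hy : y ∈ V.carrier), F y = ev hy f

section Rep

variable {F F' : E n → ℝ} {f f' : V.Alg}

lemma rep_of (hF : ContDiffOn ℝ ∞ F V.carrier) : V.Rep F (of F hF) := fun _ _ => rfl

lemma Rep.contDiffOn (h : V.Rep F f) : ContDiffOn ℝ ∞ F V.carrier :=
  (contDiffOn_fn f).congr fun y hy => by rw [h y hy, ev_eq_fn]

lemma Rep.congr (h : V.Rep F f) (h' : ∀ y ∈ V.carrier, F' y = F y) : V.Rep F' f :=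
  fun y hy => (h' y hy).trans (h y hy)

lemma Rep.add (h : V.Rep F f) (h' : V.Rep F' f') : V.Rep (fun y => F y + F' y) (f + f') :=
  fun y hy => by rw [map_add, ← h y hy, ← h' y hy]

lemma Rep.sub (h : V.Rep F f) (h' : V.Rep F' f') : V.Rep (fun y => F y - F' y) (f - f') :=
  fun y hy => by rw [map_sub, ← h y hy, ← h' y hy]

lemma Rep.neg (h : V.Rep F f) : V.Rep (fun y => - F y) (- f) :=
  fun y hy => by rw [map_neg, ← h y hy]

lemma Rep.mul (h : V.Rep F f) (h' : V.Rep F' f') : V.Rep (fun y => F y * F' y) (f * f') :=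
  fun y hy => by rw [map_mul, ← h y hy, ← h' y hy]

lemma Rep.smul (r : ℝ) (h : V.Rep F f) : V.Rep (fun y => r * F y) (r • f) :=
  fun y hy => by rw [map_smul, ← h y hy, smul_eq_mul]

lemma Rep.pow (k : ℕ) (h : V.Rep F f) : V.Rep (fun y => F y ^ k) (f ^ k) :=
  fun y hy => by rw [map_pow, ← h y hy]

lemma Rep.sum {ι : Type*} {s : Finset ι} {F : ι → E n → ℝ} {f : ι → V.Alg}
    (h : ∀ i, V.Rep (F i) (f i)) : V.Rep (fun y => ∑ i ∈ s, F i y) (∑ i ∈ s, f i) :=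
  fun y hy => by rw [map_sum]; exact Finset.sum_congr rfl fun i _ => h i y hy

lemma rep_const (r : ℝ) : V.Rep (fun _ => r) (algebraMap ℝ V.Alg r) := fun y hy => by
  rw [AlgHom.commutes]; rfl

end Rep

/-- A coordinate metric which is smooth and non-degenerate on a region. -/
structure IsRegular (V : Region n) (Y : LocalMetric n) : Prop where
  nhds : ∀ y ∈ V.carrier, 𝓝[Y.dom] y = 𝓝[V.carrier] y
  smooth : ∀ a b, ContDiffOn ℝ ∞ (fun y => Y.g y a b) V.carrier
  symm : ∀ y ∈ V.carrier, ∀ a b, Y.g y a b = Y.g y b a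
  det : ∀ y ∈ V.carrier, (Y.g y).det ≠ 0

namespace IsRegular

variable {Y : LocalMetric n} (h : V.IsRegular Y)

/-- The matrix of the metric over the algebra of smooth functions. -/
def mat : Matrix (Fin n) (Fin n) V.Alg := Matrix.of fun a b => of _ (h.smooth a b)

lemma map_mat {y : E n} (hy : y ∈ V.carrier) : (ev hy : V.Alg →+* ℝ).mapMatrix h.mat = Y.g y := by
  ext a b
  exact ev_of hy _ (h.smooth a b)

lemma isUnit_det : IsUnit h.mat.det := isUnit_of_ne_zero fun y hy => by
  rw [← RingHom.coe_coe, RingHom.map_det, h.map_mat]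
  exact h.det y hy

lemma mat_symm : h.mat.transpose = h.mat := by
  ext1 a b
  exact alg_ext fun y hy => h.symm y hy b a

/-- The metric over the algebra of smooth functions. -/
def metric : MetricAlgebra n V.Alg where
  D := D
  g a b := h.mat a b
  gi a b := (h.mat⁻¹ : Matrix (Fin n) (Fin n) V.Alg) a b
  D_comm := D_comm
  g_symm a b := congrFun (congrFun h.mat_symm b) a
  gi_symm a b := by
    conv_lhs => rw [← h.mat_symm, ← Matrix.transpose_nonsing_inv]
    rfl
  gi_mul_g a b := by
    rw [← Matrix.mul_apply, Matrix.nonsing_inv_mul _ h.isUnit_det, Matrix.one_apply]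

lemma rep_g (a b : Fin n) : V.Rep (fun y => Y.g y a b) (h.metric.g a b) := rep_of (h.smooth a b)

lemma rep_inv (a b : Fin n) : V.Rep (fun y => Y.inv y a b) (h.metric.gi a b) := fun y hy => by
  have h1 := congrArg (ev hy : V.Alg →+* ℝ).mapMatrix (Matrix.nonsing_inv_mul _ h.isUnit_det)
  rw [map_mul, map_one, h.map_mat] at h1
  change (Y.g y)⁻¹ a b = _
  rw [Matrix.inv_eq_left_inv h1]
  rfl

include h

/-- The domain of differentiation and the region agree near each point of the region, so derivatives
within either coincide. The other dictionary lemmas for derivatives build on this one. -/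
lemma rep_pd {F : E n → ℝ} {f : V.Alg} (hF : V.Rep F f) (a : Fin n) :
    V.Rep (Y.pd a F) (D a f) := fun y hy => by
  rw [ev_D, LocalMetric.pd, fderivWithin_congr_set (nhdsWithin_eq_iff_eventuallyEq.1 (h.nhds y hy)),
    fderivWithin_congr (fun z hz => by rw [hF z hz, ev_eq_fn]) (by rw [hF y hy, ev_eq_fn])]

lemma rep_chr (c a b : Fin n) : V.Rep (fun y => Y.chr y c a b) (h.metric.chr c a b) :=
  Rep.smul _ (Rep.sum fun d => (h.rep_inv c d).mul (((h.rep_pd (h.rep_g d b) a).add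
    (h.rep_pd (h.rep_g d a) b)).sub (h.rep_pd (h.rep_g a b) d)))

lemma rep_trace {T : E n → Fin n → Fin n → ℝ} {T' : Fin n → Fin n → V.Alg}
    (hT : ∀ a b, V.Rep (fun y => T y a b) (T' a b)) : V.Rep (Y.trace T) (h.metric.tr T') :=
  Rep.sum fun a => Rep.sum fun b => (h.rep_inv a b).mul (hT a b)

lemma rep_dot {v w : E n → Fin n → ℝ} {v' w' : Fin n → V.Alg}
    (hv : ∀ a, V.Rep (fun y => v y a) (v' a)) (hw : ∀ a, V.Rep (fun y => w y a) (w' a)) :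
    V.Rep (Y.dot v w) (h.metric.dot v' w') := by
  refine Rep.congr (Rep.sum fun a => Rep.sum fun b => (h.rep_inv a b).mul ((hv a).mul (hw b))) ?_
  intro y _
  simp only [LocalMetric.dot, mul_assoc]

lemma rep_cov1 {w : E n → Fin n → ℝ} {w' : Fin n → V.Alg}
    (hw : ∀ a, V.Rep (fun y => w y a) (w' a)) (c a : Fin n) :
    V.Rep (fun y => Y.cov1 w y c a) (h.metric.cov1 w' c a) :=
  (h.rep_pd (hw a) c).sub (Rep.sum fun d => (h.rep_chr d c a).mul (hw d))

lemma rep_cov2 {T : E n → Fin n → Fin n → ℝ} {T' : Fin n → Fin n → V.Alg}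
    (hT : ∀ a b, V.Rep (fun y => T y a b) (T' a b)) (c a b : Fin n) :
    V.Rep (fun y => Y.cov2 T y c a b) (h.metric.cov2 T' c a b) :=
  ((h.rep_pd (hT a b) c).sub (Rep.sum fun d => (h.rep_chr d c a).mul (hT d b))).sub
    (Rep.sum fun d => (h.rep_chr d c b).mul (hT a d))

lemma rep_cov3 {T : E n → Fin n → Fin n → Fin n → ℝ} {T' : Fin n → Fin n → Fin n → V.Alg}
    (hT : ∀ a b c, V.Rep (fun y => T y a b c) (T' a b c)) (d a b c : Fin n) :
    V.Rep (fun y => Y.cov3 T y d a b c) (h.metric.cov3 T' d a b c) :=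
  (((h.rep_pd (hT a b c) d).sub (Rep.sum fun e => (h.rep_chr e d a).mul (hT e b c))).sub
    (Rep.sum fun e => (h.rep_chr e d b).mul (hT a e c))).sub
    (Rep.sum fun e => (h.rep_chr e d c).mul (hT a b e))

lemma rep_riemUp (a b c d : Fin n) :
    V.Rep (fun y => Y.riemUp y a b c d) (h.metric.riemUp a b c d) :=
  ((h.rep_pd (h.rep_chr c b d) a).sub (h.rep_pd (h.rep_chr c a d) b)).add
    (Rep.sum fun e => ((h.rep_chr c a e).mul (h.rep_chr e b d)).sub
      ((h.rep_chr c b e).mul (h.rep_chr e a d)))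

lemma rep_riem (a b c d : Fin n) : V.Rep (fun y => Y.riem y a b c d) (h.metric.riem a b c d) :=
  Rep.sum fun e => (h.rep_g c e).mul (h.rep_riemUp a b e d)

lemma rep_ric (b d : Fin n) : V.Rep (fun y => Y.ric y b d) (h.metric.ric b d) :=
  Rep.sum fun a => h.rep_riemUp a b a d

lemma rep_scal : V.Rep Y.scal h.metric.scal := h.rep_trace h.rep_ric

lemma rep_lap {F : E n → ℝ} {f : V.Alg} (hF : V.Rep F f) :
    V.Rep (Y.lap F) (h.metric.lap f) :=
  h.rep_trace fun a b => h.rep_cov1 (fun c => h.rep_pd hF c) a b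

end IsRegular

namespace IsRegular

variable {V : Region 4} {Y : LocalMetric 4} (h : V.IsRegular Y)

lemma rep_schouten (a b : Fin 4) :
    V.Rep (fun y => Y.schouten y a b) (h.metric.schouten a b) := by
  refine Rep.congr (Rep.smul (1 / 2) ((h.rep_ric a b).sub (Rep.smul (1 / 6)
    (h.rep_scal.mul (h.rep_g a b))))) fun y _ => ?_
  rw [LocalMetric.schouten]
  push_cast
  ring

lemma rep_J : V.Rep Y.J h.metric.J := h.rep_trace h.rep_schouten

lemma rep_weyl (a b c d : Fin 4) : V.Rep (fun y => Y.weyl y a b c d) (h.metric.weyl a b c d) :=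
  (h.rep_riem a b c d).sub (((((h.rep_g c a).mul (h.rep_schouten b d)).sub
    ((h.rep_g c b).mul (h.rep_schouten a d))).add ((h.rep_g d b).mul (h.rep_schouten a c))).sub
    ((h.rep_g d a).mul (h.rep_schouten b c)))

lemma rep_cotton (a b c : Fin 4) : V.Rep (fun y => Y.cotton y a b c) (h.metric.cotton a b c) :=
  (h.rep_cov2 h.rep_schouten b c a).sub (h.rep_cov2 h.rep_schouten c b a)

lemma rep_bach (a b : Fin 4) : V.Rep (fun y => Y.bach y a b) (h.metric.bach a b) := by
  refine Rep.congr ((h.rep_trace fun c d => h.rep_cov3 h.rep_cotton d a b c).neg.add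
    (h.rep_trace (T := fun y d e => Y.trace (fun y c f => Y.schouten y e f * Y.weyl y d a c b) y)
    fun d e => h.rep_trace fun c f => (h.rep_schouten e f).mul (h.rep_weyl d a c b)))
    fun y _ => ?_
  rw [LocalMetric.bach]
  congr 1
  simp only [LocalMetric.trace, Finset.mul_sum, Finset.sum_mul]
  rw [Finset.sum_comm]
  refine Finset.sum_congr rfl fun d _ => ?_
  rw [Finset.sum_comm]
  refine Finset.sum_congr rfl fun e _ => Finset.sum_congr rfl fun c _ =>
    Finset.sum_congr rfl fun f _ => by ring

lemma rep_div2 {T : E 4 → Fin 4 → Fin 4 → ℝ} {T' : Fin 4 → Fin 4 → V.Alg}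
    (hT : ∀ a b, V.Rep (fun y => T y a b) (T' a b)) (a : Fin 4) :
    V.Rep (fun y => Y.div2 T y a) (h.metric.div T' a) := by
  rw [MetricAlgebra.div, ← MetricAlgebra.tr_swap]
  exact h.rep_trace (T := fun y b c => Y.cov2 T y c a b) fun b c => h.rep_cov2 hT c a b

end IsRegular

end Region

end

/-! ## Coordinate fields satisfying the Einstein equations -/

section

/-- The Einstein equations at a point, written in terms of the unphysical fields. -/
def LocalMatter.EinsteinAt (X : LocalMatter) (q : ℕ) (y : E 4) : Prop := ∀ a b,
  X.Ω y * X.cov1 (fun z a => X.pd a X.Ω z) y a b + X.Ω y ^ 2 * X.schouten y a b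
    - (1 / 2) * ((X.dot (fun z a => X.pd a X.Ω z) (fun z a => X.pd a X.Ω z) y + X.lam) * X.g y a b)
  = (1 / 2) * (X.Ω y ^ (q + 2) * (X.τ y a b - (1 / 3) * (X.τtr y * X.g y a b)))

namespace Region

/-- Unphysical fields which are smooth on a region and satisfy the Einstein equations in its
interior, where the defining function is positive. -/
structure IsMatter (V : Region 4) (X : LocalMatter) (q : ℕ) : Prop where
  regular : V.IsRegular X.toLocalMetric
  smooth_Ω : ContDiffOn ℝ ∞ X.Ω V.carrier
  smooth_τ : ∀ a b, ContDiffOn ℝ ∞ (fun y => X.τ y a b) V.carrier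
  lam_pos : 0 < X.lam
  pos : ∀ y ∈ interior V.carrier, 0 < X.Ω y
  einstein : ∀ y ∈ interior V.carrier, X.EinsteinAt q y

section

variable {V : Region 4} {X : LocalMatter} (hr : V.IsRegular X.toLocalMetric)
  {Om : V.Alg} (hΩ : V.Rep X.Ω Om) {τ : Fin 4 → Fin 4 → V.Alg}
  (hτ : ∀ a b, V.Rep (fun y => X.τ y a b) (τ a b)) (q : ℕ)
include hΩ

lemma rep_einstein_left (a b : Fin 4) : V.Rep (fun y =>
    X.Ω y * X.cov1 (fun z a => X.pd a X.Ω z) y a b + X.Ω y ^ 2 * X.schouten y a b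
    - (1 / 2) * ((X.dot (fun z a => X.pd a X.Ω z) (fun z a => X.pd a X.Ω z) y + X.lam) * X.g y a b))
    (Om * hr.metric.cov1 (hr.metric.grad Om) a b + Om ^ 2 * hr.metric.schouten a b
    - (1 / 2 : ℝ) • ((hr.metric.dot (hr.metric.grad Om) (hr.metric.grad Om)
      + algebraMap ℝ V.Alg X.lam) * hr.metric.g a b)) :=
  ((hΩ.mul (hr.rep_cov1 (fun c => hr.rep_pd hΩ c) a b)).add
    ((hΩ.pow 2).mul (hr.rep_schouten a b))).sub (Rep.smul _ (((hr.rep_dot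
    (fun c => hr.rep_pd hΩ c) (fun c => hr.rep_pd hΩ c)).add (rep_const _)).mul (hr.rep_g a b)))

include hτ

lemma rep_einstein_right (a b : Fin 4) : V.Rep (fun y =>
    (1 / 2) * (X.Ω y ^ (q + 2) * (X.τ y a b - (1 / 3) * (X.τtr y * X.g y a b))))
    ((1 / 2 : ℝ) • (Om ^ (q + 2) * (τ a b - (1 / 3 : ℝ) • (hr.metric.tr τ
      * hr.metric.g a b)))) :=
  Rep.smul _ ((hΩ.pow _).mul ((hτ a b).sub (Rep.smul _ ((hr.rep_trace hτ).mul (hr.rep_g a b)))))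

include hr in
/-- The Einstein equations for the physical metric imply those for the unphysical fields. -/
lemma einsteinAt_of_conformal {Y : LocalMetric 4} (hY : V.IsRegular Y)
    (hpos : ∀ y ∈ V.carrier, 0 < X.Ω y)
    (hg : ∀ y ∈ V.carrier, ∀ a b, Y.g y a b = (X.Ω y)⁻¹ ^ 2 * X.g y a b)
    (hE : ∀ y ∈ V.carrier, ∀ a b, Y.ric y a b - (1 / 2) * Y.scal y * Y.g y a b
      + (3 * X.lam) * Y.g y a b = X.Ω y ^ q * X.τ y a b)
    {y : E 4} (hy : y ∈ V.carrier) : X.EinsteinAt q y := by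
  intro a b
  have ho : ContDiffOn ℝ ∞ (fun y => (X.Ω y)⁻¹) V.carrier :=
    hΩ.contDiffOn.inv fun y hy => (hpos y hy).ne'
  have h := MetricAlgebra.einstein_conf (G := hr.metric) (G' := hY.metric) (Om := Om)
    (o := of _ ho) rfl (fun a b => alg_ext fun y hy => by
      rw [map_mul, map_pow, ← hY.rep_g a b y hy, ← hr.rep_g a b y hy, ev_of]
      exact hg y hy a b)
    (alg_ext fun y hy => by
      rw [map_mul, map_one, ev_of, ← hΩ y hy]; exact mul_inv_cancel₀ (hpos y hy).ne')
    (q := q) (Λ := 3 * X.lam) (τ := τ) (fun a b => alg_ext fun y hy => by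
      have := hE y hy a b
      simp only [map_add, map_sub, map_smul, map_mul, map_pow, smul_eq_mul]
      rw [← hY.rep_g a b y hy, ← hY.rep_ric a b y hy, ← hY.rep_scal y hy, ← hΩ y hy,
        ← hτ a b y hy, ← this]
      ring) a b
  rw [show 3 * X.lam / 3 = X.lam by ring] at h
  have h2 := congrArg (ev hy) h
  rw [← rep_einstein_left hr hΩ a b y hy, ← rep_einstein_right hr hΩ hτ q a b y hy] at h2
  exact h2

end

namespace IsMatter

variable {V : Region 4} {X : LocalMatter} {q : ℕ} (h : V.IsMatter X q)

/-- The equation is given in the interior only; both sides are smooth up to the boundary, so density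
extends it. -/
lemma einstein_alg (a b : Fin 4) :
    of X.Ω h.smooth_Ω * h.regular.metric.cov1 (h.regular.metric.grad (of X.Ω h.smooth_Ω)) a b
      + of X.Ω h.smooth_Ω ^ 2 * h.regular.metric.schouten a b
    - (1 / 2 : ℝ) • ((h.regular.metric.dot (h.regular.metric.grad (of X.Ω h.smooth_Ω))
      (h.regular.metric.grad (of X.Ω h.smooth_Ω))
      + algebraMap ℝ V.Alg X.lam) * h.regular.metric.g a b)
    = (1 / 2 : ℝ) • (of X.Ω h.smooth_Ω ^ (q + 2) * (of (fun y => X.τ y a b) (h.smooth_τ a b)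
      - (1 / 3 : ℝ) • (h.regular.metric.tr (fun a b => of (fun y => X.τ y a b) (h.smooth_τ a b))
        * h.regular.metric.g a b))) := by
  have h1 := rep_einstein_left h.regular (rep_of h.smooth_Ω) a b
  have h2 := rep_einstein_right h.regular (rep_of h.smooth_Ω)
    (τ := fun a b => of (fun y => X.τ y a b) (h.smooth_τ a b))
    (fun a b => rep_of (h.smooth_τ a b)) q a b
  refine alg_ext_interior fun y hy => ?_
  have h3 := h.einstein y hy a b
  rw [← h1 y (interior_subset hy), ← h2 y (interior_subset hy)]
  exact h3

/-- The zeros of Ω avoid the dense interior, where f must therefore vanish. -/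
lemma Om_cancel_alg (f : V.Alg) (hf : of X.Ω h.smooth_Ω * f = 0) : f = 0 :=
  alg_ext_interior fun y hy => by
    have := congrArg (ev (interior_subset hy)) hf
    rw [map_mul, map_zero, ev_of] at this
    rw [map_zero]
    exact (mul_eq_zero.1 this).resolve_left (h.pos y hy).ne'

/-- The unphysical fields over the algebra of smooth functions. -/
def matter : MatterAlgebra V.Alg :=
  .mk h.regular.metric (of X.Ω h.smooth_Ω) (fun a b => of (fun y => X.τ y a b) (h.smooth_τ a b))
    X.lam q h.Om_cancel_alg h.einstein_alg

/-- The normalization factor of the normal. -/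
def κ (_ : V.IsMatter X q) : ℝ := (√X.lam)⁻¹

lemma κ_sq : h.κ ^ 2 * h.matter.lam = 1 := by
  have := h.lam_pos
  change (√X.lam)⁻¹ ^ 2 * X.lam = 1
  rw [inv_pow, Real.sq_sqrt this.le]
  exact inv_mul_cancel₀ this.ne'

lemma κ_mul_lam : h.κ * X.lam = √X.lam := by
  change (√X.lam)⁻¹ * X.lam = _
  have := Real.sqrt_pos.2 h.lam_pos
  field_simp
  exact (Real.sq_sqrt h.lam_pos.le).symm

lemma rep_Ω : V.Rep X.Ω h.matter.Om := rep_of h.smooth_Ω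

lemma rep_τ (a b : Fin 4) : V.Rep (fun y => X.τ y a b) (h.matter.τ a b) :=
  rep_of (h.smooth_τ a b)

lemma rep_t : V.Rep X.τtr h.matter.t := h.regular.rep_trace h.rep_τ

lemma rep_w (a : Fin 4) : V.Rep (X.pd a X.Ω) (h.matter.w a) := h.regular.rep_pd h.rep_Ω a

lemma rep_nrm (a : Fin 4) : V.Rep (fun y => X.nrm y a) (h.matter.nrm h.κ a) :=
  Rep.congr (Rep.smul h.κ (h.rep_w a)) fun y _ => by
    rw [LocalMatter.nrm, div_eq_mul_inv, mul_comm]; rfl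

lemma rep_sum_nUp {F : E 4 → Fin 4 → ℝ} {f : Fin 4 → V.Alg}
    (hF : ∀ c, V.Rep (fun y => F y c) (f c)) :
    V.Rep (fun y => ∑ c, X.nUp y c * F y c) (h.κ • h.matter.dot f h.matter.w) := by
  have e : h.κ • h.matter.dot f h.matter.w = h.matter.dot f (h.matter.nrm h.κ) := by
    rw [h.matter.dot_comm, ← h.matter.dot_smul_left, h.matter.dot_comm]; rfl
  rw [e]
  refine Rep.congr (h.regular.rep_dot hF h.rep_nrm) fun y _ => ?_
  simp only [LocalMatter.nUp, LocalMetric.dot, Finset.sum_mul]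
  exact Finset.sum_congr rfl fun a _ => Finset.sum_congr rfl fun b _ => by ring

lemma rep_nn : V.Rep X.nn (h.κ ^ 2 • h.matter.N) := by
  have e : h.κ ^ 2 • h.matter.N = h.matter.dot (h.matter.nrm h.κ) (h.matter.nrm h.κ) := by
    rw [show h.matter.nrm h.κ = fun a => h.κ • h.matter.w a from rfl, h.matter.dot_smul_left,
      h.matter.dot_comm, h.matter.dot_smul_left, smul_smul, sq]
    rfl
  rw [e]
  exact h.regular.rep_dot h.rep_nrm h.rep_nrm

lemma rep_ctr {T : E 4 → Fin 4 → Fin 4 → ℝ} {T' : Fin 4 → Fin 4 → V.Alg}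
    (hT : ∀ a b, V.Rep (fun y => T y a b) (T' a b)) (a : Fin 4) :
    V.Rep (fun y => X.ctr T y a) (h.matter.cn h.κ T' a) :=
  Rep.congr (h.rep_sum_nUp (F := fun y b => T y a b) (hT a)) fun _ _ =>
    Finset.sum_congr rfl fun _ _ => mul_comm _ _

lemma rep_ctr2 {T : E 4 → Fin 4 → Fin 4 → ℝ} {T' : Fin 4 → Fin 4 → V.Alg}
    (hT : ∀ a b, V.Rep (fun y => T y a b) (T' a b)) :
    V.Rep (X.ctr2 T) (h.matter.cnn h.κ T') :=
  Rep.congr (h.rep_sum_nUp (h.rep_ctr hT)) fun _ _ =>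
    Finset.sum_congr rfl fun _ _ => mul_comm _ _

lemma rep_dn0 {F : E 4 → ℝ} {f : V.Alg} (hF : V.Rep F f) :
    V.Rep (X.dn0 F) (h.matter.dn0 h.κ f) := by
  rw [MatterAlgebra.dn0, h.matter.dot_comm]
  exact h.rep_sum_nUp (F := fun y c => X.pd c F y) fun c => h.regular.rep_pd hF c

lemma rep_dn1 {v : E 4 → Fin 4 → ℝ} {v' : Fin 4 → V.Alg}
    (hv : ∀ a, V.Rep (fun y => v y a) (v' a)) (a : Fin 4) :
    V.Rep (fun y => X.dn1 v y a) (h.matter.dn1 h.κ v' a) := by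
  rw [MatterAlgebra.dn1, show h.matter.dir₁ h.matter.w v' a
    = h.matter.dot h.matter.w (fun c => h.matter.cov1 v' c a) from rfl, h.matter.dot_comm]
  exact h.rep_sum_nUp (F := fun y c => X.cov1 v y c a) fun c => h.regular.rep_cov1 hv c a

lemma rep_dn2 {T : E 4 → Fin 4 → Fin 4 → ℝ} {T' : Fin 4 → Fin 4 → V.Alg}
    (hT : ∀ a b, V.Rep (fun y => T y a b) (T' a b)) (a b : Fin 4) :
    V.Rep (fun y => X.dn2 T y a b) (h.matter.dn2 h.κ T' a b) := by
  rw [MatterAlgebra.dn2, show h.matter.dir₂ h.matter.w T' a b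
    = h.matter.dot h.matter.w (fun c => h.matter.cov2 T' c a b) from rfl, h.matter.dot_comm]
  exact h.rep_sum_nUp (F := fun y c => X.cov2 T y c a b) fun c => h.regular.rep_cov2 hT c a b

lemma rep_constr (a : Fin 4) :
    V.Rep (fun y => X.constr q y a) (h.matter.constr h.κ a) :=
  (Rep.smul _ (h.rep_ctr h.rep_τ a)).add ((h.rep_nrm a).mul h.rep_t)

lemma rep_weylE (a b : Fin 4) : V.Rep (fun y => X.weylE y a b) (h.matter.weylE h.κ a b) := by
  have e : h.matter.weylE h.κ a b = h.κ • h.matter.dot (fun c => h.κ • h.matter.dot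
      (fun d => h.matter.weyl c a d b) h.matter.w) h.matter.w := by
    rw [h.matter.dot_smul_left, smul_smul, ← sq, MatterAlgebra.weylE]
    congr 1
    refine h.matter.tr_congr fun c x => ?_
    change _ = h.matter.tr (fun d y => h.matter.weyl c a d b * h.matter.w y) * h.matter.w x
    rw [← h.matter.tr_mul_right]
    exact h.matter.tr_congr fun d y => by ring
  rw [e]
  refine Rep.congr (h.rep_sum_nUp (F := fun y c => ∑ d, X.nUp y d * X.weyl y c a d b) fun c =>
    h.rep_sum_nUp (F := fun y d => X.weyl y c a d b) fun d => h.regular.rep_weyl c a d b)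
    fun y _ => ?_
  simp only [LocalMatter.weylE, Finset.mul_sum]
  exact Finset.sum_congr rfl fun _ _ => Finset.sum_congr rfl fun _ _ => by ring

section Projection

variable {Ni : V.Alg} (hNi : h.matter.N * Ni = 1)
include hNi

lemma rep_top1 {v : E 4 → Fin 4 → ℝ} {v' : Fin 4 → V.Alg}
    (hv : ∀ a, V.Rep (fun y => v y a) (v' a)) (a : Fin 4) :
    V.Rep (fun y => X.top1 v y a) (h.matter.pr1 Ni v' a) := by
  intro y hy
  have hn : ev hy h.matter.N * ev hy Ni = 1 := by rw [← map_mul, hNi, map_one]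
  have h1 := h.rep_sum_nUp hv y hy
  have h2 := h.rep_nrm a y hy
  have h3 := h.rep_nn y hy
  have hκ : h.κ ≠ 0 := fun h0 => by have := h.κ_sq; rw [h0] at this; simp at this
  have hN : ev hy h.matter.N ≠ 0 := left_ne_zero_of_mul_eq_one hn
  rw [MatterAlgebra.nrm, map_smul, smul_eq_mul] at h2
  rw [map_smul, smul_eq_mul] at h1 h3
  have e : X.top1 v y a = v y a - X.nrm y a / X.nn y * ∑ c, X.nUp y c * v y c := by
    simp only [LocalMatter.top1, LocalMatter.proj, sub_mul, ite_mul, one_mul, zero_mul,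
      Finset.sum_sub_distrib, Finset.sum_ite_eq, Finset.mem_univ, if_true, Finset.mul_sum]
    congr 1
    exact Finset.sum_congr rfl fun _ _ => by ring
  beta_reduce at h1 h2 h3 ⊢
  rw [e, h1, h2, h3, MatterAlgebra.pr1, MetricAlgebra.top1, map_sub, map_mul, map_mul,
    ← hv a y hy, eq_inv_of_mul_eq_one_right hn]
  field_simp

lemma rep_top2 {T : E 4 → Fin 4 → Fin 4 → ℝ} {T' : Fin 4 → Fin 4 → V.Alg}
    (hT : ∀ a b, V.Rep (fun y => T y a b) (T' a b)) (a b : Fin 4) :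
    V.Rep (fun y => X.top2 T y a b) (h.matter.pr2 Ni T' a b) := by
  refine Rep.congr (h.rep_top1 hNi (v := fun y d => X.top1 (fun y c => T y c d) y a)
    (fun d => h.rep_top1 hNi (fun c => hT c d) a) b) fun y _ => ?_
  simp only [LocalMatter.top2, LocalMatter.top1, Finset.mul_sum]
  rw [Finset.sum_comm]
  exact Finset.sum_congr rfl fun _ _ => Finset.sum_congr rfl fun _ _ => by ring

lemma rep_gbar (a b : Fin 4) : V.Rep (fun y => X.gbar y a b) (h.matter.gbar Ni a b) :=
  h.rep_top2 hNi h.regular.rep_g a b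

lemma rep_topFree {T : E 4 → Fin 4 → Fin 4 → ℝ} {T' : Fin 4 → Fin 4 → V.Alg}
    (hT : ∀ a b, V.Rep (fun y => T y a b) (T' a b)) (a b : Fin 4) :
    V.Rep (fun y => X.topFree T y a b) (h.matter.prFree Ni T' a b) := by
  refine Rep.congr ((h.rep_top2 hNi hT a b).sub (Rep.smul (1 / 3)
    ((h.regular.rep_trace (h.rep_top2 hNi hT)).mul (h.rep_gbar hNi a b)))) fun y _ => ?_
  rw [LocalMatter.topFree, mul_assoc]

lemma rep_K (a b : Fin 4) : V.Rep (fun y => X.K y a b) (h.matter.K h.κ Ni a b) :=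
  h.rep_top2 hNi (h.regular.rep_cov1 h.rep_nrm) a b

lemma rep_H : V.Rep X.H (h.matter.H h.κ Ni) := h.regular.rep_trace (h.rep_K hNi)

end Projection

end IsMatter

end Region

end

/-! ## The induced geometry of the coordinate hyperplane -/

section

namespace LocalMatter

/-- The inclusion of the boundary hyperplane as a linear map. -/
def inclL : E 3 →L[ℝ] E 4 := LinearMap.toContinuousLinearMap
  { toFun := incl
    map_add' := fun y z => by
      ext a
      refine Fin.cases ?_ (fun i => ?_) a <;> simp [incl]
    map_smul' := fun r z => by
      ext a
      refine Fin.cases ?_ (fun i => ?_) a <;> simp [incl] }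

lemma incl_zero (z : E 3) : incl z 0 = 0 := rfl

lemma inclL_single (k : Fin 3) :
    inclL (EuclideanSpace.single k 1) = EuclideanSpace.single k.succ 1 := by
  ext a
  refine Fin.cases ?_ (fun i => ?_) a
  · exact (incl_zero _).trans (by simp [(Fin.succ_ne_zero k).symm])
  · change (EuclideanSpace.single k (1 : ℝ) : E 3) i = _
    simp

lemma incl_tail {x : E 4} (h0 : x 0 = 0) : incl (tail x) = x := by
  ext a
  refine Fin.cases ?_ (fun i => ?_) a
  · rw [h0]; rfl
  · rfl

end LocalMatter

open LocalMatter

namespace Region.IsMatter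

variable {V : Region 4} {X : LocalMatter} {q : ℕ} (h : V.IsMatter X q)
  (hdom : X.dom = {y : E 4 | 0 ≤ y 0}) {x : E 4} (hx : x ∈ V.carrier)

include h in
lemma pos_lam : X.lam ≠ 0 := h.lam_pos.ne'

lemma rep_cottonN (a b : Fin 4) :
    V.Rep (fun y => ∑ c, X.cotton y a c b * X.nUp y c) (h.matter.cottonN h.κ a b) :=
  Rep.congr (h.rep_sum_nUp (F := fun y c => X.cotton y a c b) fun c => h.regular.rep_cotton a c b)
    fun _ _ => Finset.sum_congr rfl fun _ _ => mul_comm _ _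

include h hx in
lemma mem_nhdsWithin_dom : V.carrier ∈ 𝓝[X.dom] x := by
  rw [h.regular.nhds x hx]; exact self_mem_nhdsWithin

section Boundary

include hdom hx

variable (hx0 : x 0 = 0)
include hx0

include h in
lemma eventually_incl_mem : ∀ᶠ z in 𝓝 (tail x), incl z ∈ V.carrier := by
  have h1 : Filter.Tendsto inclL (𝓝 (tail x)) (𝓝[X.dom] x) := by
    refine tendsto_nhdsWithin_iff.2 ⟨?_, Filter.Eventually.of_forall fun z => ?_⟩
    · have := inclL.continuous.tendsto (tail x)
      rwa [show inclL (tail x) = x from incl_tail hx0] at this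
    · rw [hdom]; exact (incl_zero z).ge
  exact h1 (h.mem_nhdsWithin_dom hx)

include h in
-- The chain rule along the inclusion of the hyperplane, which stays in the region near the point:
-- derivatives of a restriction are tangential derivatives within the half-space.
lemma pd_incl {F : E 4 → ℝ} {f : V.Alg} (hF : V.Rep F f) (k : Fin 3) :
    fderivWithin ℝ (fun z => F (incl z)) Set.univ (tail x) (EuclideanSpace.single k 1)
      = ev hx (D k.succ f) := by
  have hd : HasFDerivWithinAt F (fderivWithin ℝ F V.carrier x) V.carrier (inclL (tail x)) := by
    rw [show inclL (tail x) = x from incl_tail hx0]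
    exact (hF.contDiffOn.differentiableOn (by simp) x hx).hasFDerivWithinAt
  have hc := hd.comp_hasFDerivAt (tail x) inclL.hasFDerivAt
    (h.eventually_incl_mem hdom hx hx0)
  rw [fderivWithin_univ, show (fun z => F (incl z)) = F ∘ inclL from rfl, hc.fderiv, ev_D,
    ContinuousLinearMap.comp_apply, inclL_single]
  rw [fderivWithin_congr (fun z hz => by rw [hF z hz, ev_eq_fn]) (by rw [hF x hx, ev_eq_fn])]

/-- The tangential derivatives of the defining function vanish on the boundary. -/
lemma W_succ_eq_zero (hΩ : ∀ y ∈ V.carrier, y 0 = 0 → X.Ω y = 0) (i : Fin 3) :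
    h.matter.W (ev hx) i.succ = 0 := by
  have h1 := h.pd_incl hdom hx hx0 h.rep_Ω i
  have h2 : (fun z => X.Ω (incl z)) =ᶠ[𝓝 (tail x)] fun _ => 0 := by
    filter_upwards [h.eventually_incl_mem hdom hx hx0] with z hz
    exact hΩ _ hz (incl_zero z)
  rw [fderivWithin_univ, h2.fderiv_eq] at h1
  simp only [fderiv_fun_const, Pi.zero_apply, zero_apply] at h1
  exact h1.symm

/-- The matrix inverse of the induced metric is the Schur complement `tang`, and by `pd_incl` its
Christoffel symbols are `bdryChr`. -/
lemma divCotton_eq (hΩx : X.Ω x = 0) (hΩ : ∀ y ∈ V.carrier, y 0 = 0 → X.Ω y = 0) (i : Fin 3) :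
    X.divCotton x i = h.matter.divCotton (ev hx) h.κ i := by
  have hO : ev hx h.matter.Om = 0 := by rw [← h.rep_Ω x hx]; exact hΩx
  have hg0 := (MatterAlgebra.W_zero_ne hO h.pos_lam
    (h.W_succ_eq_zero hdom hx hx0 hΩ)).2
  have hxx := incl_tail hx0
  have hg : X.bdry.g (tail x) = Matrix.of fun i j => (h.matter.eval (ev hx)).g i.succ j.succ := by
    ext i j
    change X.g (incl (tail x)) i.succ j.succ = _
    rw [hxx]
    exact h.regular.rep_g _ _ x hx
  have hinv : ∀ i j, X.bdry.inv (tail x) i j = (h.matter.eval (ev hx)).tang i j := fun i j => by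
    change (X.bdry.g (tail x))⁻¹ i j = _
    rw [hg, Matrix.inv_eq_left_inv (B := Matrix.of (h.matter.eval (ev hx)).tang)]
    · rfl
    · ext i k
      rw [Matrix.mul_apply, Matrix.one_apply]
      exact MetricAlgebra.tang_mul_g hg0 i k
  have hpd : ∀ k {F : E 4 → ℝ} {f : V.Alg}, V.Rep F f →
      X.bdry.pd k (fun z => F (incl z)) (tail x) = ev hx (D k.succ f) := fun k F f hF =>
    h.pd_incl hdom hx hx0 hF k
  have hchr : ∀ c a b, X.bdry.chr (tail x) c a b = h.matter.bdryChr (ev hx) c a b := fun c a b => by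
    rw [LocalMetric.chr, MetricAlgebra.bdryChr]
    congr 1
    refine Finset.sum_congr rfl fun d _ => ?_
    rw [hinv]
    congr 1
    exact congrArg₂ _ (congrArg₂ _ (hpd a (h.regular.rep_g d.succ b.succ))
      (hpd b (h.regular.rep_g d.succ a.succ))) (hpd d (h.regular.rep_g a.succ b.succ))
  have hY : ∀ i j, X.cottonBdry (tail x) i j = ev hx (h.matter.cottonN h.κ i.succ j.succ) :=
    fun i j => by
      rw [← h.rep_cottonN _ _ x hx, LocalMatter.cottonBdry, hxx]
  rw [LocalMatter.divCotton, LocalMetric.div2, MatterAlgebra.divCotton]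
  refine Finset.sum_congr rfl fun j _ => Finset.sum_congr rfl fun k _ => ?_
  rw [hinv, LocalMetric.cov2]
  simp only [hchr, hY]
  congr 3
  exact hpd k (h.rep_cottonN i.succ j.succ)

end Boundary

end Region.IsMatter

end

/-! ## The constraints in coordinates -/

section

open LocalMatter MatterAlgebra

namespace Region.IsMatter

variable {V : Region 4} {X : LocalMatter} {q : ℕ} (h : V.IsMatter X q)
  {x : E 4} (hx : x ∈ V.carrier) (hΩx : X.Ω x = 0)

include h in
lemma rep_bach (a b : Fin 4) : V.Rep (fun y => X.bach y a b) (h.matter.bach a b) :=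
  h.regular.rep_bach a b

include h in
lemma rep_weyl (a b c d : Fin 4) :
    V.Rep (fun y => X.weyl y a b c d) (h.matter.weyl a b c d) :=
  h.regular.rep_weyl a b c d

include h in
lemma rep_lap_Ω : V.Rep (X.lap X.Ω) (h.matter.lap h.matter.Om) := h.regular.rep_lap h.rep_Ω

include h in
lemma rep_J : V.Rep X.J h.matter.J := h.regular.rep_J

include hΩx in
lemma ev_Om : ev hx h.matter.Om = 0 := by rw [← h.rep_Ω x hx]; exact hΩx

include h hx in
-- The remainder is Ω^{q+2} times a smooth, hence locally bounded, function by `nn_eq`.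
lemma nn_isBigO : (fun y => X.nn y - (-1 + 2 / (4 * X.lam) * (X.Ω y * (X.lap X.Ω y
    + X.J y * X.Ω y)))) =O[𝓝[X.dom] x] (fun y => X.Ω y ^ (q + 2)) := by
  have hl : ∀ y ∈ V.carrier, X.nn y - (-1 + 2 / (4 * X.lam) * (X.Ω y * (X.lap X.Ω y
      + X.J y * X.Ω y))) = h.κ ^ 2 / 12 * (X.Ω y ^ (q + 2) * X.τtr y) := by
    intro y hy
    have h2 := congrArg (ev hy) (h.matter.nn_eq h.κ_sq)
    rw [map_add, map_add, map_neg, map_one, map_smul _ (2 / _), map_smul _ (_ / 12), map_mul,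
      map_mul, map_add, map_mul, map_pow, ← h.rep_nn y hy, ← h.rep_Ω y hy, ← h.rep_lap_Ω y hy,
      ← h.rep_J y hy, ← h.rep_t y hy, smul_eq_mul, smul_eq_mul] at h2
    exact sub_eq_of_eq_add' h2
  have ht : (fun y => (h.κ ^ 2 / 12) * X.τtr y) =O[𝓝[X.dom] x] (fun _ => (1 : ℝ)) := by
    rw [h.regular.nhds x hx]
    exact ((Rep.smul _ h.rep_t).contDiffOn.continuousOn x hx).isBigO_one ℝ
  have h3 := ht.mul (Asymptotics.isBigO_refl (fun y => X.Ω y ^ (q + 2)) (𝓝[X.dom] x))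
  simp only [one_mul] at h3
  refine h3.congr' ?_ (Filter.EventuallyEq.refl _ _)
  filter_upwards [h.mem_nhdsWithin_dom hx] with y hy
  rw [hl y hy]
  ring

include h hx hΩx in
lemma nn_boundary : X.nn x = -1 := by
  have h1 := h.κ_sq
  rw [h.rep_nn x hx, map_smul, ev_N (h.ev_Om hx hΩx), smul_eq_mul]
  linarith

variable {Ni : V.Alg} (hNi : h.matter.N * Ni = 1)
include hΩx

include h hx in
lemma constr_boundary (a : Fin 4) : X.constr q x a = 0 := by
  have h1 := h.rep_constr a x hx
  rw [h.matter.constr_eq, map_smul, map_mul, h.ev_Om hx hΩx, zero_mul, smul_zero] at h1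
  exact h1

include h hx in
lemma dn1_constr_boundary (a : Fin 4) : X.dn1 (X.constr q) x a - X.div2 X.τ x a = 0 := by
  have h1 := h.rep_dn1 h.rep_constr a x hx
  have h2 := h.regular.rep_div2 h.rep_τ a x hx
  have h3 := ev_dn1_constr (h.ev_Om hx hΩx) h.κ_sq a
  exact sub_eq_zero.2 (h1.trans (h3.trans h2.symm))

include hNi hx

lemma Kfree_boundary (a b : Fin 4) : X.Kfree x a b = 0 := by
  have h1 := ev_Kfree (h.ev_Om hx hΩx) hNi h.κ a b
  rw [← h.rep_K hNi a b x hx, ← h.rep_H hNi x hx, ← h.rep_gbar hNi a b x hx] at h1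
  exact h1

lemma weylE_boundary (hq : q = 0) (a b : Fin 4) :
    X.weylE x a b = 1 / 2 * X.topFree X.τ x a b := by
  have h1 := ev_weylE_zero (h.ev_Om hx hΩx) hq hNi h.κ_sq a b
  rw [← h.rep_weylE a b x hx, ← h.rep_topFree hNi h.rep_τ a b x hx] at h1
  exact h1

lemma dn2_boundary (hq : q = 0) (a b : Fin 4) :
    X.dn2 (X.top2 X.τ) x a b + 2 / 3 * X.H x * X.top2 X.τ x a b = 0 := by
  have h1 := ev_dn2_zero (h.ev_Om hx hΩx) hq hNi h.κ a b
  rw [← h.rep_dn2 (h.rep_top2 hNi h.rep_τ) a b x hx, ← h.rep_H hNi x hx,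
    ← h.rep_top2 hNi h.rep_τ a b x hx] at h1
  exact h1

omit hNi in
include h in
lemma τ_boundary_one (hq : q = 1) (a b : Fin 4) :
    X.τ x a b = - X.nrm x a * X.nrm x b * X.τtr x := by
  have h1 := ev_τ_one (h.ev_Om hx hΩx) hq h.κ_sq a b
  have h2 := fun a => h.rep_nrm a x hx
  simp only [MatterAlgebra.nrm, map_smul, smul_eq_mul] at h2
  rw [← h.rep_τ a b x hx, ← h.rep_t x hx] at h1
  refine h1.trans ?_
  rw [h2 a, h2 b, W, W]
  ring

lemma bach_boundary_one (hq : q = 1) (a b : Fin 4) : X.topFree X.bach x a b = √X.lam / 3 *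
    (9 * X.dn2 (X.top2 X.τ) x a b - 3 * X.gbar x a b * X.dn0 (X.ctr2 X.τ) x
      + 8 * X.H x * X.top2 X.τ x a b - X.H x * X.gbar x a b * X.ctr2 X.τ x) := by
  have h1 := ev_prFree_bach_one (h.ev_Om hx hΩx) hq hNi h.κ_sq a b
  rw [← h.rep_topFree hNi h.rep_bach a b x hx,
    ← h.rep_dn2 (h.rep_top2 hNi h.rep_τ) a b x hx, ← h.rep_H hNi x hx,
    ← h.rep_top2 hNi h.rep_τ a b x hx, ← h.rep_gbar hNi a b x hx,
    ← h.rep_dn0 (h.rep_ctr2 h.rep_τ) x hx, ← h.rep_ctr2 h.rep_τ x hx,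
    show h.κ * h.matter.lam = √X.lam from h.κ_mul_lam] at h1
  exact h1

omit hNi in
include h in
lemma bach_nn_boundary (hq : q = 1 ∨ q = 2) : X.ctr2 X.bach x = 0 := by
  have h1 := h.rep_ctr2 h.rep_bach x hx
  rw [h1]
  rcases hq with hq | hq
  · exact ev_cnn_bach_one (h.ev_Om hx hΩx) hq h.κ_sq
  · exact ev_cnn_bach_two (h.ev_Om hx hΩx) h.pos_lam hq h.κ

omit hx hΩx in
include h in
lemma rep_gradTop {F : E 4 → ℝ} {f : V.Alg} (hF : V.Rep F f) (a : Fin 4) :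
    V.Rep (fun y => X.gradTop F y a) (h.matter.pr1 Ni (h.matter.grad f) a) :=
  h.rep_top1 hNi (v := fun y c => X.pd c F y) (fun c => h.regular.rep_pd hF c) a

lemma bach_n_boundary_one (hq : q = 1) (a : Fin 4) : X.top1 (X.ctr X.bach) x a =
    √X.lam * (X.dn1 (X.top1 (X.ctr X.τ)) x a + 1 / 3 * X.gradTop X.τtr x a) := by
  have h1 := ev_pr1_cn_bach_one (h.ev_Om hx hΩx) hq hNi h.κ_sq a
  rw [← h.rep_top1 hNi (h.rep_ctr h.rep_bach) a x hx,
    ← h.rep_dn1 (h.rep_top1 hNi (h.rep_ctr h.rep_τ)) a x hx,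
    ← h.rep_gradTop hNi h.rep_t a x hx,
    show h.κ * h.matter.lam = √X.lam from h.κ_mul_lam] at h1
  exact h1

lemma bach_boundary_two (hq : q = 2) (a b : Fin 4) :
    X.topFree (fun y c d => X.bach y c d + 3 * X.lam * X.τ y c d) x a b = 0 := by
  have h1 := ev_prFree_bach_two (h.ev_Om hx hΩx) h.pos_lam hq hNi a b
  refine Eq.trans (h.rep_topFree hNi (T := fun y c d => X.bach y c d + 3 * X.lam * X.τ y c d)
    ?_ a b x hx) h1
  intro a b y hy
  rw [map_add, map_smul, ← h.rep_bach a b y hy, ← h.rep_τ a b y hy, smul_eq_mul]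
  rfl

lemma bach_n_boundary_two (hq : q = 2) (a : Fin 4) :
    X.top1 (X.ctr X.bach) x a = - X.lam * X.top1 (X.ctr X.τ) x a := by
  have h1 := ev_pr1_cn_bach_two (h.ev_Om hx hΩx) h.pos_lam hq hNi h.κ a
  rw [← h.rep_top1 hNi (h.rep_ctr h.rep_bach) a x hx,
    ← h.rep_top1 hNi (h.rep_ctr h.rep_τ) a x hx] at h1
  exact h1

variable (hdom : X.dom = {y : E 4 | 0 ≤ y 0}) (hx0 : x 0 = 0)
  (hΩ : ∀ y ∈ V.carrier, y 0 = 0 → X.Ω y = 0)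
include hdom hx0 hΩ

omit hNi hΩx in
include h in
lemma weyl_boundary (hq : q ≠ 0) (a b c d : Fin 4) : X.weyl x a b c d = 0 := by
  have h1 := ev_weyl (h.ev_Om hx (hΩ x hx hx0)) h.pos_lam hq (h.W_succ_eq_zero hdom hx hx0 hΩ) a b c d
  rw [← h.rep_weyl a b c d x hx] at h1
  exact h1

lemma exists_flux (hq : q = 1) : ∃ j : E 4 → Fin 4 → ℝ,
    (∀ a, ContDiffWithinAt ℝ ∞ (fun y => j y a) X.dom x) ∧
    (∀ a, (fun y => X.top1 (X.ctr X.τ) y a - X.Ω y * j y a)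
      =O[𝓝[X.dom] x] (fun y => X.Ω y ^ 2)) ∧
    (∀ i : Fin 3, X.divCotton x i =
      X.lam * j x i.succ - √X.lam / 3 * X.gradTop X.τtr x i.succ) := by
  -- By `pr1_cn_one` the tangential flux is exactly Ω times this covector, so the remainder of order
  -- Ω² is zero.
  refine ⟨fun y a => fn (h.κ • h.matter.pr1 Ni (h.matter.div h.matter.τ) a) y, fun a => ?_,
    fun a => ?_, fun i => ?_⟩
  · exact (contDiffOn_fn (h.κ • h.matter.pr1 Ni (h.matter.div h.matter.τ) a) x hx).mono_of_mem_nhdsWithin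
      (h.mem_nhdsWithin_dom hx)
  · refine (Asymptotics.isBigO_zero _ _).congr' ?_ (Filter.EventuallyEq.refl _ _)
    filter_upwards [h.mem_nhdsWithin_dom hx] with y hy
    have h1 := h.rep_top1 hNi (h.rep_ctr h.rep_τ) a y hy
    rw [h.matter.pr1_cn_one hq hNi, map_mul, ← h.rep_Ω y hy, ev_eq_fn] at h1
    exact (sub_eq_zero.2 h1).symm
  · have h1 := divCotton_one (h.ev_Om hx hΩx) hq (h.W_succ_eq_zero hdom hx hx0 hΩ) hNi h.κ_sq i
    rw [← h.divCotton_eq hdom hx hx0 hΩx hΩ i, ← h.rep_gradTop hNi h.rep_t i.succ x hx,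
      show h.κ * h.matter.lam = √X.lam from h.κ_mul_lam, ev_eq_fn] at h1
    exact h1

lemma divCotton_boundary_two (hq : q = 2) (i : Fin 3) :
    X.divCotton x i = X.lam * X.top1 (X.ctr X.τ) x i.succ := by
  have h1 := divCotton_two (h.ev_Om hx hΩx) h.pos_lam hq
    (h.W_succ_eq_zero hdom hx hx0 hΩ) hNi h.κ i
  rw [← h.divCotton_eq hdom hx hx0 hΩx hΩ i, ← h.rep_top1 hNi (h.rep_ctr h.rep_τ) i.succ x hx] at h1
  exact h1

/-- The constraints at a boundary point, in coordinates. -/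
theorem boundary_constraints :
    (∀ a b, X.Kfree x a b = 0) ∧
    (∀ a, X.constr q x a = 0) ∧
    (∀ a, X.dn1 (X.constr q) x a - X.div2 X.τ x a = 0) ∧
    (fun y => X.nn y - (-1 + 2 / (4 * X.lam) * (X.Ω y * (X.lap X.Ω y + X.J y * X.Ω y))))
      =O[𝓝[X.dom] x] (fun y => X.Ω y ^ (q + 2)) ∧
    X.nn x = -1 ∧
    (q = 0 →
      (∀ a b, X.weylE x a b = 1 / 2 * X.topFree X.τ x a b) ∧
      (∀ a b, X.dn2 (X.top2 X.τ) x a b + 2 / 3 * X.H x * X.top2 X.τ x a b = 0)) ∧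
    (q = 1 →
      (∀ a b c d, X.weyl x a b c d = 0) ∧
      (∀ a b, X.τ x a b = - X.nrm x a * X.nrm x b * X.τtr x) ∧
      (∃ j : E 4 → Fin 4 → ℝ,
        (∀ a, ContDiffWithinAt ℝ ∞ (fun y => j y a) X.dom x) ∧
        (∀ a, (fun y => X.top1 (X.ctr X.τ) y a - X.Ω y * j y a)
          =O[𝓝[X.dom] x] (fun y => X.Ω y ^ 2)) ∧
        (∀ i : Fin 3, X.divCotton x i =
          X.lam * j x i.succ - √X.lam / 3 * X.gradTop X.τtr x i.succ)) ∧
      (∀ a b, X.topFree X.bach x a b = √X.lam / 3 *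
        (9 * X.dn2 (X.top2 X.τ) x a b - 3 * X.gbar x a b * X.dn0 (X.ctr2 X.τ) x
          + 8 * X.H x * X.top2 X.τ x a b - X.H x * X.gbar x a b * X.ctr2 X.τ x)) ∧
      X.ctr2 X.bach x = 0 ∧
      (∀ a, X.top1 (X.ctr X.bach) x a =
        √X.lam * (X.dn1 (X.top1 (X.ctr X.τ)) x a + 1 / 3 * X.gradTop X.τtr x a))) ∧
    (q = 2 →
      (∀ a b c d, X.weyl x a b c d = 0) ∧
      (∀ i : Fin 3, X.divCotton x i = X.lam * X.top1 (X.ctr X.τ) x i.succ) ∧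
      (∀ a b, X.topFree (fun y c d => X.bach y c d + 3 * X.lam * X.τ y c d) x a b = 0) ∧
      X.ctr2 X.bach x = 0 ∧
      (∀ a, X.top1 (X.ctr X.bach) x a = - X.lam * X.top1 (X.ctr X.τ) x a)) :=
  ⟨h.Kfree_boundary hx hΩx hNi, h.constr_boundary hx hΩx, h.dn1_constr_boundary hx hΩx,
    h.nn_isBigO hx, h.nn_boundary hx hΩx,
    fun hq => ⟨h.weylE_boundary hx hΩx hNi hq, h.dn2_boundary hx hΩx hNi hq⟩,
    fun hq => ⟨h.weyl_boundary hx hdom hx0 hΩ (by omega), h.τ_boundary_one hx hΩx hq,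
      h.exists_flux hx hΩx hNi hdom hx0 hΩ hq, h.bach_boundary_one hx hΩx hNi hq,
      h.bach_nn_boundary hx hΩx (Or.inl hq), h.bach_n_boundary_one hx hΩx hNi hq⟩,
    fun hq => ⟨h.weyl_boundary hx hdom hx0 hΩ (by omega),
      h.divCotton_boundary_two hx hΩx hNi hdom hx0 hΩ hq, h.bach_boundary_two hx hΩx hNi hq,
      h.bach_nn_boundary hx hΩx (Or.inr hq), h.bach_n_boundary_two hx hΩx hNi hq⟩⟩

end Region.IsMatter

end

/-! ## Charts and Lorentz metrics -/

section

section Chart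

variable {n : ℕ} {HH : Type*} [TopologicalSpace HH] {I : ModelWithCorners ℝ (E n) HH}
  {M : Type*} [TopologicalSpace M] [ChartedSpace HH M]
  {e : OpenPartialHomeomorph M HH} (he : e ∈ IsManifold.maximalAtlas I ∞ M)
  {y : E n} (hy : y ∈ (e.extend I).target)

omit [ChartedSpace HH M] in
include hy in
lemma extend_target_mem_nhdsWithin : (e.extend I).target ∈ 𝓝[Set.range I] y := by
  have h1 := (e.extend I).map_target hy
  rw [e.extend_source] at h1
  have h2 := e.extend_target_mem_nhdsWithin (I := I) h1
  rwa [(e.extend I).right_inv hy] at h2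

include he in
lemma contMDiffOn_extend_symm_target :
    ContMDiffOn 𝓘(ℝ, E n) I ∞ (e.extend I).symm (e.extend I).target := by
  rw [e.extend_target']
  exact contMDiffOn_extend_symm he

include he hy

lemma mdifferentiableWithinAt_extend_symm :
    MDifferentiableWithinAt 𝓘(ℝ, E n) I (e.extend I).symm (Set.range I) y :=
  (((contMDiffOn_extend_symm_target he) y hy).mono_of_mem_nhdsWithin
    (extend_target_mem_nhdsWithin hy)).mdifferentiableWithinAt (by simp)

lemma injective_mfderivWithin_extend_symm : Function.Injective
    (mfderivWithin 𝓘(ℝ, E n) I (e.extend I).symm (Set.range I) y) := by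
  have U : UniqueMDiffWithinAt 𝓘(ℝ, E n) (Set.range I) y :=
    I.uniqueMDiffOn y (e.extend_target_subset_range hy)
  have h1 : (e.extend I).symm y ∈ e.source := by
    rw [← e.extend_source (I := I)]
    exact (e.extend I).map_target hy
  have h2 : (mfderiv I 𝓘(ℝ, E n) (e.extend I) ((e.extend I).symm y)) ∘L
      (mfderivWithin 𝓘(ℝ, E n) I (e.extend I).symm (Set.range I) y)
      = ContinuousLinearMap.id _ _ := by
    rw [← mfderiv_comp_mfderivWithin _ ((e.contMDiffAt_extend he h1).mdifferentiableAt (by simp))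
      (mdifferentiableWithinAt_extend_symm he hy) U, ← mfderivWithin_id U]
    apply Filter.EventuallyEq.mfderivWithin_eq
    · filter_upwards [extend_target_mem_nhdsWithin hy] with z hz
      exact (e.extend I).right_inv hz
    · exact (e.extend I).right_inv hy
  exact Function.LeftInverse.injective (g := mfderiv I 𝓘(ℝ, E n) (e.extend I) ((e.extend I).symm y))
    fun v => congrArg (fun L => L v) h2

end Chart

section Lorentz

variable {HH : Type*} [TopologicalSpace HH] {I : ModelWithCorners ℝ (E 4) HH}
  {M : Type*} [TopologicalSpace M] [ChartedSpace HH M] {g : Tensor2 I M}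
  (hg : IsLorentzMetric I g)
include hg

lemma IsLorentzMetric.symm (p : M) (u v : E 4) :
    (g p : E 4 →L[ℝ] E 4 →L[ℝ] ℝ) u v = (g p : E 4 →L[ℝ] E 4 →L[ℝ] ℝ) v u := by
  obtain ⟨b, hb⟩ := hg.signature p
  let G : E 4 →L[ℝ] E 4 →L[ℝ] ℝ := g p
  let B : E 4 →ₗ[ℝ] E 4 →ₗ[ℝ] ℝ := LinearMap.mk₂ ℝ (fun u v => G u v) (by simp) (by simp)
    (by simp) (by simp)
  have h : B = B.flip := LinearMap.ext_basis (b : Module.Basis (Fin 4) ℝ (E 4)) b fun i j => by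
    change g p (b i) (b j) = g p (b j) (b i)
    rw [hb, hb]
    by_cases h : i = j
    · rw [h]
    · rw [if_neg h, if_neg (Ne.symm h)]
  exact congrArg (fun L : E 4 →ₗ[ℝ] E 4 →ₗ[ℝ] ℝ => L u v) h

lemma IsLorentzMetric.nondegenerate (p : M) {v : E 4}
    (hv : ∀ u, (g p : E 4 →L[ℝ] E 4 →L[ℝ] ℝ) u v = 0) : v = 0 := by
  obtain ⟨b', hb'⟩ := hg.signature p
  let b : Module.Basis (Fin 4) ℝ (E 4) := b'
  let G : E 4 →L[ℝ] E 4 →L[ℝ] ℝ := g p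
  have hb : ∀ i j, G (b i) (b j) = if i = j then (if i = 0 then -1 else 1) else 0 := hb'
  refine b.ext_elem fun i => ?_
  have h1 : G (b i) v = 0 := hv (b i)
  rw [← b.sum_repr v, map_sum] at h1
  simp only [map_smul, hb, smul_eq_mul, mul_ite, mul_zero] at h1
  rw [Finset.sum_ite_eq, if_pos (Finset.mem_univ i)] at h1
  rw [map_zero]
  by_cases h0 : i = 0
  · simpa [h0] using h1
  · simpa [h0] using h1

variable {e : OpenPartialHomeomorph M HH} (he : e ∈ IsManifold.maximalAtlas I ∞ M)
  {y : E 4} (hy : y ∈ (e.extend I).target)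

lemma IsLorentzMetric.comp_symm (y : E 4) (a b : Fin 4) :
    comp I g e y a b = comp I g e y b a := hg.symm _ _ _

include he hy in
lemma IsLorentzMetric.det_ne_zero : ((localMetric I g e).g y).det ≠ 0 := by
  intro h0
  obtain ⟨c, hc, h1⟩ := Matrix.exists_mulVec_eq_zero_iff.2 h0
  let A : E 4 →L[ℝ] E 4 := mfderivWithin 𝓘(ℝ, E 4) I (e.extend I).symm (Set.range I) y
  have hA : Function.Injective A := injective_mfderivWithin_extend_symm he hy
  have hA' : Function.Surjective A :=
    (LinearMap.injective_iff_surjective (f := A.toLinearMap)).1 hA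
  let G : E 4 →L[ℝ] E 4 →L[ℝ] ℝ := g ((e.extend I).symm y)
  let w : E 4 := ∑ a, c a • EuclideanSpace.single a (1 : ℝ)
  have hbas : ∀ v : E 4, v = ∑ a, v a • EuclideanSpace.single a (1 : ℝ) := fun v => by
    ext i
    simp [Pi.single_apply]
  have h2 : ∀ a, G (A (EuclideanSpace.single a 1)) (A w) = 0 := by
    intro a
    have h3 := congrFun h1 a
    simp only [Matrix.mulVec, dotProduct, Pi.zero_apply] at h3
    rw [← h3]
    simp only [w, map_sum, map_smul, smul_eq_mul]
    exact Finset.sum_congr rfl fun b _ => mul_comm _ _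
  have h2 : ∀ u, G u (A w) = 0 := by
    intro u
    obtain ⟨v, rfl⟩ := hA' u
    rw [hbas v]
    simp only [map_sum, map_smul, sum_apply, smul_apply, h2, smul_zero, Finset.sum_const_zero]
  have h3 : A w = 0 := hg.nondegenerate _ h2
  have h4 : w = 0 := hA (h3.trans (map_zero A).symm)
  refine hc (funext fun i => ?_)
  have h5 := congrArg (fun v : E 4 => v i) h4
  simpa [w, Pi.single_apply] using h5

end Lorentz

end

/-! ## Pull-back of charts along an embedding -/

section

section Pullback

variable {Mt : Type*} [TopologicalSpace Mt] [ChartedSpace (E 4) Mt] [IsManifold (𝓡 4) ∞ Mt]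
  {M : Type*} [TopologicalSpace M] [ChartedSpace (EuclideanHalfSpace 4) M]
  [IsManifold (𝓡∂ 4) ∞ M] {φ : Mt → M} (hφ : Manifold.IsSmoothEmbedding (𝓡 4) (𝓡∂ 4) ∞ φ)
  {e : OpenPartialHomeomorph M (EuclideanHalfSpace 4)}
  (he : e ∈ IsManifold.maximalAtlas (𝓡∂ 4) ∞ M)
include hφ he

omit [IsManifold (𝓡∂ 4) ∞ M] in
/-- A chart of the target of a codimension-zero embedding pulls back, away from the boundary, to
a chart of the source. -/
lemma exists_pullback_chart {x : Mt} (hx : φ x ∈ e.source)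
    (hint : e.extend (𝓡∂ 4) (φ x) ∈ interior (e.extend (𝓡∂ 4)).target) :
    ∃ f ∈ IsManifold.maximalAtlas (𝓡 4) ∞ Mt, e.extend (𝓡∂ 4) (φ x) ∈ f.target ∧
      f.target ⊆ interior (e.extend (𝓡∂ 4)).target ∧
      ∀ y ∈ f.target, φ (f.symm y) = (e.extend (𝓡∂ 4)).symm y := by
  have him := hφ.isImmersion.isImmersionOfComplement_complement x
  set D := him.domChart with hD
  set C := him.codChart with hC
  have hDm : D ∈ IsManifold.maximalAtlas (𝓡 4) ∞ Mt := him.domChart_mem_maximalAtlas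
  have hCm : C ∈ IsManifold.maximalAtlas (𝓡∂ 4) ∞ M := him.codChart_mem_maximalAtlas
  have hDC : ∀ z ∈ D.source, φ z ∈ C.source := him.source_subset_preimage_source
  let L' : E 4 →L[ℝ] E 4 := him.equiv.toContinuousLinearMap.comp (ContinuousLinearMap.inl ℝ _ _)
  have hL' : Function.Injective L' := fun u v huv =>
    congrArg Prod.fst (him.equiv.injective huv)
  -- In suitable charts the immersion is v ↦ (v, 0) followed by a linear isomorphism; between spaces
  -- of equal dimension this injective linear map is bijective.
  let L : E 4 ≃L[ℝ] E 4 := (LinearEquiv.ofInjectiveEndo L'.toLinearMap hL').toContinuousLinearEquiv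
  have hL : ∀ v, L v = L' v := fun v => rfl
  have hDext : (D.extend (𝓡 4)).target = D.target := by simp
  have hw : ∀ z ∈ D.target, C.extend (𝓡∂ 4) (φ (D.symm z)) = L z := fun z hz =>
    him.writtenInCharts (hDext.symm ▸ hz)
  set T := (e.extend (𝓡∂ 4)).target with hT
  have hTi : interior T ⊆ T := interior_subset
  have hsrc : ∀ y ∈ T, (e.extend (𝓡∂ 4)).symm y ∈ e.source := fun y hy => by
    rw [← e.extend_source (I := 𝓡∂ 4)]
    exact (e.extend (𝓡∂ 4)).map_target hy
  let W : Set (E 4) := interior T ∩ (e.extend (𝓡∂ 4)).symm ⁻¹' C.source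
  -- The new chart is φ followed by the chart e. Its inverse passes from e to the immersion charts C
  -- and D, between which φ is the linear isomorphism L.
  let k' : E 4 → E 4 := fun y => L.symm (C.extend (𝓡∂ 4) ((e.extend (𝓡∂ 4)).symm y))
  have hWT : W ⊆ T := fun y hy => hTi hy.1
  have hsm : ContMDiffOn (𝓡 4) (𝓡∂ 4) ∞ (e.extend (𝓡∂ 4)).symm (interior T) :=
    (contMDiffOn_extend_symm_target he).mono hTi
  have hWo : IsOpen W := hsm.continuousOn.isOpen_inter_preimage isOpen_interior C.open_source
  have hk' : ContMDiffOn (𝓡 4) (𝓡 4) ∞ k' W :=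
    L.symm.contDiff.contMDiff.comp_contMDiffOn
      ((OpenPartialHomeomorph.contMDiffOn_extend hCm).comp (hsm.mono Set.inter_subset_left)
        fun y hy => hy.2)
  let U : Set (E 4) := W ∩ k' ⁻¹' D.target
  have hUo : IsOpen U := hk'.continuousOn.isOpen_inter_preimage hWo D.open_target
  have hk : ContMDiffOn (𝓡 4) (𝓡 4) ∞ (fun y => D.symm (k' y)) U :=
    (contMDiffOn_symm_of_mem_maximalAtlas hDm).comp (hk'.mono Set.inter_subset_left)
      fun y hy => hy.2
  have hφk : ∀ y ∈ U, φ (D.symm (k' y)) = (e.extend (𝓡∂ 4)).symm y := by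
    intro y hy
    have h1 : φ (D.symm (k' y)) ∈ C.source := hDC _ (D.map_target hy.2)
    refine (C.extend (𝓡∂ 4)).injOn ?_ ?_ ?_
    · rw [C.extend_source]; exact h1
    · rw [C.extend_source]; exact hy.1.2
    · rw [hw _ hy.2]
      exact L.apply_symm_apply _
  have hφc : ContMDiff (𝓡 4) (𝓡∂ 4) ∞ φ := hφ.contMDiff
  let S : Set Mt := D.source ∩ φ ⁻¹' (e.source ∩ e.extend (𝓡∂ 4) ⁻¹' interior T)
  have hSo : IsOpen S := by
    refine D.open_source.inter (IsOpen.preimage hφc.continuous ?_)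
    have := e.continuousOn_extend (I := 𝓡∂ 4)
    rw [e.extend_source] at this
    exact this.isOpen_inter_preimage e.open_source isOpen_interior
  have hf : ContMDiffOn (𝓡 4) (𝓡 4) ∞ (fun z => e.extend (𝓡∂ 4) (φ z)) S :=
    (OpenPartialHomeomorph.contMDiffOn_extend he).comp hφc.contMDiffOn fun z hz => hz.2.1
  have hleft : ∀ z ∈ S, (e.extend (𝓡∂ 4)).symm (e.extend (𝓡∂ 4) (φ z)) = φ z := fun z hz =>
    (e.extend (𝓡∂ 4)).left_inv (by rw [e.extend_source]; exact hz.2.1)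
  have hkS : ∀ z ∈ S, k' (e.extend (𝓡∂ 4) (φ z)) = D z := by
    intro z hz
    have h1 := hw (D z) (D.map_source hz.1)
    rw [D.left_inv hz.1] at h1
    change L.symm (C.extend (𝓡∂ 4) ((e.extend (𝓡∂ 4)).symm (e.extend (𝓡∂ 4) (φ z)))) = D z
    rw [hleft z hz, h1, L.symm_apply_apply]
  have hSU : ∀ z ∈ S, e.extend (𝓡∂ 4) (φ z) ∈ U := by
    intro z hz
    refine ⟨⟨hz.2.2, ?_⟩, ?_⟩
    · change (e.extend (𝓡∂ 4)).symm (e.extend (𝓡∂ 4) (φ z)) ∈ C.source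
      rw [hleft z hz]
      exact hDC z hz.1
    · change k' (e.extend (𝓡∂ 4) (φ z)) ∈ D.target
      rw [hkS z hz]
      exact D.map_source hz.1
  let f : OpenPartialHomeomorph Mt (E 4) :=
    { toFun := fun z => e.extend (𝓡∂ 4) (φ z)
      invFun := fun y => D.symm (k' y)
      source := S
      target := U
      map_source' := hSU
      map_target' := fun y hy => by
        refine ⟨D.map_target hy.2, ?_⟩
        change φ (D.symm (k' y)) ∈ e.source ∩ e.extend (𝓡∂ 4) ⁻¹' interior T
        rw [hφk y hy]
        refine ⟨hsrc y (hWT hy.1), ?_⟩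
        change e.extend (𝓡∂ 4) ((e.extend (𝓡∂ 4)).symm y) ∈ interior T
        rw [(e.extend (𝓡∂ 4)).right_inv (hWT hy.1)]
        exact hy.1.1
      left_inv' := fun z hz => by
        rw [hkS z hz, D.left_inv hz.1]
      right_inv' := fun y hy => by
        change e.extend (𝓡∂ 4) (φ (D.symm (k' y))) = y
        rw [hφk y hy, (e.extend (𝓡∂ 4)).right_inv (hWT hy.1)]
      open_source := hSo
      open_target := hUo
      continuousOn_toFun := hf.continuousOn
      continuousOn_invFun := hk.continuousOn }
  exact ⟨f, f.mem_maximalAtlas_of_contMDiffOn hf hk,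
    hSU x ⟨him.mem_domChart_source, hx, hint⟩, fun y hy => hy.1.1, hφk⟩

omit he [IsManifold (𝓡 4) ∞ Mt] [IsManifold (𝓡∂ 4) ∞ M] in
/-- The components of a tensor field related to the pull-back of another one, in the pulled back
chart. -/
lemma comp_pullback {f : OpenPartialHomeomorph Mt (E 4)}
    (hf : f ∈ IsManifold.maximalAtlas (𝓡 4) ∞ Mt)
    (hfe : f.target ⊆ interior (e.extend (𝓡∂ 4)).target)
    (hφf : ∀ y ∈ f.target, φ (f.symm y) = (e.extend (𝓡∂ 4)).symm y)
    {T' : Tensor2 (𝓡 4) Mt} {T : Tensor2 (𝓡∂ 4) M} {c : M → ℝ}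
    (hT : ∀ x u v, T' x u v = c (φ x) *
      T (φ x) (mfderiv (𝓡 4) (𝓡∂ 4) φ x u) (mfderiv (𝓡 4) (𝓡∂ 4) φ x v))
    {y : E 4} (hy : y ∈ f.target) (a b : Fin 4) :
    comp (𝓡 4) T' f y a b = c ((e.extend (𝓡∂ 4)).symm y) * comp (𝓡∂ 4) T e y a b := by
  have hft : f.target = (f.extend (𝓡 4)).target := by simp
  have hyt : y ∈ (e.extend (𝓡∂ 4)).target := interior_subset (hfe hy)
  have hmem : (e.extend (𝓡∂ 4)).target ∈ 𝓝 y := mem_interior_iff_mem_nhds.1 (hfe hy)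
  have hR : Set.range (𝓡∂ 4) ∈ 𝓝 y := Filter.mem_of_superset hmem
    (e.extend_target_subset_range)
  have hd : ∀ a, (mfderiv (𝓡 4) (𝓡∂ 4) φ (f.symm y) (coordVec (𝓡 4) f y a) : E 4)
      = coordVec (𝓡∂ 4) e y a := by
    intro a
    have h1 : mfderiv (𝓡 4) (𝓡∂ 4) (φ ∘ f.symm) y
        = (mfderiv (𝓡 4) (𝓡∂ 4) φ (f.symm y)).comp (mfderiv (𝓡 4) (𝓡 4) f.symm y) := by
      refine mfderiv_comp y (hφ.contMDiff.mdifferentiableAt (by simp)) ?_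
      have := mdifferentiableWithinAt_extend_symm hf (hft ▸ hy)
      rw [(𝓡 4).range_eq_univ] at this
      exact mdifferentiableWithinAt_univ.1 this
    have h2 : mfderiv (𝓡 4) (𝓡∂ 4) (φ ∘ f.symm) y
        = mfderiv (𝓡 4) (𝓡∂ 4) (e.extend (𝓡∂ 4)).symm y := by
      apply Filter.EventuallyEq.mfderiv_eq
      filter_upwards [f.open_target.mem_nhds hy] with z hz
      exact hφf z hz
    have h3 : coordVec (𝓡 4) f y a = mfderiv (𝓡 4) (𝓡 4) f.symm y (EuclideanSpace.single a 1) := by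
      unfold coordVec
      rw [(𝓡 4).range_eq_univ, mfderivWithin_univ]
      rfl
    have h4 : coordVec (𝓡∂ 4) e y a
        = mfderiv (𝓡 4) (𝓡∂ 4) (e.extend (𝓡∂ 4)).symm y (EuclideanSpace.single a 1) := by
      unfold coordVec
      rw [mfderivWithin_of_mem_nhds hR]
    rw [h3, h4, ← h2, h1]
    rfl
  have h5 := hT (f.symm y) (coordVec (𝓡 4) f y a) (coordVec (𝓡 4) f y b)
  refine h5.trans ?_
  rw [hφf y hy]
  congr 1
  exact congrArg₂ (fun u v => (T ((e.extend (𝓡∂ 4)).symm y) : E 4 →L[ℝ] E 4 →L[ℝ] ℝ) u v)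
    (hd a) (hd b)

end Pullback

end

/-! ## Conformal extensions in coordinates -/

section

/-- The regions which are relatively open in the range of a model with corners. -/
def Region.inter {n : ℕ} {HH : Type*} [TopologicalSpace HH] (I : ModelWithCorners ℝ (E n) HH)
    {O : Set (E n)} (hO : IsOpen O) : Region n where
  carrier := Set.range I ∩ O
  uniqueDiffOn := I.uniqueDiffOn.inter hO
  subset_closure_interior := by
    rw [interior_inter, hO.interior_eq]
    rintro y ⟨hy, hyO⟩
    exact hO.closure_inter ⟨I.range_subset_closure_interior hy, hyO⟩

lemma nhdsWithin_region_inter {n : ℕ} {HH : Type*} [TopologicalSpace HH]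
    (I : ModelWithCorners ℝ (E n) HH) {O : Set (E n)} (hO : IsOpen O) {y : E n}
    (hy : y ∈ (Region.inter I hO).carrier) :
    𝓝[Set.range I] y = 𝓝[(Region.inter I hO).carrier] y :=
  (nhdsWithin_inter_of_mem' (mem_nhdsWithin_of_mem_nhds (hO.mem_nhds hy.2))).symm

lemma Region.IsMatter.mono {V V' : Region 4} {X : LocalMatter} {q : ℕ} (h : V.IsMatter X q)
    (hs : V'.carrier ⊆ V.carrier) (hn : ∀ y ∈ V'.carrier, 𝓝[X.dom] y = 𝓝[V'.carrier] y) :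
    V'.IsMatter X q where
  regular :=
    { nhds := hn
      smooth := fun a b => (h.regular.smooth a b).mono hs
      symm := fun y hy => h.regular.symm y (hs hy)
      det := fun y hy => h.regular.det y (hs hy) }
  smooth_Ω := h.smooth_Ω.mono hs
  smooth_τ := fun a b => (h.smooth_τ a b).mono hs
  lam_pos := h.lam_pos
  pos := fun y hy => h.pos y (interior_mono hs hy)
  einstein := fun y hy => h.einstein y (interior_mono hs hy)

/-! ### Boundary points in an arbitrary chart -/

section Boundary

variable {M : Type*} [TopologicalSpace M] [ChartedSpace (EuclideanHalfSpace 4) M]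
  [IsManifold (𝓡∂ 4) ∞ M] {e : OpenPartialHomeomorph M (EuclideanHalfSpace 4)}
  (he : e ∈ IsManifold.maximalAtlas (𝓡∂ 4) ∞ M)
include he

omit [IsManifold (𝓡∂ 4) ∞ M] in
-- Boundary points are defined by the preferred chart at the point. Any other chart of the atlas is
-- a local diffeomorphism to the half-space, and these preserve boundary points.
lemma mem_boundary_iff {p : M} (hp : p ∈ e.source) :
    p ∈ (𝓡∂ 4).boundary M ↔ e.extend (𝓡∂ 4) p 0 = 0 := by
  let Φ : PartialDiffeomorph (𝓡∂ 4) (𝓡∂ 4) M (EuclideanHalfSpace 4) ∞ :=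
    { toPartialEquiv := e.toPartialEquiv
      open_source := e.open_source
      open_target := e.open_target
      contMDiffOn_toFun := contMDiffOn_of_mem_maximalAtlas he
      contMDiffOn_invFun := contMDiffOn_symm_of_mem_maximalAtlas he }
  have h1 : IsLocalDiffeomorphAt (𝓡∂ 4) (𝓡∂ 4) ∞ e p := ⟨Φ, hp, fun _ _ => rfl⟩
  have h2 := h1.isBoundaryPoint_iff (by simp)
  refine h2.trans ?_
  rw [ModelWithCorners.IsBoundaryPoint, frontier_range_modelWithCornersEuclideanHalfSpace]
  exact eq_comm

omit [IsManifold (𝓡∂ 4) ∞ M] in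
lemma symm_mem_boundary_iff {y : E 4} (hy : y ∈ (e.extend (𝓡∂ 4)).target) :
    (e.extend (𝓡∂ 4)).symm y ∈ (𝓡∂ 4).boundary M ↔ y 0 = 0 := by
  have h1 := (e.extend (𝓡∂ 4)).map_target hy
  rw [e.extend_source] at h1
  rw [mem_boundary_iff he h1, (e.extend (𝓡∂ 4)).right_inv hy]

omit [IsManifold (𝓡∂ 4) ∞ M] in
lemma symm_notMem_boundary {y : E 4} (hy : y ∈ interior (e.extend (𝓡∂ 4)).target) :
    (e.extend (𝓡∂ 4)).symm y ∉ (𝓡∂ 4).boundary M := by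
  rw [symm_mem_boundary_iff he (interior_subset hy)]
  have h1 := interior_mono e.extend_target_subset_range hy
  rw [interior_range_modelWithCornersEuclideanHalfSpace] at h1
  exact (ne_of_lt h1).symm

end Boundary

namespace IsAsymptoticallyDeSitter

variable {Mt : Type*} [TopologicalSpace Mt] [ChartedSpace (E 4) Mt] [IsManifold (𝓡 4) ∞ Mt]
  {M : Type*} [TopologicalSpace M] [ChartedSpace (EuclideanHalfSpace 4) M]
  {gt Tt : Tensor2 (𝓡 4) Mt} {g τ : Tensor2 (𝓡∂ 4) M}
  {Ω : M → ℝ} {φ : Mt → M} {Λ : ℝ} {q : ℕ} (h : IsAsymptoticallyDeSitter gt Tt g τ Ω φ Λ q)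
  {e : OpenPartialHomeomorph M (EuclideanHalfSpace 4)}
  (he : e ∈ IsManifold.maximalAtlas (𝓡∂ 4) ∞ M)
include h he

omit [IsManifold (𝓡 4) ∞ Mt] in
lemma Ω_eq_zero {y : E 4} (hy : y ∈ (e.extend (𝓡∂ 4)).target) (h0 : y 0 = 0) :
    (localMatter g τ Ω Λ e).Ω y = 0 :=
  (h.zero_Ω _).2 ((symm_mem_boundary_iff he hy).2 h0)

omit [IsManifold (𝓡 4) ∞ Mt] in
lemma Ω_pos {y : E 4} (hy : y ∈ interior (e.extend (𝓡∂ 4)).target) :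
    0 < (localMatter g τ Ω Λ e).Ω y :=
  lt_of_le_of_ne (h.nonneg_Ω _) fun h0 => symm_notMem_boundary he hy ((h.zero_Ω _).1 h0.symm)

omit [IsManifold (𝓡 4) ∞ Mt] in
lemma contDiffOn_Ω : ContDiffOn ℝ ∞ (localMatter g τ Ω Λ e).Ω (e.extend (𝓡∂ 4)).target :=
  contMDiffOn_iff_contDiffOn.1 (h.smooth_Ω.comp_contMDiffOn (contMDiffOn_extend_symm_target he))

/-- The Einstein equations for the unphysical fields at an interior point of a chart. -/
lemma einsteinAt {y : E 4} (hy : y ∈ interior (e.extend (𝓡∂ 4)).target) :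
    (localMatter g τ Ω Λ e).EinsteinAt q y := by
  have hyt := interior_subset hy
  have hP : (e.extend (𝓡∂ 4)).symm y ∈ Set.range φ := by
    rw [h.range_embedding]
    exact symm_notMem_boundary he hy
  obtain ⟨x, hx⟩ := hP
  have hxe : e.extend (𝓡∂ 4) (φ x) = y := by rw [hx, (e.extend (𝓡∂ 4)).right_inv hyt]
  have hxs : φ x ∈ e.source := by
    rw [hx, ← e.extend_source (I := 𝓡∂ 4)]
    exact (e.extend (𝓡∂ 4)).map_target hyt
  -- In the pulled-back chart f the embedding is the identity in coordinates, so physical and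
  -- unphysical components differ by powers of Ω only.
  obtain ⟨f, hf, hyf, hfe, hφf⟩ := exists_pullback_chart h.embedding he hxs (hxe ▸ hy)
  rw [hxe] at hyf
  let V : Region 4 := Region.inter (𝓡∂ 4) f.open_target
  have hVf : ∀ z ∈ V.carrier, z ∈ f.target := fun z hz => hz.2
  have hfV : f.target ⊆ V.carrier := fun z hz =>
    ⟨e.extend_target_subset_range (interior_subset (hfe hz)), hz⟩
  have hVt : V.carrier ⊆ (e.extend (𝓡∂ 4)).target := fun z hz => interior_subset (hfe hz.2)
  have hreg : V.IsRegular (localMatter g τ Ω Λ e).toLocalMetric :=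
    { nhds := fun z hz => nhdsWithin_region_inter (𝓡∂ 4) f.open_target hz
      smooth := fun a b => (h.lorentz.smooth e he a b).mono hVt
      symm := fun z hz a b => h.lorentz.comp_symm z a b
      det := fun z hz => h.lorentz.det_ne_zero he (hVt hz) }
  have hΩs := (h.contDiffOn_Ω he).mono hVt
  have hpos : ∀ z ∈ V.carrier, 0 < (localMatter g τ Ω Λ e).Ω z :=
    fun z hz => h.Ω_pos he (hfe (hVf z hz))
  have hg : ∀ z ∈ V.carrier, ∀ a b, (localMetric (𝓡 4) gt f).g z a b
      = ((localMatter g τ Ω Λ e).Ω z)⁻¹ ^ 2 * (localMatter g τ Ω Λ e).g z a b :=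
    fun z hz a b => comp_pullback h.embedding hf hfe hφf (c := fun p => (Ω p)⁻¹ ^ 2)
      h.conformal (hVf z hz) a b
  have hYm : ∀ z ∈ V.carrier, (localMetric (𝓡 4) gt f).g z
      = ((localMatter g τ Ω Λ e).Ω z)⁻¹ ^ 2 • (localMatter g τ Ω Λ e).g z :=
    fun z hz => Matrix.ext fun a b => hg z hz a b
  have hY : V.IsRegular (localMetric (𝓡 4) gt f) :=
    { nhds := fun z hz => by
        change 𝓝[Set.range (𝓡 4)] z = _
        rw [(𝓡 4).range_eq_univ, nhdsWithin_univ]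
        exact (nhdsWithin_eq_nhds.2 (Filter.mem_of_superset
          (f.open_target.mem_nhds (hVf z hz)) hfV)).symm
      smooth := fun a b => (((hΩs.inv fun z hz => (hpos z hz).ne').pow 2).mul
        (hreg.smooth a b)).congr fun z hz => hg z hz a b
      symm := fun z hz a b => by rw [hg z hz, hg z hz, hreg.symm z hz]
      det := fun z hz => by
        rw [hYm z hz, Matrix.det_smul]
        exact mul_ne_zero (pow_ne_zero _ (pow_ne_zero _ (inv_ne_zero (hpos z hz).ne')))
          (hreg.det z hz) }
  refine Region.einsteinAt_of_conformal hreg (Om := Region.of _ hΩs) (fun z hz => rfl)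
    (τ := fun a b => Region.of _ ((h.smooth_τ e he a b).mono hVt)) (fun a b z hz => rfl) q hY hpos
    hg ?_ (hfV hyf)
  intro z hz a b
  have h1 := h.einstein f hf z (by simpa using hVf z hz) a b
  rw [comp_pullback h.embedding hf hfe hφf (c := fun p => Ω p ^ q) h.decay (hVf z hz) a b] at h1
  rw [show 3 * (localMatter g τ Ω Λ e).lam = Λ by change 3 * (Λ / 3) = Λ; ring]
  exact h1

lemma isMatter (hΛ : 0 < Λ) {O : Set (E 4)} (hO : IsOpen O)
    (hOe : Set.range (𝓡∂ 4) ∩ O ⊆ (e.extend (𝓡∂ 4)).target) :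
    (Region.inter (𝓡∂ 4) hO).IsMatter (localMatter g τ Ω Λ e) q where
  regular :=
    { nhds := fun _ hz => nhdsWithin_region_inter (𝓡∂ 4) hO hz
      smooth := fun a b => (h.lorentz.smooth e he a b).mono hOe
      symm := fun z _ a b => h.lorentz.comp_symm z a b
      det := fun _ hz => h.lorentz.det_ne_zero he (hOe hz) }
  smooth_Ω := (h.contDiffOn_Ω he).mono hOe
  smooth_τ := fun a b => (h.smooth_τ e he a b).mono hOe
  lam_pos := div_pos hΛ three_pos
  pos := fun _ hy => h.Ω_pos he (interior_mono hOe hy)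
  einstein := fun _ hy => h.einsteinAt he (interior_mono hOe hy)

/-- Near a boundary point, the unphysical fields satisfy the Einstein equations on a region where
the normal is not null. -/
lemma exists_isMatter (hΛ : 0 < Λ) {x : E 4} (hx : x ∈ (e.extend (𝓡∂ 4)).target) (hx0 : x 0 = 0) :
    ∃ (V : Region 4) (hV : V.IsMatter (localMatter g τ Ω Λ e) q) (Ni : V.Alg),
      x ∈ V.carrier ∧ V.carrier ⊆ (e.extend (𝓡∂ 4)).target ∧ hV.matter.N * Ni = 1 := by
  have hO : IsOpen ((𝓡∂ 4).symm ⁻¹' e.target) := e.open_target.preimage (𝓡∂ 4).continuous_symm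
  have hT : Set.range (𝓡∂ 4) ∩ (𝓡∂ 4).symm ⁻¹' e.target = (e.extend (𝓡∂ 4)).target := by
    rw [e.extend_target, Set.inter_comm]
  have h1 := h.isMatter he hΛ hO hT.subset
  have hx1 : x ∈ (Region.inter (𝓡∂ 4) hO).carrier := hT.symm.subset hx
  have hn : (localMatter g τ Ω Λ e).nn x = -1 := h1.nn_boundary hx1 (h.Ω_eq_zero he hx hx0)
  -- The norm of n is −1 at x. Shrinking the region to the relatively open set where it does not
  -- vanish makes N a unit, so that the projections are defined over the algebra.
  obtain ⟨u, hu, hu'⟩ := continuousOn_iff'.1 h1.rep_nn.contDiffOn.continuousOn {0}ᶜ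
    isOpen_compl_singleton
  have hsub : (Region.inter (𝓡∂ 4) (hO.inter hu)).carrier ⊆ (Region.inter (𝓡∂ 4) hO).carrier :=
    fun y hy => ⟨hy.1, hy.2.1⟩
  have h2 := h1.mono hsub fun y hy => nhdsWithin_region_inter (𝓡∂ 4) (hO.inter hu) hy
  have hxu : x ∈ u ∩ (Region.inter (𝓡∂ 4) hO).carrier := by
    rw [← hu']
    refine ⟨?_, hx1⟩
    change (localMatter g τ Ω Λ e).nn x ≠ 0
    rw [hn]
    norm_num
  have hunit : IsUnit h2.matter.N := Region.isUnit_of_ne_zero fun y hy h0 => by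
    have h3 := h2.rep_nn y hy
    rw [map_smul, h0, smul_zero] at h3
    have h4 : y ∈ u ∩ (Region.inter (𝓡∂ 4) hO).carrier := ⟨hy.2.2, hsub hy⟩
    rw [← hu'] at h4
    exact h4.1 h3
  obtain ⟨Ni, hNi⟩ := hunit.exists_right_inv
  exact ⟨_, h2, Ni, ⟨hx1.1, hx1.2, hxu.1⟩, hsub.trans hT.subset, hNi⟩

end IsAsymptoticallyDeSitter

end

end AdS

end

/-! ### The theorem at a boundary point, in an arbitrary chart around it -/

theorem theorem3
    {Mt : Type*} [TopologicalSpace Mt] [ChartedSpace (AdS.E 4) Mt] [IsManifold (𝓡 4) ∞ Mt]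
    {M : Type*} [TopologicalSpace M] [ChartedSpace (EuclideanHalfSpace 4) M]
    [IsManifold (𝓡∂ 4) ∞ M]
    (gt Tt : AdS.Tensor2 (𝓡 4) Mt) (g τ : AdS.Tensor2 (𝓡∂ 4) M)
    (Ω : M → ℝ) (φ : Mt → M) (Λ : ℝ) (hΛ : 0 < Λ) (q : ℕ) (hq : q ∈ ({0, 1, 2} : Set ℕ))
    (h : AdS.IsAsymptoticallyDeSitter gt Tt g τ Ω φ Λ q)
    (e : OpenPartialHomeomorph M (EuclideanHalfSpace 4))
    (he : e ∈ IsManifold.maximalAtlas (𝓡∂ 4) ∞ M)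
    (p : M) (hpe : p ∈ e.source) (hp : p ∈ (𝓡∂ 4).boundary M) :
    let X := AdS.localMatter g τ Ω Λ e
    let x := e.extend (𝓡∂ 4) p
    let half : Set (AdS.E 4) := Set.range (𝓡∂ 4)
    -- the boundary is umbilic
    (∀ a b, X.Kfree x a b = 0) ∧
    -- the two constraints on the matter fields
    (∀ a, X.constr q x a = 0) ∧
    (∀ a, X.dn1 (X.constr q) x a - X.div2 X.τ x a = 0) ∧
    -- the norm of the normal
    (fun y => X.nn y - (-1 + 2 / (4 * X.lam) * (X.Ω y * (X.lap X.Ω y + X.J y * X.Ω y))))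
      =O[𝓝[half] x] (fun y => X.Ω y ^ (q + 2)) ∧
    X.nn x = -1 ∧
    (q = 0 →
      (∀ a b, X.weylE x a b = 1 / 2 * X.topFree X.τ x a b) ∧
      (∀ a b, X.dn2 (X.top2 X.τ) x a b + 2 / 3 * X.H x * X.top2 X.τ x a b = 0)) ∧
    (q = 1 →
      (∀ a b c d, X.weyl x a b c d = 0) ∧
      (∀ a b, X.τ x a b = - X.nrm x a * X.nrm x b * X.τtr x) ∧
      -- the expansion `τ_{an}^⊤ = Ω j_a + O(Ω²)` defines `j_a`
      (∃ j : AdS.E 4 → Fin 4 → ℝ,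
        (∀ a, ContDiffWithinAt ℝ ∞ (fun y => j y a) half x) ∧
        (∀ a, (fun y => X.top1 (X.ctr X.τ) y a - X.Ω y * j y a)
          =O[𝓝[half] x] (fun y => X.Ω y ^ 2)) ∧
        (∀ i : Fin 3, X.divCotton x i =
          X.lam * j x i.succ - √X.lam / 3 * X.gradTop X.τtr x i.succ)) ∧
      (∀ a b, X.topFree X.bach x a b = √X.lam / 3 *
        (9 * X.dn2 (X.top2 X.τ) x a b - 3 * X.gbar x a b * X.dn0 (X.ctr2 X.τ) x
          + 8 * X.H x * X.top2 X.τ x a b - X.H x * X.gbar x a b * X.ctr2 X.τ x)) ∧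
      X.ctr2 X.bach x = 0 ∧
      (∀ a, X.top1 (X.ctr X.bach) x a =
        √X.lam * (X.dn1 (X.top1 (X.ctr X.τ)) x a + 1 / 3 * X.gradTop X.τtr x a))) ∧
    (q = 2 →
      (∀ a b c d, X.weyl x a b c d = 0) ∧
      (∀ i : Fin 3, X.divCotton x i = X.lam * X.top1 (X.ctr X.τ) x i.succ) ∧
      (∀ a b, X.topFree (fun y c d => X.bach y c d + 3 * X.lam * X.τ y c d) x a b = 0) ∧
      X.ctr2 X.bach x = 0 ∧
      (∀ a, X.top1 (X.ctr X.bach) x a = - X.lam * X.top1 (X.ctr X.τ) x a)) := by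
  intro X x half
  have hx : x ∈ (e.extend (𝓡∂ 4)).target :=
    (e.extend (𝓡∂ 4)).map_source (by rwa [e.extend_source])
  have hx0 : x 0 = 0 := (AdS.mem_boundary_iff he hpe).1 hp
  obtain ⟨V, hV, Ni, hxV, hVe, hNi⟩ := h.exists_isMatter he hΛ hx hx0
  exact hV.boundary_constraints hxV (h.Ω_eq_zero he hx hx0) hNi
    (range_modelWithCornersEuclideanHalfSpace 4) hx0 fun y hy hy0 => h.Ω_eq_zero he (hVe hy) hy0
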